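/- **Theorem 3.** Let $p\ge 3$, $T\in(0,\infty)$, $\mu\in\{1,-1\}$, let $\alpha_1,\alpha_2\in(0,2]\setminus\{1\}$ with $\alpha_1\ge\alpha_2$, put $\alpha=\frac{2\alpha_2}{\alpha_1}$, and let $\frac12+\frac1\alpha<s\le\lfloor p\rfloor-1$. Let $H^s_\alpha$ be the space of $f\in L^2(\mathbb R^2)$ with $\|f\|_{H^s_\alpha}=\|(1+|\xi|^2+|\eta|^\alpha)^{s/2}\widehat f(\xi,\eta)\|_{L^2_{\xi,\eta}}<\infty$, where $(\xi,\eta)$ are the variables dual to $(x,y)$, and let $D_1=(-\partial_{xx})^{1/2}$, $D_2=(-\partial_{yy})^{1/2}$. Let $A\subseteq((0,2]\setminus\{1\})^2$ be a set of pairs of exponents with $(\alpha_1,\alpha_2)\in A$ (for instance $A=((0,2]\setminus\{1\})^2$). For every $(\alpha_1',\alpha_2')\in A$ let $u_0^{(\alpha_1',\alpha_2')}\in H^s_\alpha$, and let $u^{(\alpha_1',\alpha_2')}\in C([0,T];H^s_\alpha)$ be a solution on $[0,T]$ of $$i\partial_t u=(D_1^{\alpha_1'}+D_2^{\alpha_2'})u+\mu|u|^{p-1}u,\qquad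 u(0)=u_0^{(\alpha_1',\alpha_2')},$$ in the sense of the integral equation $$u(t)=U(t)u_0^{(\alpha_1',\alpha_2')}-i\mu\int_0^tU(t-t')\big(|u(t')|^{p-1}u(t')\big)\,dt',\qquad U(t)=e^{-it(D_1^{\alpha_1'}+D_2^{\alpha_2'})},\quad t\in[0,T].$$ Suppose that $u_0^{(\alpha_1',\alpha_2')}\to u_0^{(\alpha_1,\alpha_2)}$ in $H^s_\alpha$ as $(\alpha_1',\alpha_2')\to(\alpha_1,\alpha_2)$ in $A$, and that for some $c>0$ and $R>0$ $$\sup_{\substack{(\alpha_1',\alpha_2')\in A\\ |\alpha_1-\alpha_1'|+|\alpha_2-\alpha_2'|<R}}\big\|u^{(\alpha_1',\alpha_2')}\big\|_{L^{p-1}_tL^\infty([0,T]\times\mathbb R^2)}\le c\,\big\|u^{(\alpha_1,\alpha_2)}\big\|_{L^{p-1}_tL^\infty([0,T]\times\mathbb R^2)}<\infty .$$ Then $u^{(\alpha_1',\alpha_2')}\to u^{(\alpha_1,\alpha_2)}$ in $C([0,T];H^s_\alpha)$ as $(\alpha_1',\alpha_2')\to(\alpha_1,\alpha_2)$ in $A$.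 -/

import Mathlib

open MeasureTheory Filter Topology Set
open scoped ENNReal FourierTransform

noncomputable section

namespace MixedNLS

/-- The plane `ℝ²` with coordinates `(x, y) = (z 0, z 1)`. -/
abbrev Plane : Type := EuclideanSpace ℝ (Fin 2)

/-- `L²(ℝ²; ℂ)`. -/
abbrev L2 : Type := Lp ℂ 2 (volume : Measure Plane)

/-- The frequency variable dual to the `i`-th coordinate, normalized so that `∂ᵢ` has symbol
`√-1 * freq i k`. The factor `2π` comes from the kernel `exp (-2π √-1 ⟨z, k⟩)` of `𝓕`. -/
def freq (i : Fin 2) (k : Plane) : ℝ := 2 * Real.pi * k i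

/-- The symbol `(1 + ξ² + |η|^α)^{s/2}`. -/
def sobolevWeight (α s : ℝ) (k : Plane) : ℝ :=
  (1 + |freq 0 k| ^ 2 + |freq 1 k| ^ α) ^ (s / 2)

/-- The norm of the anisotropic Sobolev space `H^s_α`, with value `∞` off the space. -/
def hsNorm (α s : ℝ) (f : L2) : ℝ≥0∞ :=
  eLpNorm (fun k : Plane => (sobolevWeight α s k : ℂ) * (𝓕 f : L2) k) 2 volume

/-- `f ∈ H^s_α` (for `s ≥ 0`, where `H^s_α ⊆ L²`). -/
def MemHs (α s : ℝ) (f : L2) : Prop := hsNorm α s f < ∞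

/-- `u ∈ C([0,T]; H^s_α)`; the values of `u` outside `[0,T]` play no role. -/
def MemCHs (T α s : ℝ) (u : ℝ → L2) : Prop :=
  (∀ t ∈ Icc 0 T, MemHs α s (u t)) ∧
    ∀ t₀ ∈ Icc 0 T, Tendsto (fun t => hsNorm α s (u t - u t₀)) (𝓝[Icc 0 T] t₀) (𝓝 0)

/-- The distance of `u` and `v` in `C([0,T]; H^s_α)`. -/
def cHsDist (T α s : ℝ) (u v : ℝ → L2) : ℝ≥0∞ :=
  ⨆ t ∈ Icc 0 T, hsNorm α s (u t - v t)

/-- The norm of `u` in `L^q_t L^∞([0,T] × ℝ²)`. -/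
def lqLinftyNorm (T q : ℝ) (u : ℝ → L2) : ℝ≥0∞ :=
  (∫⁻ t in Icc 0 T, eLpNorm (u t) ∞ volume ^ q) ^ (1 / q)

/-- The symbol `|ξ|^{a₁} + |η|^{a₂}` of `D₁^{a₁} + D₂^{a₂}`. -/
def dispersion (a : ℝ × ℝ) (k : Plane) : ℝ :=
  |freq 0 k| ^ a.1 + |freq 1 k| ^ a.2

/-- The symbol `exp (-√-1 t (|ξ|^{a₁} + |η|^{a₂}))` of the free propagator. -/
def phase (a : ℝ × ℝ) (t : ℝ) (k : Plane) : ℂ :=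
  Complex.exp (-(Complex.I * (t * dispersion a k : ℝ)))

theorem norm_phase (a : ℝ × ℝ) (t : ℝ) (k : Plane) : ‖phase a t k‖ = 1 := by
  rw [phase, Complex.norm_exp]
  simp

theorem measurable_phase (a : ℝ × ℝ) (t : ℝ) : Measurable (phase a t) := by
  unfold phase dispersion freq
  fun_prop

theorem memLp_phase_mul (a : ℝ × ℝ) (t : ℝ) (g : L2) :
    MemLp (fun k : Plane => phase a t k * g k) 2 volume := by
  refine (Lp.memLp g).of_le
    ((measurable_phase a t).aestronglyMeasurable.mul (Lp.aestronglyMeasurable g)) ?_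
  exact Eventually.of_forall fun k => by simp [norm_phase]

/-- The free propagator `U_a(t) = exp (-√-1 t (D₁^{a₁} + D₂^{a₂}))` on `L²`. -/
def propagator (a : ℝ × ℝ) (t : ℝ) (f : L2) : L2 :=
  𝓕⁻ ((memLp_phase_mul a t (𝓕 f)).toLp (fun k : Plane => phase a t k * (𝓕 f : L2) k) : L2)

/-- The power nonlinearity `|z|^{p-1} z`. -/
def power (p : ℝ) (z : ℂ) : ℂ := ((‖z‖ ^ (p - 1) : ℝ) : ℂ) * z

/-- `u` solves `√-1 ∂ₜu = (D₁^{a₁} + D₂^{a₂})u + μ|u|^{p-1}u`, `u(0) = u₀` on `[0,T]`, in the sense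
of the integral representation
`u(t) = U_a(t)u₀ - √-1 μ ∫₀ᵗ U_a(t - t') (|u(t')|^{p-1}u(t')) dt'`.
Here `F t` is `|u(t)|^{p-1}u(t)` as an element of `L²`, and the integral is a convergent Bochner
integral in `L²`. -/
def IsSolution (T p μ : ℝ) (a : ℝ × ℝ) (u₀ : L2) (u : ℝ → L2) : Prop :=
  ∃ F : ℝ → L2,
    (∀ t ∈ Icc 0 T, ∀ᵐ z : Plane, F t z = power p (u t z)) ∧
    ∀ t ∈ Icc 0 T,
      IntervalIntegrable (fun t' => propagator a (t - t') (F t')) volume 0 t ∧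
      u t = propagator a t u₀
        - (Complex.I * (μ : ℂ)) • ∫ t' in (0 : ℝ)..t, propagator a (t - t') (F t')

/-- The admissible dispersion exponents `((0,2] \ {1})²`. -/
def admissible : Set (ℝ × ℝ) :=
  {a | (0 < a.1 ∧ a.1 ≤ 2 ∧ a.1 ≠ 1) ∧ (0 < a.2 ∧ a.2 ≤ 2 ∧ a.2 ≠ 1)}

end MixedNLS

end

open MeasureTheory Filter Topology Set
open scoped ENNReal FourierTransform

noncomputable section

namespace MixedNLS

/-! The proof compares two Duhamel formulas in `H^s_α` by Grönwall's inequality. Two facts carry it: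
the power nonlinearity is Lipschitz on bounded sets of `H^s_α`, and the propagators converge
strongly as the exponents converge, uniformly on compact sets.

For the Lipschitz bound, `s > 1/2 + 1/α` makes the inverse weight square integrable, so `H^s_α`
embeds into functions with integrable Fourier transform (`exists_lintegral_fourier_le`), hence into
`L^∞`. Let `J(z) = |z|^{p-1} z` and `N = ⌊p⌋ - 1 ≤ p - 1`. Since `DJ(z)h` is homogeneous of degree
`p - 1` in `z`, it admits smooth regularizations whose derivatives up to order `N` are locally
bounded, uniformly in the regularization (`exists_norm_iteratedFDeriv_gradReg_le`). The norm of
`H^s_α` is controlled by the `L²` norm and two directional homogeneous norms, of orders `s` and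
`αs/2`, both at most `N`, so composition can be estimated one direction at a time
(`exists_energy_comp_le`). For integer order this is Faà di Bruno plus Gagliardo–Nirenberg with the
Wiener norm as lower endpoint. For fractional order, the tail of the composition beyond frequency
`t` is estimated by truncating the input at `t`, and the tails are integrated in `t`. Removing the
regularization bounds `DJ(w)h` in `H^s_α`, linearly in `h`. The mean value inequality along the
segment from `v` to `u` then yields `exists_hsNorm_power_sub_le`.

For stability, each difference is written `U_a f - U_b g = U_a (f - g) + (U_a - U_b) g`, so the
change of propagator acts only on the data and nonlinearity of the limit solution. These form a
fixed point and a fixed continuous curve in `H^s_α`, and dominated convergence with compactness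
makes the contribution uniformly small (`eventually_gapNorm_le`). The Lipschitz constant applies as
long as the two solutions are within distance one, and a first-exit argument built into Grönwall
(`le_mul_exp_of_le_integral`) shows that they remain so up to time `T`. -/

/-! ### Fourier integrals of functions in `L¹ ∩ L²`. -/

theorem continuous_fourierInv {m : Plane → ℂ} (h1 : Integrable m) : Continuous (𝓕⁻ m) := by
  rw [Real.fourierInv_eq_fourier_comp_neg]
  exact VectorFourier.fourierIntegral_continuous Real.continuous_fourierChar
    (by exact continuous_inner) h1.comp_neg

open SchwartzMap in
/-- On `L¹ ∩ L²` the inverse Fourier transform of `L²` is given by the integral. -/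
theorem fourierInv_toLp_ae {m : Plane → ℂ} (h1 : Integrable m) (h2 : MemLp m 2 volume) :
    ((𝓕⁻ (h2.toLp m : L2) : L2) : Plane → ℂ) =ᵐ[volume] 𝓕⁻ m := by
  -- Both sides are locally integrable, so it suffices to test them against smooth compactly
  -- supported functions, which are Schwartz; the `L²` transform is known through its action on
  -- those.
  refine ae_eq_of_integral_contDiff_smul_eq
    ((Lp.memLp _).locallyIntegrable (by norm_num)) (continuous_fourierInv h1).locallyIntegrable ?_
  intro g gs gc
  have hg₁ : HasCompactSupport (Complex.ofRealCLM ∘ g) := gc.comp_left rfl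
  have hg₂ : ContDiff ℝ (⊤ : ℕ∞) (Complex.ofRealCLM ∘ g) := by fun_prop
  set φ : 𝓢(Plane, ℂ) := hg₁.toSchwartzMap hg₂ with hφ
  have hval : ∀ x, φ x = (g x : ℂ) := fun x => rfl
  have e1 := congrArg (fun d : TemperedDistribution Plane ℂ => d φ)
    (Lp.fourierInv_toTemperedDistribution_eq (h2.toLp m : L2))
  simp only [TemperedDistribution.fourierInv_apply, Lp.toTemperedDistribution_apply] at e1
  have e2 : ∫ x, g x • (𝓕⁻ (h2.toLp m : L2) : L2) x = ∫ x, (𝓕⁻ φ : 𝓢(Plane, ℂ)) x • m x := by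
    rw [show (∫ x, g x • (𝓕⁻ (h2.toLp m : L2) : L2) x)
      = ∫ x, φ x • (𝓕⁻ (h2.toLp m : L2) : L2) x by simp [hval], ← e1]
    refine integral_congr_ae ?_
    filter_upwards [h2.coeFn_toLp] with x hx
    rw [hx]
  -- The inverse kernel is the Fourier kernel of the symmetric form `-⟨·,·⟩`, so duality moves the
  -- transform from `φ` to `m` without changing it.
  have hflip : (-innerₗ Plane).flip = -innerₗ Plane := by
    ext x y; simp [real_inner_comm]
  have e3 := VectorFourier.integral_fourierIntegral_smul_eq_flip (μ := volume) (ν := volume)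
    (L := -innerₗ Plane) Real.continuous_fourierChar
    (by exact continuous_inner.neg) φ.integrable h1
  rw [hflip] at e3
  rw [e2, SchwartzMap.fourierInv_coe]
  refine e3.trans (integral_congr_ae (Eventually.of_forall fun x => ?_))
  simp only [hval, Complex.real_smul, smul_eq_mul]
  rfl

theorem memLp_fourierInv {m : Plane → ℂ} (h1 : Integrable m) (h2 : MemLp m 2 volume) :
    MemLp (𝓕⁻ m) 2 volume :=
  (memLp_congr_ae (fourierInv_toLp_ae h1 h2)).1 (Lp.memLp _)

theorem eLpNorm_fourier (f : L2) : eLpNorm (𝓕 f : L2) 2 volume = eLpNorm f 2 volume := by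
  rw [← Lp.enorm_def, ← Lp.enorm_def, ← ofReal_norm, ← ofReal_norm,
    Lp.norm_fourier_eq]

/-- Plancherel's identity for the inverse Fourier integral. -/
theorem eLpNorm_fourierInv {m : Plane → ℂ} (h1 : Integrable m) (h2 : MemLp m 2 volume) :
    eLpNorm (𝓕⁻ m) 2 volume = eLpNorm m 2 volume := by
  rw [← eLpNorm_congr_ae (fourierInv_toLp_ae h1 h2), ← eLpNorm_fourier,
    FourierTransform.fourier_fourierInv_eq, eLpNorm_congr_ae h2.coeFn_toLp]

theorem norm_fourierInv_le (m : Plane → ℂ) (z : Plane) : ‖(𝓕⁻ m) z‖ ≤ ∫ k, ‖m k‖ := by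
  exact VectorFourier.norm_fourierIntegral_le_integral_norm _ _ _ _ _

/-- An `L²` function whose Fourier transform is integrable is its Fourier integral. -/
theorem ae_eq_fourierInv (f : L2) (h : Integrable (𝓕 f : L2)) :
    (f : Plane → ℂ) =ᵐ[volume] 𝓕⁻ ((𝓕 f : L2) : Plane → ℂ) := by
  have := fourierInv_toLp_ae h (Lp.memLp _)
  rwa [Lp.toLp_coeFn, FourierTransform.fourierInv_fourier_eq] at this

/-! ### Directional derivatives on the Fourier side. -/

/-- The unit vector of the `e`-th coordinate. -/
def unitVec (e : Fin 2) : Plane := EuclideanSpace.single e 1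

theorem inner_unitVec (e : Fin 2) (k : Plane) : inner ℝ k (unitVec e) = k e := by
  simp [unitVec, EuclideanSpace.inner_single_right]

theorem continuous_freq (e : Fin 2) : Continuous (freq e) := by
  unfold freq; fun_prop

@[fun_prop]
theorem measurable_freq (e : Fin 2) : Measurable (freq e) := (continuous_freq e).measurable

/-- Multiplication by the symbol of `∂ₑ ^ j`. -/
def derivSymbol (e : Fin 2) (j : ℕ) (m : Plane → ℂ) (k : Plane) : ℂ :=
  (Complex.I * freq e k) ^ j * m k

theorem norm_derivSymbol (e : Fin 2) (j : ℕ) (m : Plane → ℂ) (k : Plane) :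
    ‖derivSymbol e j m k‖ = |freq e k| ^ j * ‖m k‖ := by
  simp [derivSymbol]

theorem hasDerivAt_fourierInv (e : Fin 2) {m : Plane → ℂ} (h0 : Integrable m)
    (h1 : Integrable (derivSymbol e 1 m)) (z : Plane) (x : ℝ) :
    HasDerivAt (fun x : ℝ => (𝓕⁻ m) (z + x • unitVec e))
      ((𝓕⁻ (derivSymbol e 1 m)) (z + x • unitVec e)) x := by
  have hexp : ∀ x : ℝ, AEStronglyMeasurable (fun k : Plane => Complex.exp
      ((↑(2 * Real.pi * inner ℝ k (z + x • unitVec e)) * Complex.I))) volume :=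
    fun x => Continuous.aestronglyMeasurable (by fun_prop)
  have key := (hasDerivAt_integral_of_dominated_loc_of_deriv_le (μ := (volume : Measure Plane))
    (F := fun (x : ℝ) k => Complex.exp ((↑(2 * Real.pi * inner ℝ k (z + x • unitVec e)) * Complex.I))
      • m k)
    (F' := fun (x : ℝ) k => Complex.exp ((↑(2 * Real.pi * inner ℝ k (z + x • unitVec e)) *
      Complex.I)) • derivSymbol e 1 m k)
    (x₀ := x) (s := univ) (bound := fun k => ‖derivSymbol e 1 m k‖) univ_mem
    (Eventually.of_forall fun x => ?_) ?_ ?_ ?_ h1.norm ?_).2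
  · simpa only [Real.fourierInv_eq'] using key
  · exact (hexp x).smul h0.1
  · refine h0.norm.mono' ((hexp x).smul h0.1) ?_
    exact Eventually.of_forall fun k => by
      rw [norm_smul, Complex.norm_exp_ofReal_mul_I, one_mul]
  · exact (hexp x).smul h1.1
  · exact Eventually.of_forall fun k x _ => by
      rw [norm_smul, Complex.norm_exp_ofReal_mul_I, one_mul]
  · refine Eventually.of_forall fun k x _ => ?_
    have hlin : HasDerivAt (fun x : ℝ => (2 * Real.pi * inner ℝ k (z + x • unitVec e) : ℝ))
        (freq e k) x := by
      simp only [inner_add_right, inner_smul_right, inner_unitVec, freq]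
      have := (((hasDerivAt_id x).mul_const (k e)).const_add (inner ℝ k z)).const_mul (2 * Real.pi)
      simpa using this
    have h2 := ((hlin.ofReal_comp.mul_const Complex.I).cexp).smul_const (m k)
    refine h2.congr_deriv ?_
    simp only [derivSymbol, pow_one, smul_eq_mul]
    ring

open SchwartzMap LineDeriv in
/-- The Fourier transform turns a classical directional derivative in `L²` into multiplication. -/
theorem fourier_lineDeriv_ae (e : Fin 2) {g g' : Plane → ℂ} (hg : MemLp g 2 volume)
    (hg' : MemLp g' 2 volume) (hd : ∀ z, HasLineDerivAt ℝ g (g' z) z (unitVec e)) :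
    ((𝓕 (hg'.toLp g' : L2) : L2) : Plane → ℂ) =ᵐ[volume]
      derivSymbol e 1 ((𝓕 (hg.toLp g : L2) : L2) : Plane → ℂ) := by
  -- The classical derivative is also the distributional one: integrate by parts against a Schwartz
  -- function, every product being integrable as a product of `L²` functions.
  have hdist : ((hg'.toLp g' : L2) : TemperedDistribution Plane ℂ)
      = ∂_{unitVec e} ((hg.toLp g : L2) : TemperedDistribution Plane ℂ) := by
    ext φ
    rw [TemperedDistribution.lineDerivOp_apply_apply]
    simp only [Lp.toTemperedDistribution_apply]
    have hφ := φ.memLp 2 (volume : Measure Plane)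
    have hφ' := (∂_{unitVec e} φ : 𝓢(Plane, ℂ)).memLp 2 (volume : Measure Plane)
    have ibp := integral_bilinear_hasLineDerivAt_right_eq_neg_left_of_integrable
      (μ := (volume : Measure Plane)) (B := ContinuousLinearMap.mul ℝ ℂ) (v := unitVec e)
      (f := fun x => φ x) (f' := fun x => (∂_{unitVec e} φ : 𝓢(Plane, ℂ)) x) (g := g) (g' := g')
      (hφ'.integrable_mul hg) (hφ.integrable_mul hg') (hφ.integrable_mul hg)
      (fun x _ => ?_) (fun x _ => hd x)
    · have e1 : ∫ x, φ x • (hg'.toLp g' : L2) x = ∫ x, φ x * g' x :=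
        integral_congr_ae (hg'.coeFn_toLp.mono fun x hx => by simp [hx])
      have e2 : ∫ x, (∂_{unitVec e} φ : 𝓢(Plane, ℂ)) x • (hg.toLp g : L2) x
          = ∫ x, (∂_{unitVec e} φ : 𝓢(Plane, ℂ)) x * g x :=
        integral_congr_ae (hg.coeFn_toLp.mono fun x hx => by simp [hx])
      simp only [ContinuousLinearMap.mul_apply'] at ibp
      have e3 : ∫ x, (-(∂_{unitVec e} φ) : 𝓢(Plane, ℂ)) x • (hg.toLp g : L2) x
          = -∫ x, (∂_{unitVec e} φ : 𝓢(Plane, ℂ)) x • (hg.toLp g : L2) x := by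
        rw [← integral_neg]; simp
      rw [e1, ibp, e3, e2]
    · rw [SchwartzMap.lineDerivOp_apply]
      exact (φ.differentiableAt.lineDifferentiableAt).hasLineDerivAt
  have hF := congrArg (fun d : TemperedDistribution Plane ℂ => 𝓕 d) hdist
  simp only [TemperedDistribution.fourier_lineDerivOp_eq, Lp.fourier_toTemperedDistribution_eq]
    at hF
  refine ae_eq_of_integral_contDiff_smul_eq
    ((Lp.memLp _).locallyIntegrable (by norm_num)) ?_ ?_
  · have := (((Lp.memLp (𝓕 (hg.toLp g : L2) : L2)).locallyIntegrable (by norm_num))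
      |>.locallyIntegrableOn univ).continuousOn_mul
      (g := fun k => Complex.I * freq e k) (by have := continuous_freq e; fun_prop)
      isOpen_univ.isLocallyClosed
    rw [locallyIntegrableOn_univ] at this
    have hsym : derivSymbol e 1 ((𝓕 (hg.toLp g : L2) : L2) : Plane → ℂ)
        = fun k => Complex.I * freq e k * (𝓕 (hg.toLp g : L2) : L2) k := by
      ext k; simp [derivSymbol]
    rwa [hsym]
  intro φ gs gc
  have hg₁ : HasCompactSupport (Complex.ofRealCLM ∘ φ) := gc.comp_left rfl
  have hg₂ : ContDiff ℝ (⊤ : ℕ∞) (Complex.ofRealCLM ∘ φ) := by fun_prop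
  set ψ : 𝓢(Plane, ℂ) := hg₁.toSchwartzMap hg₂ with hφ
  have hval : ∀ x, ψ x = (φ x : ℂ) := fun x => rfl
  have e1 := congrArg (fun d : TemperedDistribution Plane ℂ => d ψ) hF
  have htg : (fun k : Plane => (inner ℝ k (unitVec e) : ℂ)).HasTemperateGrowth := by fun_prop
  simp only [Lp.toTemperedDistribution_apply, smul_eq_mul, FunLike.coe_smul, Pi.smul_apply,
    TemperedDistribution.smulLeftCLM_apply_apply, SchwartzMap.smulLeftCLM_apply_apply htg] at e1
  rw [← integral_const_mul] at e1
  have e2 : ∫ x, φ x • (𝓕 (hg'.toLp g' : L2) : L2) x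
      = ∫ x, ψ x * (𝓕 (hg'.toLp g' : L2) : L2) x := by simp [hval]
  rw [e2, e1]
  refine integral_congr_ae (Eventually.of_forall fun x => ?_)
  simp only [hval, derivSymbol, inner_unitVec, freq, Complex.real_smul]
  push_cast
  ring

/-! ### Level-set integration and a Gagliardo–Nirenberg inequality. -/

/-- Tonelli. It serves all the arguments that split frequencies at a height depending on `t` and
then integrate in `t`. -/
theorem lintegral_mul_setLIntegral_swap {w : ℝ → ℝ≥0∞} (hw : Measurable w)
    {φ : Plane → ℝ≥0∞} (hφ : AEMeasurable φ volume) {S : Set (ℝ × Plane)} (hS : MeasurableSet S) :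
    ∫⁻ t in Ioi (0 : ℝ), w t * ∫⁻ k in {k | (t, k) ∈ S}, φ k
      = ∫⁻ k, φ k * ∫⁻ t in Ioi (0 : ℝ) ∩ {t | (t, k) ∈ S}, w t := by
  have hSt : ∀ t, MeasurableSet {k | (t, k) ∈ S} := fun t => measurable_prodMk_left hS
  have hSk : ∀ k, MeasurableSet {t | (t, k) ∈ S} := fun k => measurable_prodMk_right hS
  have e1 : ∀ t, w t * ∫⁻ k in {k | (t, k) ∈ S}, φ k
      = ∫⁻ k, S.indicator (fun x : ℝ × Plane => w x.1 * φ x.2) (t, k) := by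
    intro t
    rw [← lintegral_const_mul'' _ hφ.restrict, ← lintegral_indicator (hSt t)]
    rfl
  have e2 : ∀ k, φ k * ∫⁻ t in Ioi (0 : ℝ) ∩ {t | (t, k) ∈ S}, w t
      = ∫⁻ t in Ioi (0 : ℝ), S.indicator (fun x : ℝ × Plane => w x.1 * φ x.2) (t, k) := by
    intro k
    rw [inter_comm, ← Measure.restrict_restrict (hSk k), ← lintegral_const_mul _ hw,
      ← lintegral_indicator (hSk k)]
    refine lintegral_congr fun t => ?_
    simp only [indicator, mul_comm (φ k)]
    rfl
  simp_rw [e1, e2]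
  refine lintegral_lintegral_swap ?_
  exact ((hw.comp measurable_fst).aemeasurable.mul (hφ.comp_snd)).indicator hS

theorem setLIntegral_rpow_Ioo {a c : ℝ} (ha : 0 < a) (hc : 0 ≤ c) :
    ∫⁻ t in Ioo 0 c, ENNReal.ofReal (t ^ (a - 1)) = ENNReal.ofReal (c ^ a / a) := by
  rw [setLIntegral_congr Ioo_ae_eq_Ioc, ← ofReal_integral_eq_lintegral_ofReal]
  · rw [← intervalIntegral.integral_of_le hc, integral_rpow (Or.inl (by linarith))]
    simp [Real.zero_rpow ha.ne']
  · exact (intervalIntegrable_iff_integrableOn_Ioc_of_le hc).1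
      (intervalIntegral.intervalIntegrable_rpow' (by linarith))
  · exact (ae_restrict_iff' measurableSet_Ioc).2 (Eventually.of_forall fun t ht =>
      Real.rpow_nonneg ht.1.le _)

theorem setLIntegral_rpow_Ici {a c : ℝ} (ha : 0 < a) (hc : 0 < c) :
    ∫⁻ t in Ici c, ENNReal.ofReal (t ^ (-a - 1)) = ENNReal.ofReal (c ^ (-a) / a) := by
  rw [← restrict_Ioi_eq_restrict_Ici, ← ofReal_integral_eq_lintegral_ofReal]
  · rw [integral_Ioi_rpow_of_lt (by linarith) hc]
    congr 1
    simp [neg_div_neg_eq]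
  · exact integrableOn_Ioi_rpow_of_lt (by linarith) hc
  · exact (ae_restrict_iff' measurableSet_Ioi).2 (Eventually.of_forall fun t ht =>
      Real.rpow_nonneg (hc.trans ht).le _)

theorem fourierInv_indicator_add {m : Plane → ℂ} (hm : Integrable m) {S : Set Plane}
    (hS : MeasurableSet S) (z : Plane) :
    (𝓕⁻ m) z = (𝓕⁻ (S.indicator m)) z + (𝓕⁻ (Sᶜ.indicator m)) z := by
  simp only [Real.fourierInv_eq]
  rw [← integral_add]
  · refine integral_congr_ae (Eventually.of_forall fun k => ?_)
    by_cases hk : k ∈ S <;> simp [hk]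
  · have := (Real.fourierIntegral_convergent_iff (-z)).2 (hm.indicator hS)
    simpa using this
  · have := (Real.fourierIntegral_convergent_iff (-z)).2 (hm.indicator hS.compl)
    simpa using this

theorem eLpNorm_two_sq (f : Plane → ℂ) :
    eLpNorm f 2 volume ^ 2 = ∫⁻ k, ‖f k‖ₑ ^ 2 := by
  rw [eLpNorm_eq_lintegral_rpow_enorm_toReal (by norm_num) (by norm_num)]
  simp only [ENNReal.toReal_ofNat, ENNReal.rpow_ofNat]
  rw [← ENNReal.rpow_natCast, ← ENNReal.rpow_mul]
  norm_num

/-- A Gagliardo–Nirenberg inequality in the direction `e`, with the norm of `L¹` of the Fourier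
transform as the lower endpoint. -/
theorem lintegral_fourierInv_derivSymbol_rpow_le (e : Fin 2) (i : ℕ) {q M : ℝ} (hq : 2 < q)
    (hM : 0 < M) {m : Plane → ℂ} (hm : Integrable m) (hmM : ∫ k, ‖m k‖ ≤ M)
    (h1 : Integrable (derivSymbol e i m)) (h2 : MemLp (derivSymbol e i m) 2 volume) :
    ∫⁻ z, ENNReal.ofReal (‖(𝓕⁻ (derivSymbol e i m)) z‖ ^ q)
      ≤ ENNReal.ofReal (4 * q * (2 * M) ^ (q - 2) / (q - 2)) *
        ∫⁻ k, ENNReal.ofReal (|freq e k| ^ (i * q) * ‖m k‖ ^ 2) := by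
  set G := derivSymbol e i m with hG
  -- At height `t` the frequencies are split where `2M|ξₑ|^i = t`. As `M` bounds the `L¹` norm of
  -- `m`, the part with `c ≤ t` has Fourier integral at most `t/2`; hence wherever `|𝓕⁻ G| > t`, the
  -- other part is at least `t/2`.
  set c : Plane → ℝ := fun k => 2 * M * |freq e k| ^ i with hc
  have hcm : Measurable c := by fun_prop
  set S : Set (ℝ × Plane) := {x | x.1 < c x.2} with hSdef
  have hS : MeasurableSet S := measurableSet_lt measurable_fst (hcm.comp measurable_snd)
  have hSt : ∀ t, MeasurableSet {k | (t, k) ∈ S} := fun t => measurable_prodMk_left hS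
  have hGm : AEMeasurable (fun k => ‖G k‖ₑ ^ 2) volume := h1.1.enorm.pow_const 2
  have key : ∀ t : ℝ, 0 < t → volume {z | t < ‖(𝓕⁻ G) z‖} * ENNReal.ofReal (t ^ (q - 1))
      ≤ ENNReal.ofReal (4 * t ^ (q - 2 - 1)) * ∫⁻ k in {k | (t, k) ∈ S}, ‖G k‖ₑ ^ 2 := by
    intro t ht
    set St := {k | (t, k) ∈ S} with hStd
    have hi1 : Integrable (St.indicator G) := h1.indicator (hSt t)
    have hi2 : MemLp (St.indicator G) 2 volume := h2.indicator (hSt t)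
    have hlow : ∀ z, ‖(𝓕⁻ (Stᶜ.indicator G)) z‖ ≤ t / 2 := by
      intro z
      refine (norm_fourierInv_le _ z).trans ?_
      calc ∫ k, ‖Stᶜ.indicator G k‖ ≤ ∫ k, t / (2 * M) * ‖m k‖ := by
            refine integral_mono (h1.indicator (hSt t).compl).norm (hm.norm.const_mul _) fun k => ?_
            by_cases hk : k ∈ St
            · simp only [mem_compl_iff, hk, not_true, not_false_eq_true, indicator_of_notMem,
                norm_zero]
              positivity
            · rw [indicator_of_mem (by exact hk), hG, norm_derivSymbol]
              have : 2 * M * |freq e k| ^ i ≤ t := not_lt.1 hk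
              gcongr
              rw [le_div_iff₀ (by positivity)]
              linarith
        _ = t / (2 * M) * ∫ k, ‖m k‖ := integral_const_mul _ _
        _ ≤ t / (2 * M) * M := by gcongr
        _ = t / 2 := by field_simp
    have hsub : {z | t < ‖(𝓕⁻ G) z‖} ⊆
        {z | ENNReal.ofReal (t / 2) ^ 2 ≤ ‖(𝓕⁻ (St.indicator G)) z‖ₑ ^ 2} := by
      intro z hz
      rw [mem_ofPred_eq, fourierInv_indicator_add h1 (hSt t) z] at hz
      have h3 := norm_add_le ((𝓕⁻ (St.indicator G)) z) ((𝓕⁻ (Stᶜ.indicator G)) z)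
      have h4 := hlow z
      have h5 : t / 2 ≤ ‖(𝓕⁻ (St.indicator G)) z‖ := by linarith
      rw [mem_ofPred_eq, ← ofReal_norm]
      gcongr
    -- Chebyshev and Plancherel for the remaining part. The level is absorbed by `t^{q-1} = 4
    -- t^{q-3} (t/2)²`.
    have hcheb := mul_meas_ge_le_lintegral₀ (μ := (volume : Measure Plane))
      ((continuous_fourierInv hi1).measurable.enorm.pow_const 2).aemeasurable
      (ENNReal.ofReal (t / 2) ^ 2)
    rw [← eLpNorm_two_sq, eLpNorm_fourierInv hi1 hi2, eLpNorm_two_sq] at hcheb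
    have hind : ∫⁻ k, ‖St.indicator G k‖ₑ ^ 2 = ∫⁻ k in St, ‖G k‖ₑ ^ 2 := by
      rw [← lintegral_indicator (hSt t)]
      refine lintegral_congr fun k => ?_
      change _ = St.indicator _ k
      by_cases hk : k ∈ St <;> simp [hk]
    rw [hind] at hcheb
    calc volume {z | t < ‖(𝓕⁻ G) z‖} * ENNReal.ofReal (t ^ (q - 1))
        ≤ volume {z | ENNReal.ofReal (t / 2) ^ 2 ≤ ‖(𝓕⁻ (St.indicator G)) z‖ₑ ^ 2} *
          (ENNReal.ofReal (4 * t ^ (q - 2 - 1)) * ENNReal.ofReal (t / 2) ^ 2) := by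
          gcongr
          rw [← ENNReal.ofReal_pow (by positivity), ← ENNReal.ofReal_mul (by positivity)]
          refine ENNReal.ofReal_le_ofReal (le_of_eq ?_)
          rw [show q - 1 = (q - 2 - 1) + 2 by ring, Real.rpow_add ht, Real.rpow_two]
          ring
      _ = ENNReal.ofReal (4 * t ^ (q - 2 - 1)) * (ENNReal.ofReal (t / 2) ^ 2 *
          volume {z | ENNReal.ofReal (t / 2) ^ 2 ≤ ‖(𝓕⁻ (St.indicator G)) z‖ₑ ^ 2}) := by ring
      _ ≤ _ := by gcongr
  -- Layer cake formula. After Tonelli the inner integral of `t^{q-3}` over `0 < t < c k` converges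
  -- because `q > 2`, and the powers of the frequency add up to `2i + i(q-2) = iq`.
  rw [lintegral_rpow_eq_lintegral_meas_lt_mul volume (Eventually.of_forall fun z => norm_nonneg _)
    (continuous_fourierInv h1).norm.measurable.aemeasurable (by linarith)]
  calc ENNReal.ofReal q * ∫⁻ t in Ioi 0, volume {z | t < ‖(𝓕⁻ G) z‖} * ENNReal.ofReal (t ^ (q - 1))
      ≤ ENNReal.ofReal q * ∫⁻ t in Ioi 0, ENNReal.ofReal (4 * t ^ (q - 2 - 1)) *
        ∫⁻ k in {k | (t, k) ∈ S}, ‖G k‖ₑ ^ 2 := by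
        gcongr 1
        exact setLIntegral_mono' measurableSet_Ioi fun t ht => key t ht
    _ = ENNReal.ofReal q * ∫⁻ k, ‖G k‖ₑ ^ 2 * ∫⁻ t in Ioi 0 ∩ {t | (t, k) ∈ S},
          ENNReal.ofReal (4 * t ^ (q - 2 - 1)) := by
        rw [lintegral_mul_setLIntegral_swap (by fun_prop) hGm hS]
    _ = _ := by
        have : ∀ k, ‖G k‖ₑ ^ 2 * ∫⁻ t in Ioi 0 ∩ {t | (t, k) ∈ S},
            ENNReal.ofReal (4 * t ^ (q - 2 - 1))
            = ENNReal.ofReal (4 * (2 * M) ^ (q - 2) / (q - 2)) *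
              ENNReal.ofReal (|freq e k| ^ (i * q) * ‖m k‖ ^ 2) := by
          intro k
          have hset : Ioi 0 ∩ {t | (t, k) ∈ S} = Ioo 0 (c k) := by ext t; simp [hSdef]
          have hck : 0 ≤ c k := by positivity
          simp_rw [hset, ENNReal.ofReal_mul (show (0:ℝ) ≤ 4 by norm_num)]
          rw [lintegral_const_mul _ (by fun_prop),
            setLIntegral_rpow_Ioo (by linarith) hck, ← ofReal_norm, hG, norm_derivSymbol,
            ← ENNReal.ofReal_pow (by positivity), ← ENNReal.ofReal_mul (by norm_num),
            ← ENNReal.ofReal_mul (by positivity), ← ENNReal.ofReal_mul (by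
              have : 0 < q - 2 := by linarith
              positivity)]
          congr 1
          rw [hc, Real.mul_rpow (by positivity) (by positivity), ← Real.rpow_natCast |freq e k| i,
            ← Real.rpow_mul (abs_nonneg _), mul_pow, ← Real.rpow_natCast (_ ^ _) 2,
            ← Real.rpow_mul (abs_nonneg _)]
          have hsum : |freq e k| ^ ((i : ℝ) * q) =
              |freq e k| ^ ((i : ℝ) * (2 : ℕ)) * |freq e k| ^ ((i : ℝ) * (q - 2)) := by
            rw [← Real.rpow_add_of_nonneg (abs_nonneg _) (by positivity)
              (mul_nonneg (by positivity) (by linarith))]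
            congr 1; push_cast; ring
          rw [hsum]
          ring
        simp_rw [this]
        rw [lintegral_const_mul' _ _ ENNReal.ofReal_ne_top, ← mul_assoc,
          ← ENNReal.ofReal_mul (by linarith)]
        congr 2
        ring

/-! ### Directional energies. -/

/-- `∫ |ξₑ|^{2r} |m|²`, the square of a directional homogeneous Sobolev norm on the Fourier side. -/
def energy (e : Fin 2) (r : ℝ) (m : Plane → ℂ) : ℝ≥0∞ :=
  ∫⁻ k, ENNReal.ofReal (|freq e k| ^ (2 * r) * ‖m k‖ ^ 2)

theorem eLpNorm_derivSymbol_sq (e : Fin 2) (n : ℕ) (m : Plane → ℂ) :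
    eLpNorm (derivSymbol e n m) 2 volume ^ 2 = energy e n m := by
  rw [eLpNorm_two_sq, energy]
  refine lintegral_congr fun k => ?_
  rw [← ofReal_norm, norm_derivSymbol, ← ENNReal.ofReal_pow (by positivity), mul_pow, ← pow_mul,
    ← Real.rpow_natCast]
  congr 3
  push_cast; ring

theorem derivSymbol_succ (e : Fin 2) (j : ℕ) (m : Plane → ℂ) :
    derivSymbol e 1 (derivSymbol e j m) = derivSymbol e (j + 1) m := by
  ext k; simp only [derivSymbol]; ring

theorem derivSymbol_zero (e : Fin 2) (m : Plane → ℂ) : derivSymbol e 0 m = m := by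
  ext k; simp [derivSymbol]

theorem derivSymbol_congr {e : Fin 2} {j : ℕ} {m m' : Plane → ℂ} (h : m =ᵐ[volume] m') :
    derivSymbol e j m =ᵐ[volume] derivSymbol e j m' :=
  h.mono fun k hk => by simp only [derivSymbol, hk]

/-- Gagliardo–Nirenberg with `q = 2n/i`, for which `iq = 2n`. Its constant blows up as `q → 2`, so
`i = n` is treated separately, by Plancherel. -/
theorem exists_lintegral_fourierInv_rpow_le {i n : ℕ} (hi : 1 ≤ i) (hin : i ≤ n) {M : ℝ}
    (hM : 0 < M) :
    ∃ C : ℝ≥0∞, C ≠ ∞ ∧ ∀ (e : Fin 2) (m : Plane → ℂ), Integrable m → ∫ k, ‖m k‖ ≤ M →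
      Integrable (derivSymbol e i m) → MemLp (derivSymbol e i m) 2 volume →
      ∫⁻ z, ENNReal.ofReal ((‖(𝓕⁻ (derivSymbol e i m)) z‖ ^ ((n : ℝ) / i)) ^ 2)
        ≤ C * energy e n m := by
  have hi0 : (0 : ℝ) < i := by exact_mod_cast hi
  rcases hin.eq_or_lt with rfl | hlt
  · refine ⟨1, by simp, fun e m _ _ h1 h2 => ?_⟩
    rw [one_mul, ← eLpNorm_derivSymbol_sq, ← eLpNorm_fourierInv h1 h2, eLpNorm_two_sq]
    refine lintegral_mono fun z => ?_
    rw [div_self hi0.ne', Real.rpow_one, ENNReal.ofReal_pow (norm_nonneg _), ofReal_norm]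
  · refine ⟨ENNReal.ofReal (4 * (2 * n / i) * (2 * M) ^ ((2 * n / i : ℝ) - 2) / (2 * n / i - 2)),
      ENNReal.ofReal_ne_top, fun e m hm hmM h1 h2 => ?_⟩
    have hq : (2 : ℝ) < 2 * n / i := by
      rw [lt_div_iff₀ hi0]
      have : (i : ℝ) < n := by exact_mod_cast hlt
      linarith
    have := lintegral_fourierInv_derivSymbol_rpow_le e i hq hM hm hmM h1 h2
    convert this using 2
    · ext z
      rw [← Real.rpow_natCast (_ ^ _), ← Real.rpow_mul (norm_nonneg _)]
      congr 2
      push_cast; ring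
    · unfold energy
      congr 1; ext k
      congr 3
      field_simp

/-! ### Band limited functions and the chain rule of integer order. -/

/-- `m` is integrable, square integrable, and supported in `{|ξₑ| ≤ t}`. -/
structure BandLimited (e : Fin 2) (t : ℝ) (m : Plane → ℂ) : Prop where
  integrable : Integrable m
  memLp : MemLp m 2 volume
  eq_zero : ∀ k, t < |freq e k| → m k = 0

namespace BandLimited

variable {e : Fin 2} {t : ℝ} {m : Plane → ℂ}

theorem norm_derivSymbol_le (h : BandLimited e t m) (i : ℕ) (k : Plane) :
    ‖derivSymbol e i m k‖ ≤ |t| ^ i * ‖m k‖ := by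
  rw [norm_derivSymbol]
  by_cases hk : t < |freq e k|
  · simp [h.eq_zero k hk]
  · have := (not_lt.1 hk).trans (le_abs_self t)
    gcongr

theorem aestronglyMeasurable_derivSymbol (h : BandLimited e t m) (i : ℕ) :
    AEStronglyMeasurable (derivSymbol e i m) volume :=
  AEStronglyMeasurable.mul (Measurable.aestronglyMeasurable (by fun_prop)) h.integrable.1

theorem integrable_derivSymbol (h : BandLimited e t m) (i : ℕ) :
    Integrable (derivSymbol e i m) :=
  (h.integrable.norm.const_mul (|t| ^ i)).mono' (h.aestronglyMeasurable_derivSymbol i)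
    (Eventually.of_forall (h.norm_derivSymbol_le i))

theorem memLp_derivSymbol (h : BandLimited e t m) (i : ℕ) :
    MemLp (derivSymbol e i m) 2 volume :=
  h.memLp.of_le_mul (h.aestronglyMeasurable_derivSymbol i)
    (Eventually.of_forall (h.norm_derivSymbol_le i))

theorem energy_ne_top (h : BandLimited e t m) (n : ℕ) : energy e n m ≠ ∞ := by
  rw [← eLpNorm_derivSymbol_sq]
  exact ENNReal.pow_ne_top (h.memLp_derivSymbol n).2.ne

end BandLimited

/-- The plane curve `x ↦ (𝓕⁻ m₁, 𝓕⁻ m₂) (z + x e)`. -/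
def lineCurve (e : Fin 2) (m₁ m₂ : Plane → ℂ) (z : Plane) (x : ℝ) : ℂ × ℂ :=
  ((𝓕⁻ m₁) (z + x • unitVec e), (𝓕⁻ m₂) (z + x • unitVec e))

theorem hasDerivAt_lineCurve {e : Fin 2} {t : ℝ} {m₁ m₂ : Plane → ℂ} (h₁ : BandLimited e t m₁)
    (h₂ : BandLimited e t m₂) (i : ℕ) (z : Plane) (x : ℝ) :
    HasDerivAt (lineCurve e (derivSymbol e i m₁) (derivSymbol e i m₂) z)
      (lineCurve e (derivSymbol e (i + 1) m₁) (derivSymbol e (i + 1) m₂) z x) x := by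
  have a := hasDerivAt_fourierInv e (h₁.integrable_derivSymbol i)
    (by rw [derivSymbol_succ]; exact h₁.integrable_derivSymbol (i + 1)) z x
  have b := hasDerivAt_fourierInv e (h₂.integrable_derivSymbol i)
    (by rw [derivSymbol_succ]; exact h₂.integrable_derivSymbol (i + 1)) z x
  rw [derivSymbol_succ] at a b
  exact a.prodMk b

theorem iteratedDeriv_lineCurve {e : Fin 2} {t : ℝ} {m₁ m₂ : Plane → ℂ} (h₁ : BandLimited e t m₁)
    (h₂ : BandLimited e t m₂) (i : ℕ) (z : Plane) :
    iteratedDeriv i (lineCurve e m₁ m₂ z)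
      = lineCurve e (derivSymbol e i m₁) (derivSymbol e i m₂) z := by
  induction i with
  | zero => simp [derivSymbol_zero]
  | succ i ih =>
    rw [iteratedDeriv_succ, ih]
    exact funext fun x => (hasDerivAt_lineCurve h₁ h₂ i z x).deriv

theorem contDiff_lineCurve {e : Fin 2} {t : ℝ} {m₁ m₂ : Plane → ℂ} (h₁ : BandLimited e t m₁)
    (h₂ : BandLimited e t m₂) (z : Plane) (n : ℕ) : ContDiff ℝ n (lineCurve e m₁ m₂ z) := by
  refine contDiff_of_differentiable_iteratedDeriv (n := (n : ℕ∞)) fun i _ => ?_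
  rw [iteratedDeriv_lineCurve h₁ h₂]
  exact fun x => (hasDerivAt_lineCurve h₁ h₂ i z x).differentiableAt

theorem lineCurve_add (e : Fin 2) (m₁ m₂ : Plane → ℂ) (z : Plane) (y : ℝ) :
    lineCurve e m₁ m₂ (z + y • unitVec e) = fun x => lineCurve e m₁ m₂ z (x + y) := by
  ext x <;> simp [lineCurve, add_smul, add_assoc, add_comm (y • unitVec e)]

/-- The pair `(𝓕⁻ m₁, 𝓕⁻ m₂)`. -/
def pairInv (m₁ m₂ : Plane → ℂ) (z : Plane) : ℂ × ℂ := ((𝓕⁻ m₁) z, (𝓕⁻ m₂) z)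

theorem norm_pairInv_le {M : ℝ} {m₁ m₂ : Plane → ℂ} (h₁ : ∫ k, ‖m₁ k‖ ≤ M)
    (h₂ : ∫ k, ‖m₂ k‖ ≤ M) (z : Plane) : ‖pairInv m₁ m₂ z‖ ≤ M :=
  max_le ((norm_fourierInv_le _ z).trans h₁) ((norm_fourierInv_le _ z).trans h₂)

/-- The derivative `∂ₑ^j (K (𝓕⁻ m₁, 𝓕⁻ m₂))`. -/
def compDeriv (e : Fin 2) (K : ℂ × ℂ → ℂ) (m₁ m₂ : Plane → ℂ) (j : ℕ) (z : Plane) : ℂ :=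
  iteratedDeriv j (K ∘ lineCurve e m₁ m₂ z) 0

theorem compDeriv_zero (e : Fin 2) (K : ℂ × ℂ → ℂ) (m₁ m₂ : Plane → ℂ) :
    compDeriv e K m₁ m₂ 0 = fun z => K (pairInv m₁ m₂ z) := by
  ext z; simp [compDeriv, lineCurve, pairInv]

theorem compDeriv_add (e : Fin 2) (K : ℂ × ℂ → ℂ) (m₁ m₂ : Plane → ℂ) (j : ℕ) (z : Plane) (y : ℝ) :
    compDeriv e K m₁ m₂ j (z + y • unitVec e)
      = iteratedDeriv j (K ∘ lineCurve e m₁ m₂ z) y := by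
  unfold compDeriv
  rw [lineCurve_add, show (K ∘ fun x => lineCurve e m₁ m₂ z (x + y))
    = fun x => (K ∘ lineCurve e m₁ m₂ z) (x + y) from rfl, iteratedDeriv_comp_add_const]
  simp

theorem hasLineDerivAt_compDeriv {e : Fin 2} {t : ℝ} {m₁ m₂ : Plane → ℂ} {K : ℂ × ℂ → ℂ}
    (h₁ : BandLimited e t m₁) (h₂ : BandLimited e t m₂) {N j : ℕ} (hK : ContDiff ℝ N K)
    (hj : j < N) (z : Plane) :
    HasLineDerivAt ℝ (compDeriv e K m₁ m₂ j) (compDeriv e K m₁ m₂ (j + 1) z) z (unitVec e) := by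
  have hc : ContDiff ℝ N (K ∘ lineCurve e m₁ m₂ z) := hK.comp (contDiff_lineCurve h₁ h₂ z N)
  unfold HasLineDerivAt
  simp only [compDeriv_add]
  have := (hc.differentiable_iteratedDeriv j (by exact_mod_cast hj) 0).hasDerivAt
  rwa [← iteratedDeriv_succ] at this

/-- By induction: each derivative is a pointwise limit of difference quotients, with steps
`1/(n+1)`, of the previous one. -/
theorem measurable_compDeriv {e : Fin 2} {t : ℝ} {m₁ m₂ : Plane → ℂ} {K : ℂ × ℂ → ℂ}
    (h₁ : BandLimited e t m₁) (h₂ : BandLimited e t m₂) {N j : ℕ} (hK : ContDiff ℝ N K)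
    (hj : j ≤ N) : Measurable (compDeriv e K m₁ m₂ j) := by
  induction j with
  | zero =>
    rw [compDeriv_zero]
    exact (hK.continuous.comp ((continuous_fourierInv h₁.integrable).prodMk
      (continuous_fourierInv h₂.integrable))).measurable
  | succ j ih =>
    have hm := ih (by omega)
    refine measurable_of_tendsto_metrizable (f := fun (n : ℕ) z => ((n : ℝ) + 1) •
      (compDeriv e K m₁ m₂ j (z + ((n : ℝ) + 1)⁻¹ • unitVec e) - compDeriv e K m₁ m₂ j z)) ?_ ?_
    · intro n
      exact ((hm.comp (measurable_id.add_const _)).sub hm).const_smul ((n : ℝ) + 1)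
    · rw [tendsto_pi_nhds]
      intro z
      have := (hasLineDerivAt_compDeriv h₁ h₂ hK (show j < N by omega) z).tendsto_slope_zero
      have h0 : Tendsto (fun n : ℕ => ((n : ℝ) + 1)⁻¹) atTop (𝓝[≠] 0) := by
        refine tendsto_nhdsWithin_iff.2 ⟨?_, Eventually.of_forall fun n => ?_⟩
        · simpa using tendsto_one_div_add_atTop_nhds_zero_nat (𝕜 := ℝ)
        · have : ((n : ℝ) + 1)⁻¹ ≠ 0 := by positivity
          exact this
      refine (this.comp h0).congr fun n => ?_
      simp

/-- Let `Q` be the sum on the right. The `i`-th derivative of the curve is at most `Q^{i/n}`, and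
every term of Faà di Bruno's formula has total order `n`, so each is at most `B Q`. -/
theorem norm_compDeriv_le {e : Fin 2} {t M B : ℝ} {m₁ m₂ : Plane → ℂ} {K : ℂ × ℂ → ℂ}
    (h₁ : BandLimited e t m₁) (h₂ : BandLimited e t m₂) (hM₁ : ∫ k, ‖m₁ k‖ ≤ M)
    (hM₂ : ∫ k, ‖m₂ k‖ ≤ M) {n : ℕ} (hn : 1 ≤ n) (hK : ContDiff ℝ n K)
    (hB : ∀ i ≤ n, ∀ v, ‖v‖ ≤ M → ‖iteratedFDeriv ℝ i K v‖ ≤ B) (z : Plane) :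
    ‖compDeriv e K m₁ m₂ n z‖ ≤ n.factorial * B * ∑ i ∈ Finset.Icc 1 n,
      (‖(𝓕⁻ (derivSymbol e i m₁)) z‖ ^ ((n : ℝ) / i)
        + ‖(𝓕⁻ (derivSymbol e i m₂)) z‖ ^ ((n : ℝ) / i)) := by
  set Q := ∑ i ∈ Finset.Icc 1 n, (‖(𝓕⁻ (derivSymbol e i m₁)) z‖ ^ ((n : ℝ) / i)
        + ‖(𝓕⁻ (derivSymbol e i m₂)) z‖ ^ ((n : ℝ) / i)) with hS
  have hS0 : 0 ≤ Q := Finset.sum_nonneg fun i _ => by positivity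
  have hn0 : (n : ℝ) ≠ 0 := by positivity
  have key := norm_iteratedFDeriv_comp_le (x := (0 : ℝ)) hK (contDiff_lineCurve h₁ h₂ z n) le_rfl
    (C := B) (D := Q ^ ((n : ℝ)⁻¹)) (fun i hi => ?_) (fun i hi hin => ?_)
  · rw [norm_iteratedFDeriv_eq_norm_iteratedDeriv, ← Real.rpow_natCast, ← Real.rpow_mul hS0,
      inv_mul_cancel₀ hn0, Real.rpow_one] at key
    exact key
  · refine hB i hi _ ?_
    exact norm_pairInv_le hM₁ hM₂ _
  · have hi0 : (0 : ℝ) < i := by exact_mod_cast hi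
    rw [norm_iteratedFDeriv_eq_norm_iteratedDeriv, iteratedDeriv_lineCurve h₁ h₂]
    have hterm := Finset.single_le_sum (f := fun i : ℕ =>
      (‖(𝓕⁻ (derivSymbol e i m₁)) z‖ ^ ((n : ℝ) / i)
        + ‖(𝓕⁻ (derivSymbol e i m₂)) z‖ ^ ((n : ℝ) / i))) (s := Finset.Icc 1 n)
      (fun i _ => by positivity) (Finset.mem_Icc.2 ⟨hi, hin⟩)
    have aux : ∀ a : ℝ, 0 ≤ a → a ^ ((n : ℝ) / i) ≤ Q → a ≤ (Q ^ ((n : ℝ)⁻¹)) ^ i := by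
      intro a ha hle
      have := Real.rpow_le_rpow (by positivity) hle (show (0 : ℝ) ≤ i / n by positivity)
      rw [← Real.rpow_mul ha, div_mul_div_cancel₀ hi0.ne', div_self hn0, Real.rpow_one] at this
      refine this.trans (le_of_eq ?_)
      rw [← Real.rpow_natCast, ← Real.rpow_mul hS0]
      congr 1
      field_simp
    simp only [lineCurve, zero_smul, add_zero]
    refine max_le (aux _ (norm_nonneg _) (le_trans ?_ hterm))
      (aux _ (norm_nonneg _) (le_trans ?_ hterm))
    · exact le_add_of_nonneg_right (by positivity)
    · exact le_add_of_nonneg_left (by positivity)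

/-- The pointwise chain rule bound is squared and each `|∂ₑ^i f|^{2n/i}` is integrated by
Gagliardo–Nirenberg. The constant depends neither on the band `t` nor on `K` beyond `B`, which is
what later limits require. -/
theorem exists_lintegral_compDeriv_le {n : ℕ} (hn : 1 ≤ n) {M B : ℝ} (hM : 0 < M) :
    ∃ C : ℝ≥0∞, C ≠ ∞ ∧ ∀ (e : Fin 2) (t : ℝ) (m₁ m₂ : Plane → ℂ) (K : ℂ × ℂ → ℂ),
      BandLimited e t m₁ → BandLimited e t m₂ → ∫ k, ‖m₁ k‖ ≤ M → ∫ k, ‖m₂ k‖ ≤ M →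
      ContDiff ℝ n K → (∀ i ≤ n, ∀ v, ‖v‖ ≤ M → ‖iteratedFDeriv ℝ i K v‖ ≤ B) →
      ∫⁻ z, ‖compDeriv e K m₁ m₂ n z‖ₑ ^ 2 ≤ C * (energy e n m₁ + energy e n m₂) := by
  have hgn : ∀ i : Finset.Icc 1 n, _ := fun i => exists_lintegral_fourierInv_rpow_le
    (Finset.mem_Icc.1 i.2).1 (Finset.mem_Icc.1 i.2).2 hM
  choose C hC hCle using hgn
  set A : ℝ := (n.factorial * B) ^ 2 * n * 2 with hA
  refine ⟨ENNReal.ofReal A * ∑ i, C i, ENNReal.mul_ne_top ENNReal.ofReal_ne_top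
    (by simpa using hC), ?_⟩
  intro e t m₁ m₂ K h₁ h₂ hM₁ hM₂ hK hB
  have hmeas : ∀ (m : Plane → ℂ) (i : ℕ), BandLimited e t m → Measurable fun z =>
      ENNReal.ofReal ((‖(𝓕⁻ (derivSymbol e i m)) z‖ ^ ((n : ℝ) / i)) ^ 2) := fun m i h =>
    ((((continuous_fourierInv (h.integrable_derivSymbol i)).measurable.norm).pow_const _).pow_const
      2).ennreal_ofReal
  calc ∫⁻ z, ‖compDeriv e K m₁ m₂ n z‖ₑ ^ 2
      ≤ ∫⁻ z, ENNReal.ofReal A * ∑ i : Finset.Icc 1 n,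
        (ENNReal.ofReal ((‖(𝓕⁻ (derivSymbol e i m₁)) z‖ ^ ((n : ℝ) / i)) ^ 2)
          + ENNReal.ofReal ((‖(𝓕⁻ (derivSymbol e i m₂)) z‖ ^ ((n : ℝ) / i)) ^ 2)) := by
        refine lintegral_mono fun z => ?_
        have h := norm_compDeriv_le h₁ h₂ hM₁ hM₂ hn hK hB z
        have hsq : ‖compDeriv e K m₁ m₂ n z‖ ^ 2 ≤ A * ∑ i ∈ Finset.Icc 1 n,
            ((‖(𝓕⁻ (derivSymbol e i m₁)) z‖ ^ ((n : ℝ) / i)) ^ 2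
              + (‖(𝓕⁻ (derivSymbol e i m₂)) z‖ ^ ((n : ℝ) / i)) ^ 2) := by
          refine (pow_le_pow_left₀ (norm_nonneg _) h 2).trans ?_
          rw [mul_pow, hA, mul_assoc, mul_assoc]
          refine mul_le_mul_of_nonneg_left ?_ (sq_nonneg _)
          refine sq_sum_le_card_mul_sum_sq.trans ?_
          rw [Nat.card_Icc, add_tsub_cancel_right]
          refine mul_le_mul_of_nonneg_left ?_ (Nat.cast_nonneg _)
          rw [Finset.mul_sum]
          refine Finset.sum_le_sum fun i _ => ?_
          nlinarith [sq_nonneg (‖(𝓕⁻ (derivSymbol e i m₁)) z‖ ^ ((n : ℝ) / i)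
            - ‖(𝓕⁻ (derivSymbol e i m₂)) z‖ ^ ((n : ℝ) / i))]
        rw [← ofReal_norm, ← ENNReal.ofReal_pow (norm_nonneg _)]
        refine (ENNReal.ofReal_le_ofReal hsq).trans (le_of_eq ?_)
        rw [ENNReal.ofReal_mul (by positivity), ← Finset.sum_coe_sort (Finset.Icc 1 n),
          ENNReal.ofReal_sum_of_nonneg (fun i _ => by positivity)]
        congr 1
        refine Finset.sum_congr rfl fun i _ => ?_
        rw [ENNReal.ofReal_add (by positivity) (by positivity)]
    _ = ENNReal.ofReal A * ∑ i : Finset.Icc 1 n,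
        ((∫⁻ z, ENNReal.ofReal ((‖(𝓕⁻ (derivSymbol e i m₁)) z‖ ^ ((n : ℝ) / i)) ^ 2))
          + ∫⁻ z, ENNReal.ofReal ((‖(𝓕⁻ (derivSymbol e i m₂)) z‖ ^ ((n : ℝ) / i)) ^ 2)) := by
        rw [lintegral_const_mul' _ _ ENNReal.ofReal_ne_top, lintegral_finsetSum]
        · congr 1
          refine Finset.sum_congr rfl fun i _ => ?_
          rw [lintegral_add_left (hmeas _ _ h₁)]
        · exact fun i _ => (hmeas _ _ h₁).add (hmeas _ _ h₂)
    _ ≤ ENNReal.ofReal A * ∑ i : Finset.Icc 1 n, C i * (energy e n m₁ + energy e n m₂) := by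
        gcongr with i
        rw [mul_add]
        exact add_le_add
          (hCle i e m₁ h₁.integrable hM₁ (h₁.integrable_derivSymbol i) (h₁.memLp_derivSymbol i))
          (hCle i e m₂ h₂.integrable hM₂ (h₂.integrable_derivSymbol i) (h₂.memLp_derivSymbol i))
    _ = _ := by rw [← Finset.sum_mul, mul_assoc]

/-- Composition estimate of integer order for band limited functions. -/
theorem exists_energy_comp_bandLimited_le {n : ℕ} (hn : 1 ≤ n) {M B : ℝ} (hM : 0 < M) :
    ∃ C : ℝ≥0∞, C ≠ ∞ ∧ ∀ (e : Fin 2) (t : ℝ) (m₁ m₂ : Plane → ℂ) (K : ℂ × ℂ → ℂ),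
      BandLimited e t m₁ → BandLimited e t m₂ → ∫ k, ‖m₁ k‖ ≤ M → ∫ k, ‖m₂ k‖ ≤ M →
      ContDiff ℝ n K → (∀ i ≤ n, ∀ v, ‖v‖ ≤ M → ‖iteratedFDeriv ℝ i K v‖ ≤ B) →
      ∀ hK : MemLp (fun z => K (pairInv m₁ m₂ z)) 2 volume,
      energy e n (𝓕 (hK.toLp _ : L2) : L2) ≤ C * (energy e n m₁ + energy e n m₂) := by
  obtain ⟨C, hC, hCle⟩ := exists_lintegral_compDeriv_le hn (B := B) hM
  refine ⟨C, hC, ?_⟩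
  intro e t m₁ m₂ K h₁ h₂ hM₁ hM₂ hK hB hK2
  -- Intermediate derivatives are in `L²` by the same estimate at order `j`; the energies there are
  -- finite because the inputs are band limited.
  have hmem : ∀ j ≤ n, MemLp (compDeriv e K m₁ m₂ j) 2 volume := by
    intro j hj
    rcases Nat.eq_zero_or_pos j with rfl | hj0
    · rwa [compDeriv_zero]
    · refine ⟨(measurable_compDeriv h₁ h₂ hK hj).aestronglyMeasurable, ?_⟩
      obtain ⟨C', hC', hCle'⟩ := exists_lintegral_compDeriv_le hj0 (B := B) hM
      have := hCle' e t m₁ m₂ K h₁ h₂ hM₁ hM₂ (hK.of_le (by exact_mod_cast hj))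
        fun i hi => hB i (hi.trans hj)
      rw [← eLpNorm_two_sq] at this
      have hlt := this.trans_lt (ENNReal.mul_lt_top hC'.lt_top
        (ENNReal.add_lt_top.2 ⟨(h₁.energy_ne_top j).lt_top, (h₂.energy_ne_top j).lt_top⟩))
      by_contra hcon
      rw [not_lt, top_le_iff] at hcon
      simp [hcon] at hlt
  have hfour : ∀ j (hj : j ≤ n), ((𝓕 ((hmem j hj).toLp _ : L2) : L2) : Plane → ℂ) =ᵐ[volume]
      derivSymbol e j ((𝓕 (hK2.toLp _ : L2) : L2) : Plane → ℂ) := by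
    intro j
    induction j with
    | zero =>
      intro hj
      rw [derivSymbol_zero]
      have : (hmem 0 hj).toLp _ = hK2.toLp _ := by
        rw [MemLp.toLp_eq_toLp_iff, compDeriv_zero]
      rw [this]
    | succ j ih =>
      intro hj
      have h := fourier_lineDeriv_ae e (hmem j (by omega)) (hmem (j + 1) hj)
        (hasLineDerivAt_compDeriv h₁ h₂ hK (by omega))
      refine h.trans ?_
      rw [← derivSymbol_succ e j]
      exact derivSymbol_congr (ih (by omega))
  rw [← eLpNorm_derivSymbol_sq, ← eLpNorm_congr_ae (hfour n le_rfl), eLpNorm_fourier,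
    eLpNorm_congr_ae (hmem n le_rfl).coeFn_toLp, eLpNorm_two_sq]
  exact hCle e t m₁ m₂ K h₁ h₂ hM₁ hM₂ hK hB

/-! ### Lower semicontinuity and frequency truncation. -/

/-- Weighted `L²` norms of the Fourier transform are lower semicontinuous in `L²`. -/
theorem lintegral_mul_fourier_le_of_tendsto {g : ℕ → L2} {f : L2} (hg : Tendsto g atTop (𝓝 f))
    {w : Plane → ℝ≥0∞} (hw : Measurable w) (hwt : ∀ k, w k ≠ ∞) {E : ℝ≥0∞}
    (hE : ∀ n, ∫⁻ k, w k * ‖(𝓕 (g n) : L2) k‖ₑ ^ 2 ≤ E) :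
    ∫⁻ k, w k * ‖(𝓕 f : L2) k‖ₑ ^ 2 ≤ E := by
  have hF : Tendsto (fun n => (𝓕 (g n) : L2)) atTop (𝓝 (𝓕 f : L2)) :=
    ((Lp.fourierTransformₗᵢ Plane ℂ).continuous.tendsto f).comp hg
  -- Along a subsequence the transforms converge almost everywhere, and Fatou's lemma applies.
  obtain ⟨ns, -, hns⟩ := (tendstoInMeasure_of_tendsto_Lp hF).exists_seq_tendsto_ae
  calc ∫⁻ k, w k * ‖(𝓕 f : L2) k‖ₑ ^ 2
      = ∫⁻ k, liminf (fun n => w k * ‖(𝓕 (g (ns n)) : L2) k‖ₑ ^ 2) atTop := by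
        refine lintegral_congr_ae (hns.mono fun k hk => ?_)
        exact (ENNReal.Tendsto.const_mul ((ENNReal.continuous_pow 2).tendsto _ |>.comp
          ((continuous_enorm.tendsto _).comp hk)) (Or.inr (hwt k))).liminf_eq.symm
    _ ≤ liminf (fun n => ∫⁻ k, w k * ‖(𝓕 (g (ns n)) : L2) k‖ₑ ^ 2) atTop :=
        lintegral_liminf_le' fun n => hw.aemeasurable.mul
          ((Lp.aestronglyMeasurable _).enorm.pow_const 2)
    _ ≤ E := by
        refine (liminf_le_liminf (Eventually.of_forall fun n => hE (ns n))).trans ?_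
        simp

theorem energy_eq (e : Fin 2) (r : ℝ) (m : Plane → ℂ) :
    energy e r m = ∫⁻ k, ENNReal.ofReal (|freq e k| ^ (2 * r)) * ‖m k‖ₑ ^ 2 := by
  refine lintegral_congr fun k => ?_
  rw [ENNReal.ofReal_mul (by positivity), ENNReal.ofReal_pow (norm_nonneg _), ofReal_norm]

/-- Restriction of `m` to `{|ξₑ| ≤ t}`. -/
def cut (e : Fin 2) (t : ℝ) (m : Plane → ℂ) : Plane → ℂ := {k | |freq e k| ≤ t}.indicator m

theorem measurableSet_cut (e : Fin 2) (t : ℝ) : MeasurableSet {k | |freq e k| ≤ t} :=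
  measurableSet_le (by fun_prop) measurable_const

theorem compl_cut (e : Fin 2) (t : ℝ) : {k | |freq e k| ≤ t}ᶜ = {k | t < |freq e k|} := by
  ext k; simp

theorem bandLimited_cut (e : Fin 2) (t : ℝ) {m : Plane → ℂ} (h1 : Integrable m)
    (h2 : MemLp m 2 volume) : BandLimited e t (cut e t m) where
  integrable := h1.indicator (measurableSet_cut e t)
  memLp := h2.indicator (measurableSet_cut e t)
  eq_zero k hk := indicator_of_notMem (by simpa using hk) _

theorem integral_norm_cut_le (e : Fin 2) (t : ℝ) {m : Plane → ℂ} (h1 : Integrable m) :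
    ∫ k, ‖cut e t m k‖ ≤ ∫ k, ‖m k‖ :=
  integral_mono (h1.indicator (measurableSet_cut e t)).norm h1.norm
    fun k => norm_indicator_le_norm_self m k

theorem energy_cut (e : Fin 2) (r t : ℝ) (m : Plane → ℂ) :
    energy e r (cut e t m) = ∫⁻ k in {k | |freq e k| ≤ t},
      ENNReal.ofReal (|freq e k| ^ (2 * r)) * ‖m k‖ₑ ^ 2 := by
  rw [energy_eq, ← lintegral_indicator (measurableSet_cut e t)]
  refine lintegral_congr fun k => ?_
  by_cases hk : k ∈ {k | |freq e k| ≤ t}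
  · rw [cut, indicator_of_mem hk, indicator_of_mem hk]
  · rw [cut, indicator_of_notMem hk, indicator_of_notMem hk]; simp

theorem energy_cut_le (e : Fin 2) (r t : ℝ) (m : Plane → ℂ) :
    energy e r (cut e t m) ≤ energy e r m := by
  rw [energy_cut, energy_eq]
  exact setLIntegral_le_lintegral _ _

section Lipschitz

variable {M B : ℝ} {K : ℂ × ℂ → ℂ} {m₁ m₂ : Plane → ℂ}

theorem norm_sub_le_of_bound (hK : ContDiff ℝ 1 K)
    (hB : ∀ v, ‖v‖ ≤ M → ‖iteratedFDeriv ℝ 1 K v‖ ≤ B) {v w : ℂ × ℂ} (hv : ‖v‖ ≤ M)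
    (hw : ‖w‖ ≤ M) : ‖K v - K w‖ ≤ B * ‖v - w‖ := by
  refine (convex_closedBall (0 : ℂ × ℂ) M).norm_image_sub_le_of_norm_fderiv_le (𝕜 := ℝ)
    (fun x _ => (hK.differentiable (by norm_num)).differentiableAt) (fun x hx => ?_)
    (by simpa using hw) (by simpa using hv)
  rw [← norm_iteratedFDeriv_one]
  exact hB x (by simpa using hx)

theorem memLp_comp_pairInv (hK : ContDiff ℝ 1 K)
    (hB : ∀ v, ‖v‖ ≤ M → ‖iteratedFDeriv ℝ 1 K v‖ ≤ B) (hK0 : K 0 = 0) (hM : 0 < M)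
    (h₁ : Integrable m₁) (h₂ : Integrable m₂) (h₁' : MemLp m₁ 2 volume) (h₂' : MemLp m₂ 2 volume)
    (hM₁ : ∫ k, ‖m₁ k‖ ≤ M) (hM₂ : ∫ k, ‖m₂ k‖ ≤ M) :
    MemLp (fun z => K (pairInv m₁ m₂ z)) 2 volume := by
  have hc : Continuous (pairInv m₁ m₂) := (continuous_fourierInv h₁).prodMk
    (continuous_fourierInv h₂)
  have hp : MemLp (pairInv m₁ m₂) 2 volume :=
    ((memLp_fourierInv h₁ h₁').norm.add (memLp_fourierInv h₂ h₂').norm).mono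
      hc.aestronglyMeasurable (Eventually.of_forall fun z => by
        simp only [pairInv, Pi.add_apply, Real.norm_eq_abs]
        rw [abs_of_nonneg (by positivity)]
        exact max_le (by simp) (by simp))
  refine hp.of_le_mul (c := B) (hK.continuous.comp hc).aestronglyMeasurable
    (Eventually.of_forall fun z => ?_)
  have := norm_sub_le_of_bound hK hB (norm_pairInv_le hM₁ hM₂ z) (w := 0) (by simpa using hM.le)
  simpa [hK0] using this

/-- Truncation does not increase the `L¹` norm, so both pairs take values in the ball of radius `M`,
where `K` is `B`-Lipschitz; Plancherel turns the truncation error into the tails of `m₁` and `m₂`.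
-/
theorem eLpNorm_comp_sub_cut_sq_le (hK : ContDiff ℝ 1 K)
    (hB : ∀ v, ‖v‖ ≤ M → ‖iteratedFDeriv ℝ 1 K v‖ ≤ B) (e : Fin 2) (t : ℝ)
    (h₁ : Integrable m₁) (h₂ : Integrable m₂) (h₁' : MemLp m₁ 2 volume) (h₂' : MemLp m₂ 2 volume)
    (hM₁ : ∫ k, ‖m₁ k‖ ≤ M) (hM₂ : ∫ k, ‖m₂ k‖ ≤ M) :
    eLpNorm (fun z => K (pairInv m₁ m₂ z) - K (pairInv (cut e t m₁) (cut e t m₂) z)) 2 volume ^ 2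
      ≤ ENNReal.ofReal (B ^ 2) *
        ∫⁻ k in {k | t < |freq e k|}, (‖m₁ k‖ₑ ^ 2 + ‖m₂ k‖ₑ ^ 2) := by
  have hS := measurableSet_cut e t
  set S := {k | |freq e k| ≤ t} with hSdef
  have tail : ∀ m : Plane → ℂ, Integrable m → MemLp m 2 volume →
      ∫⁻ z, ‖(𝓕⁻ (Sᶜ.indicator m)) z‖ₑ ^ 2 = ∫⁻ k in Sᶜ, ‖m k‖ₑ ^ 2 := by
    intro m hm hm'
    rw [← eLpNorm_two_sq, eLpNorm_fourierInv (hm.indicator hS.compl) (hm'.indicator hS.compl),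
      eLpNorm_two_sq, ← lintegral_indicator hS.compl]
    refine lintegral_congr fun k => ?_
    by_cases hk : k ∈ S <;> simp [hk]
  have hsub : ∀ (m : Plane → ℂ) (z), Integrable m →
      (𝓕⁻ m) z - (𝓕⁻ (cut e t m)) z = (𝓕⁻ (Sᶜ.indicator m)) z := by
    intro m z hm
    rw [fourierInv_indicator_add hm hS z, cut]; ring
  rw [eLpNorm_two_sq, ← compl_cut, ← hSdef, lintegral_add_left' (by
    exact (h₁.1.enorm.pow_const 2).restrict), ← tail m₁ h₁ h₁', ← tail m₂ h₂ h₂',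
    ← lintegral_add_left ((continuous_fourierInv (h₁.indicator hS.compl)).measurable.enorm.pow_const
      2), ← lintegral_const_mul' _ _ ENNReal.ofReal_ne_top]
  refine lintegral_mono fun z => ?_
  have hl := norm_sub_le_of_bound hK hB (norm_pairInv_le hM₁ hM₂ z)
    (norm_pairInv_le ((integral_norm_cut_le e t h₁).trans hM₁)
      ((integral_norm_cut_le e t h₂).trans hM₂) z)
  have hp : ‖pairInv m₁ m₂ z - pairInv (cut e t m₁) (cut e t m₂) z‖ ^ 2
      ≤ ‖(𝓕⁻ (Sᶜ.indicator m₁)) z‖ ^ 2 + ‖(𝓕⁻ (Sᶜ.indicator m₂)) z‖ ^ 2 := by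
    simp only [pairInv, Prod.mk_sub_mk, hsub m₁ z h₁, hsub m₂ z h₂, Prod.norm_mk]
    rcases max_choice ‖(𝓕⁻ (Sᶜ.indicator m₁)) z‖ ‖(𝓕⁻ (Sᶜ.indicator m₂)) z‖ with h | h <;>
      rw [h] <;> nlinarith [sq_nonneg ‖(𝓕⁻ (Sᶜ.indicator m₁)) z‖,
        sq_nonneg ‖(𝓕⁻ (Sᶜ.indicator m₂)) z‖]
  simp only [← ofReal_norm]
  rw [← ENNReal.ofReal_pow (norm_nonneg _), ← ENNReal.ofReal_pow (norm_nonneg _),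
    ← ENNReal.ofReal_pow (norm_nonneg _), ← ENNReal.ofReal_add (by positivity) (by positivity),
    ← ENNReal.ofReal_mul (by positivity)]
  refine ENNReal.ofReal_le_ofReal ?_
  calc _ ≤ (B * ‖pairInv m₁ m₂ z - pairInv (cut e t m₁) (cut e t m₂) z‖) ^ 2 :=
        pow_le_pow_left₀ (norm_nonneg _) hl 2
    _ ≤ _ := by rw [mul_pow]; gcongr

end Lipschitz

/-! ### Composition estimates of fractional order. -/

theorem enorm_add_sq_le (a b : ℂ) : ‖a + b‖ₑ ^ 2 ≤ 2 * (‖a‖ₑ ^ 2 + ‖b‖ₑ ^ 2) := by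
  have h := norm_add_le a b
  simp only [← ofReal_norm]
  rw [← ENNReal.ofReal_pow (norm_nonneg _), ← ENNReal.ofReal_pow (norm_nonneg _),
    ← ENNReal.ofReal_pow (norm_nonneg _), ← ENNReal.ofReal_add (by positivity) (by positivity),
    show (2 : ℝ≥0∞) = ENNReal.ofReal 2 by simp, ← ENNReal.ofReal_mul (by norm_num)]
  refine ENNReal.ofReal_le_ofReal ?_
  nlinarith [sq_nonneg (‖a‖ - ‖b‖), norm_nonneg (a + b)]

/-- High frequencies of a composition. -/
theorem lintegral_tail_comp_le {N : ℕ} (hN : 1 ≤ N) {M B : ℝ} (hM : 0 < M) :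
    ∃ C : ℝ≥0∞, C ≠ ∞ ∧ ∀ (e : Fin 2) (m₁ m₂ : Plane → ℂ) (K : ℂ × ℂ → ℂ),
      Integrable m₁ → Integrable m₂ → MemLp m₁ 2 volume → MemLp m₂ 2 volume →
      ∫ k, ‖m₁ k‖ ≤ M → ∫ k, ‖m₂ k‖ ≤ M → K 0 = 0 →
      ContDiff ℝ N K → (∀ i ≤ N, ∀ v, ‖v‖ ≤ M → ‖iteratedFDeriv ℝ i K v‖ ≤ B) →
      ∀ (hK : MemLp (fun z => K (pairInv m₁ m₂ z)) 2 volume) (t : ℝ), 0 < t →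
      ∫⁻ k in {k | t < |freq e k|}, ‖(𝓕 (hK.toLp _ : L2) : L2) k‖ₑ ^ 2
        ≤ C * ((∫⁻ k in {k | t < |freq e k|}, (‖m₁ k‖ₑ ^ 2 + ‖m₂ k‖ₑ ^ 2))
          + ENNReal.ofReal (t ^ (-(2 * N : ℝ))) * ∫⁻ k in {k | |freq e k| ≤ t},
            ENNReal.ofReal (|freq e k| ^ (2 * N : ℝ)) * (‖m₁ k‖ₑ ^ 2 + ‖m₂ k‖ₑ ^ 2)) := by
  obtain ⟨C, hC, hCle⟩ := exists_energy_comp_bandLimited_le hN (B := B) hM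
  refine ⟨2 * (ENNReal.ofReal (B ^ 2) + C), by finiteness, ?_⟩
  intro e m₁ m₂ K h₁ h₂ h₁' h₂' hM₁ hM₂ hK0 hKN hB hK t ht
  have hK1 : ContDiff ℝ 1 K := hKN.of_le (by exact_mod_cast hN)
  have hb₁ := bandLimited_cut e t h₁ h₁'
  have hb₂ := bandLimited_cut e t h₂ h₂'
  have hc₁ := (integral_norm_cut_le e t h₁).trans hM₁
  have hc₂ := (integral_norm_cut_le e t h₂).trans hM₂
  have hKc := memLp_comp_pairInv hK1 (hB 1 hN) hK0 hM hb₁.integrable hb₂.integrable hb₁.memLp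
    hb₂.memLp hc₁ hc₂
  set g : L2 := hK.toLp _ with hg
  set gc : L2 := hKc.toLp _ with hgc
  set T := {k | t < |freq e k|} with hT
  have hTm : MeasurableSet T := by rw [hT, ← compl_cut]; exact (measurableSet_cut e t).compl
  -- The composition is split as `(g - gc) + gc`, where `gc` composes the inputs truncated at `t`.
  -- For `gc` the integer order estimate applies and `1 ≤ t^{-2N}|ξₑ|^{2N}` on the tail; `g - gc` is
  -- a Lipschitz truncation error.
  have hlow : ∫⁻ k in T, ‖(𝓕 gc : L2) k‖ₑ ^ 2 ≤
      ENNReal.ofReal (t ^ (-(2 * N : ℝ))) * energy e N (𝓕 gc : L2) := by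
    rw [energy_eq, ← lintegral_const_mul' _ _ ENNReal.ofReal_ne_top]
    refine (setLIntegral_mono' hTm fun k hk => ?_).trans (setLIntegral_le_lintegral T _)
    rw [← mul_assoc, ← ENNReal.ofReal_mul (by positivity)]
    refine le_mul_of_one_le_left (by positivity) ?_
    rw [ENNReal.one_le_ofReal, Real.rpow_neg ht.le, ← div_eq_inv_mul, one_le_div (by positivity)]
    exact Real.rpow_le_rpow ht.le (le_of_lt hk) (by positivity)
  have hhigh : ∫⁻ k in T, ‖(𝓕 (g - gc) : L2) k‖ₑ ^ 2 ≤ ENNReal.ofReal (B ^ 2) *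
      ∫⁻ k in T, (‖m₁ k‖ₑ ^ 2 + ‖m₂ k‖ₑ ^ 2) := by
    refine (setLIntegral_le_lintegral T _).trans ?_
    rw [← eLpNorm_two_sq, eLpNorm_fourier, hg, hgc, ← MemLp.toLp_sub,
      eLpNorm_congr_ae (MemLp.coeFn_toLp _)]
    exact eLpNorm_comp_sub_cut_sq_le hK1 (hB 1 hN) e t h₁ h₂ h₁' h₂' hM₁ hM₂
  have hen := hCle e t _ _ K hb₁ hb₂ hc₁ hc₂ hKN hB hKc
  rw [energy_cut, energy_cut, ← lintegral_add_left' (by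
    exact ((Measurable.aemeasurable (by fun_prop)).mul (h₁.1.enorm.pow_const 2)).restrict)] at hen
  simp only [← mul_add] at hen
  have hsum : ∀ᵐ k ∂(volume : Measure Plane), (𝓕 g : L2) k = (𝓕 (g - gc) : L2) k + (𝓕 gc : L2) k := by
    have h0 : (𝓕 g : L2) = 𝓕 (g - gc) + 𝓕 gc := by
      rw [← FourierTransform.fourier_add, sub_add_cancel]
    have h1 := Lp.coeFn_add (𝓕 (g - gc) : L2) (𝓕 gc : L2)
    rw [← h0] at h1
    exact h1
  calc ∫⁻ k in T, ‖(𝓕 g : L2) k‖ₑ ^ 2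
      ≤ ∫⁻ k in T, 2 * (‖(𝓕 (g - gc) : L2) k‖ₑ ^ 2 + ‖(𝓕 gc : L2) k‖ₑ ^ 2) := by
        refine lintegral_mono_ae (ae_restrict_of_ae (hsum.mono fun k hk => ?_))
        rw [hk]
        exact enorm_add_sq_le _ _
    _ = 2 * ((∫⁻ k in T, ‖(𝓕 (g - gc) : L2) k‖ₑ ^ 2) + ∫⁻ k in T, ‖(𝓕 gc : L2) k‖ₑ ^ 2) := by
        rw [lintegral_const_mul' _ _ (by simp), lintegral_add_left' (by
          exact ((Lp.aestronglyMeasurable _).enorm.pow_const 2).restrict)]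
    _ ≤ 2 * (ENNReal.ofReal (B ^ 2) * (∫⁻ k in T, (‖m₁ k‖ₑ ^ 2 + ‖m₂ k‖ₑ ^ 2))
        + ENNReal.ofReal (t ^ (-(2 * N : ℝ))) * (C * ∫⁻ k in {k | |freq e k| ≤ t},
            ENNReal.ofReal (|freq e k| ^ (2 * N : ℝ)) * (‖m₁ k‖ₑ ^ 2 + ‖m₂ k‖ₑ ^ 2))) := by
        gcongr
        exact hlow.trans (by gcongr)
    _ ≤ 2 * ((ENNReal.ofReal (B ^ 2) + C) * (∫⁻ k in T, (‖m₁ k‖ₑ ^ 2 + ‖m₂ k‖ₑ ^ 2))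
        + ENNReal.ofReal (t ^ (-(2 * N : ℝ))) * ((ENNReal.ofReal (B ^ 2) + C) *
          ∫⁻ k in {k | |freq e k| ≤ t},
            ENNReal.ofReal (|freq e k| ^ (2 * N : ℝ)) * (‖m₁ k‖ₑ ^ 2 + ‖m₂ k‖ₑ ^ 2))) := by
        gcongr
        · exact le_self_add
        · exact le_add_self
    _ = _ := by ring

/-- Since `∫₀^{|ξ|} t^{2r-1} dt = |ξ|^{2r}/(2r)`, the energy of order `r` is recovered from the
tails. -/
theorem lintegral_rpow_mul_tail (e : Fin 2) {r : ℝ} (hr : 0 < r) {φ : Plane → ℝ≥0∞}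
    (hφ : AEMeasurable φ volume) :
    ∫⁻ t in Ioi (0 : ℝ), ENNReal.ofReal (t ^ (2 * r - 1)) * ∫⁻ k in {k | t < |freq e k|}, φ k
      = ENNReal.ofReal (1 / (2 * r)) * ∫⁻ k, ENNReal.ofReal (|freq e k| ^ (2 * r)) * φ k := by
  have hS : MeasurableSet {x : ℝ × Plane | x.1 < |freq e x.2|} :=
    measurableSet_lt measurable_fst (by fun_prop)
  have := lintegral_mul_setLIntegral_swap (w := fun t => ENNReal.ofReal (t ^ (2 * r - 1)))
    (by fun_prop) hφ hS
  refine this.trans ?_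
  rw [← lintegral_const_mul' _ _ ENNReal.ofReal_ne_top]
  refine lintegral_congr fun k => ?_
  have hset : Ioi (0 : ℝ) ∩ {t | (t, k) ∈ {x : ℝ × Plane | x.1 < |freq e x.2|}}
      = Ioo 0 |freq e k| := by ext t; simp
  rw [hset, setLIntegral_rpow_Ioo (by positivity) (abs_nonneg _), ← mul_assoc,
    ← ENNReal.ofReal_mul (by positivity), mul_comm (φ k)]
  congr 2
  ring

/-- After Tonelli the `t`-integral is that of `t^{2r-2N-1}` over `t ≥ |ξₑ|`, finite because `r < N`;
at `ξₑ = 0` the weight `|ξₑ|^{2N}` vanishes. -/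
theorem lintegral_rpow_mul_head_le (e : Fin 2) {r N : ℝ} (hN : 0 < N) (hr : r < N)
    {φ : Plane → ℝ≥0∞} (hφ : AEMeasurable φ volume) :
    ∫⁻ t in Ioi (0 : ℝ), ENNReal.ofReal (t ^ (2 * r - 1)) * (ENNReal.ofReal (t ^ (-(2 * N))) *
      ∫⁻ k in {k | |freq e k| ≤ t}, ENNReal.ofReal (|freq e k| ^ (2 * N)) * φ k)
      ≤ ENNReal.ofReal (1 / (2 * (N - r))) *
        ∫⁻ k, ENNReal.ofReal (|freq e k| ^ (2 * r)) * φ k := by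
  have hS : MeasurableSet {x : ℝ × Plane | |freq e x.2| ≤ x.1} :=
    measurableSet_le (by fun_prop) measurable_fst
  have hrN : 0 < 2 * (N - r) := by linarith
  have e1 : ∫⁻ t in Ioi (0 : ℝ), ENNReal.ofReal (t ^ (2 * r - 1)) * (ENNReal.ofReal (t ^ (-(2 * N)))
      * ∫⁻ k in {k | |freq e k| ≤ t}, ENNReal.ofReal (|freq e k| ^ (2 * N)) * φ k)
      = ∫⁻ t in Ioi (0 : ℝ), ENNReal.ofReal (t ^ (-(2 * (N - r)) - 1)) *
        ∫⁻ k in {k | |freq e k| ≤ t}, ENNReal.ofReal (|freq e k| ^ (2 * N)) * φ k := by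
    refine setLIntegral_congr_fun measurableSet_Ioi fun t ht => ?_
    have ht : 0 < t := ht
    rw [← mul_assoc, ← ENNReal.ofReal_mul (by positivity), ← Real.rpow_add ht]
    congr 3
    ring
  have := lintegral_mul_setLIntegral_swap (w := fun t => ENNReal.ofReal (t ^ (-(2 * (N - r)) - 1)))
    (by fun_prop) (φ := fun k => ENNReal.ofReal (|freq e k| ^ (2 * N)) * φ k)
    ((Measurable.aemeasurable (by fun_prop)).mul hφ) hS
  refine e1.trans_le (this.trans_le ?_)
  rw [← lintegral_const_mul' _ _ ENNReal.ofReal_ne_top]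
  refine lintegral_mono fun k => ?_
  rcases (abs_nonneg (freq e k)).eq_or_lt with h0 | h0
  · simp [← h0, Real.zero_rpow (show 2 * N ≠ 0 by positivity)]
  · have hset : Ioi (0 : ℝ) ∩ {t | (t, k) ∈ {x : ℝ × Plane | |freq e x.2| ≤ x.1}}
        = Ici |freq e k| := by
      ext t
      simpa using fun h => h0.trans_le h
    rw [hset, setLIntegral_rpow_Ici hrN h0, mul_right_comm, ← mul_assoc]
    refine mul_le_mul_left ?_ _
    rw [← ENNReal.ofReal_mul (by positivity), ← ENNReal.ofReal_mul (by positivity)]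
    refine ENNReal.ofReal_le_ofReal (le_of_eq ?_)
    rw [mul_div_assoc', ← Real.rpow_add h0, div_mul_eq_mul_div, one_mul]
    congr 2
    ring

/-- Composition estimate in homogeneous directional Sobolev norms of order `r ≤ N`. -/
theorem exists_energy_comp_le {N : ℕ} (hN : 1 ≤ N) {r : ℝ} (hr : 0 < r) (hrN : r ≤ N) {M B : ℝ}
    (hM : 0 < M) :
    ∃ C : ℝ≥0∞, C ≠ ∞ ∧ ∀ (e : Fin 2) (m₁ m₂ : Plane → ℂ) (K : ℂ × ℂ → ℂ),
      Integrable m₁ → Integrable m₂ → MemLp m₁ 2 volume → MemLp m₂ 2 volume →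
      ∫ k, ‖m₁ k‖ ≤ M → ∫ k, ‖m₂ k‖ ≤ M → K 0 = 0 →
      ContDiff ℝ N K → (∀ i ≤ N, ∀ v, ‖v‖ ≤ M → ‖iteratedFDeriv ℝ i K v‖ ≤ B) →
      ∀ (hK : MemLp (fun z => K (pairInv m₁ m₂ z)) 2 volume),
      energy e r (𝓕 (hK.toLp _ : L2) : L2) ≤ C * (energy e r m₁ + energy e r m₂) := by
  have hN0 : (0 : ℝ) < N := by exact_mod_cast hN
  rcases hrN.eq_or_lt with rfl | hlt
  -- At `r = N` the integral in `t` would diverge logarithmically. Instead the inputs are truncated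
  -- at `|ξₑ| ≤ n`, the band limited estimate is applied, and lower semicontinuity lets `n → ∞`.
  · obtain ⟨C, hC, hCle⟩ := exists_energy_comp_bandLimited_le hN (B := B) hM
    refine ⟨C, hC, ?_⟩
    intro e m₁ m₂ K h₁ h₂ h₁' h₂' hM₁ hM₂ hK0 hKN hB hK
    have hK1 : ContDiff ℝ 1 K := hKN.of_le (by exact_mod_cast hN)
    have hb₁ := fun t => bandLimited_cut e t h₁ h₁'
    have hb₂ := fun t => bandLimited_cut e t h₂ h₂'
    have hc₁ := fun t => (integral_norm_cut_le e t h₁).trans hM₁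
    have hc₂ := fun t => (integral_norm_cut_le e t h₂).trans hM₂
    have hKc := fun t => memLp_comp_pairInv hK1 (hB 1 hN) hK0 hM (hb₁ t).integrable
      (hb₂ t).integrable (hb₁ t).memLp (hb₂ t).memLp (hc₁ t) (hc₂ t)
    have hlim : Tendsto (fun n : ℕ => ((hKc n).toLp _ : L2)) atTop (𝓝 (hK.toLp _)) := by
      rw [Lp.tendsto_Lp_iff_tendsto_eLpNorm'']
      have hsq : Tendsto (fun n : ℕ => eLpNorm ((fun z => K (pairInv (cut e n m₁) (cut e n m₂) z))
          - fun z => K (pairInv m₁ m₂ z)) 2 volume ^ 2) atTop (𝓝 0) := by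
        have htail : Tendsto (fun n : ℕ => ∫⁻ k in {k | (n : ℝ) < |freq e k|},
            (‖m₁ k‖ₑ ^ 2 + ‖m₂ k‖ₑ ^ 2)) atTop (𝓝 0) := by
          have hfin : ∫⁻ k, (‖m₁ k‖ₑ ^ 2 + ‖m₂ k‖ₑ ^ 2) ≠ ∞ := by
            rw [lintegral_add_left' (h₁.1.enorm.pow_const 2), ← eLpNorm_two_sq, ← eLpNorm_two_sq]
            exact ENNReal.add_ne_top.2 ⟨ENNReal.pow_ne_top h₁'.2.ne, ENNReal.pow_ne_top h₂'.2.ne⟩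
          have hmeas : ∀ n : ℕ, MeasurableSet {k | (n : ℝ) < |freq e k|} := fun n => by
            rw [← compl_cut]; exact (measurableSet_cut e n).compl
          simp_rw [← lintegral_indicator (hmeas _)]
          have := tendsto_lintegral_of_dominated_convergence' (μ := (volume : Measure Plane))
            (F := fun (n : ℕ) => indicator {k | (n : ℝ) < |freq e k|}
              fun k => (‖m₁ k‖ₑ ^ 2 + ‖m₂ k‖ₑ ^ 2)) (f := fun _ => 0)
            (fun k => (‖m₁ k‖ₑ ^ 2 + ‖m₂ k‖ₑ ^ 2))
            (fun n => ((h₁.1.enorm.pow_const 2).add (h₂.1.enorm.pow_const 2)).indicator (hmeas n))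
            (fun n => Eventually.of_forall fun k => indicator_le_self _ _ k) hfin
            (Eventually.of_forall fun k => ?_)
          · simpa using this
          · refine tendsto_const_nhds.congr' ?_
            obtain ⟨n₀, hn₀⟩ := exists_nat_ge |freq e k|
            filter_upwards [eventually_ge_atTop n₀] with n hn
            rw [indicator_of_notMem]
            have : |freq e k| ≤ n := hn₀.trans (by exact_mod_cast hn)
            simpa using this
        have h0 : Tendsto (fun n : ℕ => ENNReal.ofReal (B ^ 2) *
            ∫⁻ k in {k | (n : ℝ) < |freq e k|}, (‖m₁ k‖ₑ ^ 2 + ‖m₂ k‖ₑ ^ 2)) atTop (𝓝 0) := by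
          simpa using ENNReal.Tendsto.const_mul htail (Or.inr ENNReal.ofReal_ne_top)
        refine tendsto_of_tendsto_of_tendsto_of_le_of_le tendsto_const_nhds h0
          (fun _ => zero_le) fun n => ?_
        rw [eLpNorm_sub_comm]
        exact eLpNorm_comp_sub_cut_sq_le hK1 (hB 1 hN) e n h₁ h₂ h₁' h₂' hM₁ hM₂
      have := (ENNReal.continuous_rpow_const (y := 1 / 2)).tendsto 0 |>.comp hsq
      simp only [ENNReal.zero_rpow_of_pos (show (0 : ℝ) < 1 / 2 by norm_num)] at this
      refine this.congr fun n => ?_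
      simp only [Function.comp_apply]
      rw [← ENNReal.rpow_natCast, ← ENNReal.rpow_mul]
      norm_num
    rw [energy_eq]
    refine lintegral_mul_fourier_le_of_tendsto hlim (by fun_prop) (fun k => ENNReal.ofReal_ne_top)
      fun n => ?_
    rw [← energy_eq]
    refine (hCle e n _ _ K (hb₁ n) (hb₂ n) (hc₁ n) (hc₂ n) hKN hB (hKc n)).trans ?_
    gcongr <;> exact energy_cut_le _ _ _ _
  -- For `r < N` the tail estimate is integrated against `t^{2r-1}`; `D` collects the constants of
  -- the tail and head integrals.
  · obtain ⟨C, hC, hCle⟩ := lintegral_tail_comp_le hN (B := B) hM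
    set D := ENNReal.ofReal (1 / (2 * r)) + ENNReal.ofReal (1 / (2 * (N - r))) with hD
    refine ⟨ENNReal.ofReal (2 * r) * (C * D), by finiteness, ?_⟩
    intro e m₁ m₂ K h₁ h₂ h₁' h₂' hM₁ hM₂ hK0 hKN hB hK
    set φ : Plane → ℝ≥0∞ := fun k => ‖m₁ k‖ₑ ^ 2 + ‖m₂ k‖ₑ ^ 2 with hφd
    have hφ : AEMeasurable φ volume := (h₁.1.enorm.pow_const 2).add (h₂.1.enorm.pow_const 2)
    set g : L2 := hK.toLp _ with hg
    have hgm : AEMeasurable (fun k => ‖(𝓕 g : L2) k‖ₑ ^ 2) volume :=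
      (Lp.aestronglyMeasurable _).enorm.pow_const 2
    have hmt : Measurable fun t : ℝ => ∫⁻ k in {k | t < |freq e k|}, φ k :=
      Antitone.measurable fun a b hab => lintegral_mono_set fun k hk => lt_of_le_of_lt hab hk
    have hen : energy e r m₁ + energy e r m₂
        = ∫⁻ k, ENNReal.ofReal (|freq e k| ^ (2 * r)) * φ k := by
      rw [energy_eq, energy_eq, ← lintegral_add_left'
        (by exact (Measurable.aemeasurable (by fun_prop)).mul (h₁.1.enorm.pow_const 2))]
      simp only [hφd, mul_add]
    have main : ENNReal.ofReal (1 / (2 * r)) * energy e r (𝓕 g : L2)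
        ≤ C * (D * (energy e r m₁ + energy e r m₂)) := by
      rw [energy_eq, ← lintegral_rpow_mul_tail e hr hgm]
      calc ∫⁻ t in Ioi (0 : ℝ), ENNReal.ofReal (t ^ (2 * r - 1)) *
            ∫⁻ k in {k | t < |freq e k|}, ‖(𝓕 g : L2) k‖ₑ ^ 2
          ≤ ∫⁻ t in Ioi (0 : ℝ), C * (ENNReal.ofReal (t ^ (2 * r - 1)) *
              (∫⁻ k in {k | t < |freq e k|}, φ k) + ENNReal.ofReal (t ^ (2 * r - 1)) *
              (ENNReal.ofReal (t ^ (-(2 * N : ℝ))) * ∫⁻ k in {k | |freq e k| ≤ t},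
                ENNReal.ofReal (|freq e k| ^ (2 * N : ℝ)) * φ k)) := by
            refine setLIntegral_mono' measurableSet_Ioi fun t ht => ?_
            rw [← mul_add, mul_left_comm]
            gcongr
            exact hCle e m₁ m₂ K h₁ h₂ h₁' h₂' hM₁ hM₂ hK0 hKN hB hK t ht
        _ ≤ C * (ENNReal.ofReal (1 / (2 * r)) * (energy e r m₁ + energy e r m₂)
              + ENNReal.ofReal (1 / (2 * (N - r))) * (energy e r m₁ + energy e r m₂)) := by
            rw [lintegral_const_mul' _ _ hC, lintegral_add_left (by fun_prop),
              lintegral_rpow_mul_tail e hr hφ, ← hen]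
            gcongr
            rw [hen]
            exact lintegral_rpow_mul_head_le e hN0 hlt hφ
        _ = _ := by rw [← add_mul]
    calc energy e r (𝓕 g : L2)
        = ENNReal.ofReal (2 * r) * (ENNReal.ofReal (1 / (2 * r)) * energy e r (𝓕 g : L2)) := by
          rw [← mul_assoc, ← ENNReal.ofReal_mul (by positivity), mul_one_div_cancel (by positivity)]
          simp
      _ ≤ _ := by
          rw [mul_assoc, mul_assoc]
          gcongr

/-! ### Homogeneous functions and the regularized derivative of the nonlinearity. -/

/-- Differentiating `H (l v) = l^q H v` in `v`, each derivative brings out a factor `l` on the left,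
so the `i`-th derivative is homogeneous of degree `q - i`. -/
theorem norm_iteratedFDeriv_homogeneous_smul {E F : Type*} [NormedAddCommGroup E]
    [NormedSpace ℝ E] [NormedAddCommGroup F] [NormedSpace ℝ F] {H : E → F} {q : ℝ}
    (hom : ∀ l : ℝ, 0 < l → ∀ v, H (l • v) = (l ^ q) • H v) {i : ℕ} {v : E}
    (hv : ContDiffAt ℝ i H v) {l : ℝ} (hl : 0 < l) :
    ‖iteratedFDeriv ℝ i H (l • v)‖ = l ^ (q - i) * ‖iteratedFDeriv ℝ i H v‖ := by
  let L : E ≃L[ℝ] E := ContinuousLinearEquiv.smulLeft (Units.mk0 l hl.ne')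
  have hL : ∀ w, L w = l • w := fun w => rfl
  have e1 := L.iteratedFDerivWithin_comp_right H uniqueDiffOn_univ (mem_univ (L v)) i
  rw [preimage_univ, iteratedFDerivWithin_univ, iteratedFDerivWithin_univ, hL] at e1
  have e2 : H ∘ L = fun w => (l ^ q) • H w := funext fun w => hom l hl w
  rw [e2, iteratedFDeriv_const_smul_apply' hv] at e1
  have e3 : (iteratedFDeriv ℝ i H (l • v)).compContinuousLinearMap (fun _ => (L : E →L[ℝ] E))
      = (l ^ i) • iteratedFDeriv ℝ i H (l • v) := by
    ext w
    have := (iteratedFDeriv ℝ i H (l • v)).map_smul_univ (fun _ => l) w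
    simpa [hL] using this
  rw [e3] at e1
  have e4 := congrArg norm e1
  rw [norm_smul, norm_smul, Real.norm_of_nonneg (by positivity),
    Real.norm_of_nonneg (by positivity)] at e4
  rw [Real.rpow_sub hl, Real.rpow_natCast, div_mul_eq_mul_div, eq_div_iff (by positivity)]
  linarith

/-- Derivatives of a function that is smooth and homogeneous of degree `q` away from the origin. -/
theorem exists_norm_iteratedFDeriv_homogeneous_le {E F : Type*} [NormedAddCommGroup E]
    [NormedSpace ℝ E] [FiniteDimensional ℝ E] [NormedAddCommGroup F] [NormedSpace ℝ F]
    {H : E → F} {q : ℝ} (hom : ∀ l : ℝ, 0 < l → ∀ v, H (l • v) = (l ^ q) • H v) {N : ℕ}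
    (hH : ∀ v ≠ 0, ContDiffAt ℝ N H v) :
    ∃ C : ℝ, 0 ≤ C ∧ ∀ i ≤ N, ∀ v ≠ 0, ‖iteratedFDeriv ℝ i H v‖ ≤ C * ‖v‖ ^ (q - i) := by
  -- Compactness of the unit sphere gives the bound there; homogeneity carries it to every other
  -- nonzero vector.
  have hb : ∀ i : Finset.range (N + 1), ∃ C : ℝ, ∀ v ∈ Metric.sphere (0 : E) 1,
      ‖iteratedFDeriv ℝ i H v‖ ≤ C := by
    intro i
    refine (isCompact_sphere (0 : E) 1).exists_bound_of_continuousOn fun v hv => ?_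
    refine ((hH v ?_).continuousAt_iteratedFDeriv ?_).continuousWithinAt
    · rintro rfl; simp at hv
    · have := Finset.mem_range.1 i.2
      exact_mod_cast Nat.lt_succ_iff.1 this
  choose C hC using hb
  refine ⟨∑ i, |C i|, by positivity, fun i hi v hv => ?_⟩
  have hv0 : 0 < ‖v‖ := norm_pos_iff.2 hv
  have hunit : ‖v‖⁻¹ • v ≠ 0 := smul_ne_zero (by positivity) hv
  have hs := norm_iteratedFDeriv_homogeneous_smul hom
    ((hH _ hunit).of_le (show ((i : ℕ) : WithTop ℕ∞) ≤ N by exact_mod_cast hi)) hv0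
  rw [smul_inv_smul₀ hv0.ne'] at hs
  rw [hs, mul_comm]
  refine mul_le_mul_of_nonneg_right ?_ (by positivity)
  set i' : Finset.range (N + 1) := ⟨i, Finset.mem_range.2 (by omega)⟩
  refine (hC i' _ (by simp [norm_smul, hv0.ne'])).trans ((le_abs_self _).trans ?_)
  exact Finset.single_le_sum (f := fun i => |C i|) (fun _ _ => abs_nonneg _) (Finset.mem_univ i')

/-- The regularized derivative `DJ(z)a` of `J(z) = (|z|² + τ²)^{q/2} z`, at `v = (z, τ)`. -/
def powerGrad (q : ℝ) (a : ℂ) (v : ℂ × ℝ) : ℂ :=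
  ((‖v.1‖ ^ 2 + v.2 ^ 2) ^ (q / 2)) • a
    + (q * (‖v.1‖ ^ 2 + v.2 ^ 2) ^ (q / 2 - 1) * (v.1.re * a.re + v.1.im * a.im)) • v.1

/-- The regularization parameter is treated as a coordinate: scaling `z` and `τ` together preserves
homogeneity, and the only singular point is then the origin of `ℂ × ℝ`. -/
theorem powerGrad_smul (q : ℝ) (a : ℂ) {l : ℝ} (hl : 0 < l) (v : ℂ × ℝ) :
    powerGrad q a (l • v) = (l ^ q) • powerGrad q a v := by
  have hn : ‖(l • v).1‖ ^ 2 + (l • v).2 ^ 2 = l ^ (2 : ℝ) * (‖v.1‖ ^ 2 + v.2 ^ 2) := by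
    simp only [Prod.smul_fst, Prod.smul_snd, norm_smul, Real.norm_of_nonneg hl.le, smul_eq_mul,
      Real.rpow_two]
    ring
  have h0 : 0 ≤ ‖v.1‖ ^ 2 + v.2 ^ 2 := by positivity
  unfold powerGrad
  rw [hn, Real.mul_rpow (by positivity) h0, Real.mul_rpow (by positivity) h0,
    ← Real.rpow_mul hl.le, ← Real.rpow_mul hl.le, smul_add, smul_smul, smul_smul]
  have h2 : l ^ q = l ^ (2 * (q / 2 - 1)) * (l * l) := by
    rw [show q = 2 * (q / 2 - 1) + (1 + 1) by ring, Real.rpow_add hl, Real.rpow_add hl,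
      Real.rpow_one]
    ring_nf
  congr 1
  · congr 2; ring_nf
  · rw [h2]
    simp only [Prod.smul_fst, Complex.smul_re, Complex.smul_im, smul_eq_mul, smul_smul]
    congr 1
    ring

theorem contDiffAt_powerGrad (q : ℝ) (a : ℂ) (N : ℕ) {v : ℂ × ℝ} (hv : v ≠ 0) :
    ContDiffAt ℝ N (powerGrad q a) v := by
  have hpos : ‖v.1‖ ^ 2 + v.2 ^ 2 ≠ 0 := by
    intro h
    apply hv
    have h1 : ‖v.1‖ ^ 2 = 0 := by nlinarith [sq_nonneg ‖v.1‖, sq_nonneg v.2]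
    have h2 : v.2 ^ 2 = 0 := by nlinarith [sq_nonneg ‖v.1‖, sq_nonneg v.2]
    exact Prod.ext (by simpa using h1) (by simpa using h2)
  have hn : ContDiffAt ℝ N (fun v : ℂ × ℝ => ‖v.1‖ ^ 2 + v.2 ^ 2) v :=
    ((contDiff_fst.norm_sq ℝ).add (contDiff_snd.pow 2)).contDiffAt
  have hre : ContDiffAt ℝ N (fun v : ℂ × ℝ => v.1.re) v :=
    (Complex.reCLM.contDiff.comp contDiff_fst).contDiffAt
  have him : ContDiffAt ℝ N (fun v : ℂ × ℝ => v.1.im) v :=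
    (Complex.imCLM.contDiff.comp contDiff_fst).contDiffAt
  unfold powerGrad
  refine ((hn.rpow_const_of_ne hpos).smul contDiffAt_const).add ?_
  exact (((contDiffAt_const.mul (hn.rpow_const_of_ne hpos)).mul
    ((hre.mul contDiffAt_const).add (him.mul contDiffAt_const))).smul contDiffAt_fst)

theorem norm_iteratedFDeriv_clm_le {E F : Type*} [NormedAddCommGroup E] [NormedSpace ℝ E]
    [NormedAddCommGroup F] [NormedSpace ℝ F] (f : E → F) (L : E →L[ℝ] F)
    (hf : ∀ x, HasFDerivAt f L x) {i : ℕ} (hi : 1 ≤ i) (x : E) :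
    ‖iteratedFDeriv ℝ i f x‖ ≤ ‖L‖ := by
  obtain ⟨j, rfl⟩ : ∃ j, i = j + 1 := ⟨i - 1, by omega⟩
  have h : fderiv ℝ f = fun _ => L := funext fun x => (hf x).fderiv
  rw [← norm_iteratedFDeriv_fderiv, h]
  rcases Nat.eq_zero_or_pos j with rfl | hj
  · simp
  · rw [iteratedFDeriv_const_of_ne hj.ne']; simp

/-- The regularized derivative of the power nonlinearity at `v.1` in the direction `v.2`. -/
def gradReg (q τ : ℝ) (v : ℂ × ℂ) : ℂ :=
  v.2.re • powerGrad q 1 (v.1, τ) + v.2.im • powerGrad q Complex.I (v.1, τ)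

theorem contDiff_powerGrad_fst (q : ℝ) (a : ℂ) {τ : ℝ} (hτ : τ ≠ 0) (N : ℕ) :
    ContDiff ℝ N (fun v : ℂ × ℂ => powerGrad q a (v.1, τ)) :=
  contDiff_iff_contDiffAt.2 fun v => (contDiffAt_powerGrad q a N
    (show (v.1, τ) ≠ 0 by simp [hτ])).comp v (contDiffAt_fst.prodMk contDiffAt_const)

theorem contDiff_gradReg (q : ℝ) {τ : ℝ} (hτ : τ ≠ 0) (N : ℕ) : ContDiff ℝ N (gradReg q τ) :=
  ((Complex.reCLM.contDiff.comp contDiff_snd).smul (contDiff_powerGrad_fst q 1 hτ N)).add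
    ((Complex.imCLM.contDiff.comp contDiff_snd).smul (contDiff_powerGrad_fst q Complex.I hτ N))

/-- In `(z, τ)` the derivatives of order `i` are bounded by a multiple of `|(z, τ)|^{q-i}` with `q -
i ≥ 0`, hence bounded for `|z| ≤ M` and `τ ≤ 1`. Freezing `τ` is composition with an affine map
whose linear part has norm at most one. -/
theorem exists_norm_iteratedFDeriv_powerGrad_le {q : ℝ} {N : ℕ} (hN : (N : ℝ) ≤ q) (a : ℂ)
    (M : ℝ) :
    ∃ B : ℝ, 0 ≤ B ∧ ∀ τ : ℝ, 0 < τ → τ ≤ 1 → ∀ i ≤ N, ∀ v : ℂ × ℂ, ‖v‖ ≤ M →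
      ‖iteratedFDeriv ℝ i (fun v : ℂ × ℂ => powerGrad q a (v.1, τ)) v‖ ≤ B := by
  obtain ⟨C, hC0, hC⟩ := exists_norm_iteratedFDeriv_homogeneous_le
    (fun l hl v => powerGrad_smul q a hl v) (fun v hv => contDiffAt_powerGrad q a N hv)
  set A := max M 1 with hA
  have hA1 : 1 ≤ A := le_max_right _ _
  refine ⟨N.factorial * (C * A ^ q), by positivity, fun τ hτ hτ1 i hi v hv => ?_⟩
  have key := norm_iteratedFDeriv_comp_le' (𝕜 := ℝ) (n := i) (N := N) (g := powerGrad q a)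
    (f := fun v : ℂ × ℂ => (v.1, τ)) (t := {0}ᶜ) (C := C * A ^ q) (D := 1)
    (by rintro _ ⟨w, rfl⟩; simp [hτ.ne']) isOpen_compl_singleton.uniqueDiffOn
    (fun w hw => (contDiffAt_powerGrad q a N hw).contDiffWithinAt)
    (contDiff_fst.prodMk contDiff_const) (by exact_mod_cast hi) v (fun j hj => ?_)
    (fun j hj hji => ?_)
  · rw [one_pow, mul_one] at key
    refine le_trans key ?_
    gcongr
  · have hne : (v.1, τ) ≠ (0 : ℂ × ℝ) := by simp [hτ.ne']
    rw [iteratedFDerivWithin_of_isOpen j isOpen_compl_singleton hne]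
    refine (hC j (hj.trans hi) _ hne).trans ?_
    have hjq : (j : ℝ) ≤ q := le_trans (by exact_mod_cast hj.trans hi) hN
    have hle : ‖(v.1, τ)‖ ≤ A := by
      refine max_le (((norm_fst_le v).trans hv).trans (le_max_left _ _)) ?_
      rw [Real.norm_of_nonneg hτ.le]
      exact hτ1.trans hA1
    gcongr
    calc ‖(v.1, τ)‖ ^ (q - j) ≤ A ^ (q - j) :=
          Real.rpow_le_rpow (norm_nonneg _) hle (by linarith)
      _ ≤ A ^ q := Real.rpow_le_rpow_of_exponent_le hA1 (by linarith [Nat.cast_nonneg (α := ℝ) j])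
  · rw [one_pow]
    refine (norm_iteratedFDeriv_clm_le _
      ((ContinuousLinearMap.fst ℝ ℂ ℂ).prod (0 : ℂ × ℂ →L[ℝ] ℝ))
      (fun x => (hasFDerivAt_fst).prodMk (hasFDerivAt_const τ x)) hj v).trans ?_
    refine ContinuousLinearMap.opNorm_le_bound _ zero_le_one fun w => ?_
    rw [one_mul]
    exact max_le (norm_fst_le w) (by simp)

/-- Leibniz' rule: the binomial coefficients sum to at most `2^N`, and `L` contributes at most `M`
undifferentiated and at most `1` otherwise. -/
theorem norm_iteratedFDeriv_smul_clm_le {L : ℂ × ℂ →L[ℝ] ℝ} (hL : ∀ v, ‖L v‖ ≤ ‖v‖)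
    {g : ℂ × ℂ → ℂ} {N : ℕ} (hg : ContDiff ℝ N g) {B M : ℝ} (hM : 0 ≤ M) {v : ℂ × ℂ}
    (hv : ‖v‖ ≤ M) (hB : ∀ i ≤ N, ‖iteratedFDeriv ℝ i g v‖ ≤ B) {n : ℕ} (hn : n ≤ N) :
    ‖iteratedFDeriv ℝ n (fun v => L v • g v) v‖ ≤ 2 ^ N * (M + 1) * B := by
  have hB0 : 0 ≤ B := (norm_nonneg _).trans (hB 0 (by omega))
  have hLn : ‖L‖ ≤ 1 := ContinuousLinearMap.opNorm_le_bound _ zero_le_one (by simpa using hL)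
  refine (norm_iteratedFDeriv_smul_le (N := N) L.contDiff hg v (by exact_mod_cast hn)).trans ?_
  have hterm : ∀ i ∈ Finset.range (n + 1), (n.choose i : ℝ) * ‖iteratedFDeriv ℝ i L v‖ *
      ‖iteratedFDeriv ℝ (n - i) g v‖ ≤ (n.choose i : ℝ) * ((M + 1) * B) := by
    intro i hi
    rw [mul_assoc]
    have h1 : ‖iteratedFDeriv ℝ i L v‖ ≤ M + 1 := by
      rcases Nat.eq_zero_or_pos i with rfl | hi0
      · rw [norm_iteratedFDeriv_zero]
        linarith [hL v]
      · exact (norm_iteratedFDeriv_clm_le _ L (fun x => L.hasFDerivAt) hi0 v).trans (by linarith)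
    have h2 := hB (n - i) (by omega)
    gcongr
  refine (Finset.sum_le_sum hterm).trans ?_
  rw [← Finset.sum_mul, ← Nat.cast_sum, Nat.sum_range_choose, mul_assoc]
  push_cast
  gcongr
  norm_num

/-- The derivatives of order at most `N ≤ q` of the regularized derivatives of the power
nonlinearity are locally bounded, uniformly in the regularization. -/
theorem exists_norm_iteratedFDeriv_gradReg_le {q : ℝ} {N : ℕ} (hN : (N : ℝ) ≤ q) {M : ℝ}
    (hM : 0 ≤ M) :
    ∃ B : ℝ, 0 ≤ B ∧ ∀ τ : ℝ, 0 < τ → τ ≤ 1 → ∀ i ≤ N, ∀ v : ℂ × ℂ, ‖v‖ ≤ M →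
      ‖iteratedFDeriv ℝ i (gradReg q τ) v‖ ≤ B := by
  obtain ⟨B₁, hB₁0, hB₁⟩ := exists_norm_iteratedFDeriv_powerGrad_le hN 1 M
  obtain ⟨B₂, hB₂0, hB₂⟩ := exists_norm_iteratedFDeriv_powerGrad_le hN Complex.I M
  refine ⟨2 ^ N * (M + 1) * B₁ + 2 ^ N * (M + 1) * B₂, by positivity, fun τ hτ hτ1 i hi v hv => ?_⟩
  let R : ℂ × ℂ →L[ℝ] ℝ := Complex.reCLM ∘L ContinuousLinearMap.snd ℝ ℂ ℂ
  let J : ℂ × ℂ →L[ℝ] ℝ := Complex.imCLM ∘L ContinuousLinearMap.snd ℝ ℂ ℂ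
  have h1 := contDiff_powerGrad_fst q 1 hτ.ne' N
  have h2 := contDiff_powerGrad_fst q Complex.I hτ.ne' N
  have hiN : ((i : ℕ) : WithTop ℕ∞) ≤ N := by exact_mod_cast hi
  have hadd := iteratedFDeriv_add_apply (i := i) (x := v)
    ((R.contDiff.smul h1).of_le hiN).contDiffAt ((J.contDiff.smul h2).of_le hiN).contDiffAt
  have heq : gradReg q τ = (fun v => R v • powerGrad q 1 (v.1, τ)) +
      fun v => J v • powerGrad q Complex.I (v.1, τ) := rfl
  rw [heq]
  refine (congrArg norm hadd).le.trans ((norm_add_le _ _).trans (add_le_add ?_ ?_))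
  · exact norm_iteratedFDeriv_smul_clm_le (L := R)
      (fun w => (Complex.abs_re_le_norm w.2).trans (norm_snd_le w)) h1 hM hv
      (fun j hj => hB₁ τ hτ hτ1 j hj v hv) hi
  · exact norm_iteratedFDeriv_smul_clm_le (L := J)
      (fun w => (Complex.abs_im_le_norm w.2).trans (norm_snd_le w)) h2 hM hv
      (fun j hj => hB₂ τ hτ hτ1 j hj v hv) hi

/-! ### The `H^s_α` norm in terms of directional energies. -/

theorem one_le_weightBase (α : ℝ) (k : Plane) : 1 ≤ 1 + |freq 0 k| ^ 2 + |freq 1 k| ^ α := by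
  have : 0 ≤ |freq 1 k| ^ α := by positivity
  nlinarith [sq_nonneg |freq 0 k|]

theorem sobolevWeight_sq (α s : ℝ) (k : Plane) :
    sobolevWeight α s k ^ 2 = (1 + |freq 0 k| ^ 2 + |freq 1 k| ^ α) ^ s := by
  have h := one_le_weightBase α k
  rw [sobolevWeight, ← Real.rpow_natCast, ← Real.rpow_mul (by linarith)]
  congr 1; push_cast; ring

theorem sobolevWeight_pos (α s : ℝ) (k : Plane) : 0 < sobolevWeight α s k :=
  Real.rpow_pos_of_pos (by linarith [one_le_weightBase α k]) _

theorem one_le_sobolevWeight (α : ℝ) {s : ℝ} (hs : 0 ≤ s) (k : Plane) :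
    1 ≤ sobolevWeight α s k :=
  Real.one_le_rpow (one_le_weightBase α k) (by positivity)

@[fun_prop]
theorem measurable_sobolevWeight (α s : ℝ) : Measurable (sobolevWeight α s) := by
  unfold sobolevWeight; fun_prop

theorem hsNorm_sq (α s : ℝ) (f : L2) :
    hsNorm α s f ^ 2 = ∫⁻ k, ENNReal.ofReal (sobolevWeight α s k ^ 2) * ‖(𝓕 f : L2) k‖ₑ ^ 2 := by
  rw [hsNorm, eLpNorm_two_sq]
  refine lintegral_congr fun k => ?_
  rw [enorm_mul, mul_pow, ENNReal.ofReal_pow (sobolevWeight_pos α s k).le]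
  congr 2
  rw [← ofReal_norm, Complex.norm_real, Real.norm_of_nonneg (sobolevWeight_pos α s k).le]

theorem energy_zero_le (α : ℝ) {s : ℝ} (hs : 0 ≤ s) (f : L2) :
    energy 0 s (𝓕 f : L2) ≤ hsNorm α s f ^ 2 := by
  rw [energy_eq, hsNorm_sq]
  refine lintegral_mono fun k => ?_
  gcongr
  rw [sobolevWeight_sq, Real.rpow_mul (abs_nonneg _), Real.rpow_two]
  have : 0 ≤ |freq 1 k| ^ α := by positivity
  exact Real.rpow_le_rpow (by positivity) (by linarith) hs

theorem energy_one_le (α : ℝ) {s : ℝ} (hs : 0 ≤ s) (f : L2) :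
    energy 1 (α * s / 2) (𝓕 f : L2) ≤ hsNorm α s f ^ 2 := by
  rw [energy_eq, hsNorm_sq]
  refine lintegral_mono fun k => ?_
  gcongr
  rw [sobolevWeight_sq, show 2 * (α * s / 2) = α * s by ring, Real.rpow_mul (abs_nonneg _)]
  exact Real.rpow_le_rpow (by positivity) (by nlinarith [sq_nonneg |freq 0 k|]) hs

theorem eLpNorm_le_hsNorm (α : ℝ) {s : ℝ} (hs : 0 ≤ s) (f : L2) :
    eLpNorm f 2 volume ≤ hsNorm α s f := by
  rw [← eLpNorm_fourier]
  refine eLpNorm_mono fun k => ?_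
  rw [norm_mul, Complex.norm_real, Real.norm_of_nonneg (sobolevWeight_pos α s k).le]
  exact le_mul_of_one_le_left (norm_nonneg _) (one_le_sobolevWeight α hs k)

/-- From `(1+a+b)^s ≤ 3^s max(1,a,b)^s ≤ 3^s (1+a^s+b^s)`. This reduces composition in `H^s_α` to
one direction at a time. -/
theorem hsNorm_sq_le (α : ℝ) {s : ℝ} (hs : 0 ≤ s) (f : L2) :
    hsNorm α s f ^ 2 ≤ ENNReal.ofReal (3 ^ s) * (eLpNorm f 2 volume ^ 2
      + (energy 0 s (𝓕 f : L2) + energy 1 (α * s / 2) (𝓕 f : L2))) := by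
  have hm : AEMeasurable (fun k => ‖(𝓕 f : L2) k‖ₑ ^ 2) volume :=
    (Lp.aestronglyMeasurable _).enorm.pow_const 2
  rw [hsNorm_sq, energy_eq, energy_eq, ← eLpNorm_fourier, eLpNorm_two_sq,
    ← lintegral_add_left' (by exact (Measurable.aemeasurable (by fun_prop)).mul hm),
    ← lintegral_add_left' hm, ← lintegral_const_mul' _ _ ENNReal.ofReal_ne_top]
  refine lintegral_mono fun k => ?_
  rw [← add_mul, ← one_add_mul, ← mul_assoc, ← ENNReal.ofReal_add (by positivity) (by positivity),
    ← ENNReal.ofReal_one, ← ENNReal.ofReal_add (by positivity) (by positivity),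
    ← ENNReal.ofReal_mul (by positivity)]
  gcongr
  rw [sobolevWeight_sq, show 2 * (α * s / 2) = α * s by ring, Real.rpow_mul (abs_nonneg _),
    Real.rpow_mul (abs_nonneg _), Real.rpow_two]
  set a := |freq 0 k| ^ 2
  set b := |freq 1 k| ^ α
  have ha : 0 ≤ a := by positivity
  have hb : 0 ≤ b := by positivity
  set c := max 1 (max a b) with hc
  have hc1 : 1 ≤ c := le_max_left _ _
  have hca : a ≤ c := (le_max_left _ _).trans (le_max_right _ _)
  have hcb : b ≤ c := (le_max_right _ _).trans (le_max_right _ _)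
  calc (1 + a + b) ^ s ≤ (3 * c) ^ s := Real.rpow_le_rpow (by positivity) (by linarith) hs
    _ = 3 ^ s * c ^ s := Real.mul_rpow (by norm_num) (by positivity)
    _ ≤ 3 ^ s * (1 + (a ^ s + b ^ s)) := by
        gcongr
        have h1 : 0 ≤ a ^ s := by positivity
        have h2 : 0 ≤ b ^ s := by positivity
        rcases max_choice 1 (max a b) with h | h
        · rw [hc, h, Real.one_rpow]; linarith
        · rcases max_choice a b with h' | h' <;> rw [hc, h, h'] <;> linarith

/-! ### The Wiener norm -/

theorem integrable_prod_coord {f₀ f₁ : ℝ → ℝ} (h₀ : Integrable f₀) (h₁ : Integrable f₁) :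
    Integrable (fun k : Plane => f₀ (k 0) * f₁ (k 1)) := by
  let F : Fin 2 → ℝ → ℝ := ![f₀, f₁]
  have h := Integrable.fintype_prod (f := F) (μ := fun _ => volume) (fun i => by
    fin_cases i
    · exact h₀
    · exact h₁)
  have h2 := (PiLp.volume_preserving_ofLp (Fin 2)).integrable_comp_of_integrable h
  refine h2.congr (Eventually.of_forall fun k => ?_)
  simp [Fin.prod_univ_two, F]

/-- The exponent is divided as `s = b₀ + b₁`, each `bᵢ` receiving half of the surplus over `1/2 +
1/α`. The integrand is then at most a constant times `(1+x²)^{-b₀} (1+|y|)^{-αb₁}`, and both factors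
are integrable since `2b₀ > 1` and `αb₁ > 1`. -/
theorem lintegral_sobolevWeight_ne_top {α s : ℝ} (hα0 : 0 < α) (hα2 : α ≤ 2)
    (hs : 1 / 2 + 1 / α < s) :
    ∫⁻ k, ENNReal.ofReal ((sobolevWeight α s k ^ 2)⁻¹) ≠ ∞ := by
  set δ := (s - 1 / 2 - 1 / α) / 2 with hδ
  have hδ0 : 0 < δ := by rw [hδ]; linarith
  set b₀ := 1 / 2 + δ with hb₀
  set b₁ := 1 / α + δ with hb₁
  have hb1pos : 0 < b₁ := by positivity
  have hsum : b₀ + b₁ = s := by rw [hb₀, hb₁, hδ]; ring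
  have i₀ : Integrable (fun x : ℝ => (1 + ‖x‖ ^ 2) ^ (-(2 * b₀) / 2)) :=
    integrable_rpow_neg_one_add_norm_sq (by simp; linarith)
  have i₁ : Integrable (fun x : ℝ => (4 : ℝ) ^ b₁ * (1 + ‖x‖) ^ (-(α * b₁))) :=
    (integrable_one_add_norm (by
      have : α * b₁ = 1 + α * δ := by rw [hb₁]; field_simp
      simp only [Module.finrank_self, Nat.cast_one, this]
      have : 0 < α * δ := by positivity
      linarith)).const_mul _
  refine ((integrable_prod_coord i₀ i₁).lintegral_lt_top.trans_le' ?_).ne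
  refine lintegral_mono fun k => ENNReal.ofReal_le_ofReal ?_
  have hpi : 1 ≤ 2 * Real.pi := by linarith [Real.pi_gt_three]
  have hle : ∀ i, |k i| ≤ |freq i k| := fun i => by
    rw [freq, abs_mul, abs_of_pos (show (0 : ℝ) < 2 * Real.pi by positivity)]
    exact le_mul_of_one_le_left (abs_nonneg _) hpi
  have hb := one_le_weightBase α k
  rw [sobolevWeight_sq, ← Real.rpow_neg (by linarith), ← hsum, neg_add,
    Real.rpow_add (by linarith)]
  refine mul_le_mul ?_ ?_ (by positivity) (by positivity)
  · rw [show -(2 * b₀) / 2 = -b₀ by ring]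
    refine Real.rpow_le_rpow_of_nonpos (by positivity) ?_ (by rw [hb₀]; linarith)
    have h1 : |k 0| ^ 2 ≤ |freq 0 k| ^ 2 := pow_le_pow_left₀ (abs_nonneg _) (hle 0) 2
    have : 0 ≤ |freq 1 k| ^ α := by positivity
    simp only [Real.norm_eq_abs]
    linarith
  · have h4 : (1 + |k 1|) ^ α ≤ 4 * (1 + |k 1| ^ α) := by
      have hm : 1 + |k 1| ≤ 2 * max 1 |k 1| := by
        linarith [le_max_left 1 |k 1|, le_max_right 1 |k 1|]
      calc (1 + |k 1|) ^ α ≤ (2 * max 1 |k 1|) ^ α :=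
            Real.rpow_le_rpow (by positivity) hm hα0.le
        _ = 2 ^ α * (max 1 |k 1|) ^ α := Real.mul_rpow (by norm_num) (by positivity)
        _ ≤ 4 * (1 + |k 1| ^ α) := by
            refine mul_le_mul ?_ ?_ (by positivity) (by norm_num)
            · calc (2 : ℝ) ^ α ≤ 2 ^ (2 : ℝ) :=
                    Real.rpow_le_rpow_of_exponent_le (by norm_num) hα2
                _ = 4 := by norm_num
            · have : 0 ≤ |k 1| ^ α := by positivity
              rcases max_choice 1 |k 1| with h | h <;> rw [h]
              · rw [Real.one_rpow]; linarith
              · linarith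
    have h5 : (1 + |k 1|) ^ α / 4 ≤ 1 + |freq 0 k| ^ 2 + |freq 1 k| ^ α := by
      have h6 : |k 1| ^ α ≤ |freq 1 k| ^ α := Real.rpow_le_rpow (abs_nonneg _) (hle 1) hα0.le
      have := sq_nonneg |freq 0 k|
      rw [div_le_iff₀ (by norm_num)]
      linarith
    refine (Real.rpow_le_rpow_of_nonpos (by positivity) h5 (by linarith)).trans (le_of_eq ?_)
    rw [Real.div_rpow (by positivity) (by norm_num), ← Real.rpow_mul (by positivity),
      Real.rpow_neg (by norm_num : (0 : ℝ) ≤ 4), div_inv_eq_mul, mul_comm, mul_neg]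
    simp

/-- `H^s_α` embeds into the Wiener algebra. -/
theorem exists_lintegral_fourier_le {α s : ℝ} (hα0 : 0 < α) (hα2 : α ≤ 2)
    (hs : 1 / 2 + 1 / α < s) :
    ∃ C : ℝ≥0∞, C ≠ ∞ ∧ ∀ f : L2, ∫⁻ k, ‖(𝓕 f : L2) k‖ₑ ≤ C * hsNorm α s f := by
  refine ⟨(∫⁻ k, ENNReal.ofReal ((sobolevWeight α s k ^ 2)⁻¹)) ^ (1 / 2 : ℝ),
    ENNReal.rpow_ne_top_of_nonneg (by norm_num) (lintegral_sobolevWeight_ne_top hα0 hα2 hs),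
    fun f => ?_⟩
  -- Cauchy–Schwarz, with the weight inserted in one factor and its inverse in the other.
  have h := ENNReal.lintegral_mul_le_Lp_mul_Lq (volume : Measure Plane) Real.HolderConjugate.two_two
    (f := fun k => ENNReal.ofReal ((sobolevWeight α s k)⁻¹))
    (g := fun k => ‖(sobolevWeight α s k : ℂ) * (𝓕 f : L2) k‖ₑ)
    (Measurable.aemeasurable (by fun_prop))
    (AEStronglyMeasurable.mul (Measurable.aestronglyMeasurable (by fun_prop))
      (Lp.aestronglyMeasurable _)).enorm
  refine le_trans (le_of_eq ?_) (h.trans (le_of_eq ?_))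
  · refine lintegral_congr fun k => ?_
    have hw := sobolevWeight_pos α s k
    simp only [Pi.mul_apply, ← ofReal_norm]
    rw [← ENNReal.ofReal_mul (by positivity), norm_mul, Complex.norm_real,
      Real.norm_of_nonneg hw.le, inv_mul_cancel_left₀ hw.ne']
  · congr 1
    · congr 1
      refine lintegral_congr fun k => ?_
      rw [ENNReal.rpow_two, ← ENNReal.ofReal_pow (inv_nonneg.2 (sobolevWeight_pos α s k).le),
        inv_pow]
    · rw [hsNorm, eLpNorm_eq_lintegral_rpow_enorm_toReal (by norm_num) (by norm_num)]
      simp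

/-! ### The norm of `H^s_α` -/

section HsNorm

variable {α s : ℝ}

theorem aestronglyMeasurable_weight_mul (α s : ℝ) (f : L2) :
    AEStronglyMeasurable (fun k : Plane => (sobolevWeight α s k : ℂ) * (𝓕 f : L2) k) volume :=
  AEStronglyMeasurable.mul (Measurable.aestronglyMeasurable (by fun_prop))
    (Lp.aestronglyMeasurable _)

theorem fourier_coe_add (f g : L2) :
    ((𝓕 (f + g) : L2) : Plane → ℂ) =ᵐ[volume] fun k => (𝓕 f : L2) k + (𝓕 g : L2) k := by
  rw [FourierTransform.fourier_add]
  exact Lp.coeFn_add _ _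

theorem fourier_coe_sub (f g : L2) :
    ((𝓕 (f - g) : L2) : Plane → ℂ) =ᵐ[volume] fun k => (𝓕 f : L2) k - (𝓕 g : L2) k := by
  have : (𝓕 (f - g) : L2) = 𝓕 f - 𝓕 g := (Lp.fourierTransformₗᵢ Plane ℂ).map_sub f g
  rw [this]
  exact Lp.coeFn_sub _ _

theorem fourier_coe_smul (c : ℂ) (f : L2) :
    ((𝓕 (c • f) : L2) : Plane → ℂ) =ᵐ[volume] fun k => c * (𝓕 f : L2) k := by
  rw [FourierTransform.fourier_smul]
  exact Lp.coeFn_smul _ _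

theorem hsNorm_add_le (f g : L2) : hsNorm α s (f + g) ≤ hsNorm α s f + hsNorm α s g := by
  have h := eLpNorm_add_le (aestronglyMeasurable_weight_mul α s f)
    (aestronglyMeasurable_weight_mul α s g) (p := 2) (by norm_num)
  refine le_trans (le_of_eq (eLpNorm_congr_ae ?_)) h
  exact (fourier_coe_add f g).mono fun k hk => by
          simp only [hk, Pi.add_apply, mul_add]

theorem hsNorm_smul (c : ℂ) (f : L2) : hsNorm α s (c • f) = ‖c‖ₑ * hsNorm α s f := by
  rw [hsNorm, hsNorm, ← eLpNorm_const_smul]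
  exact eLpNorm_congr_ae ((fourier_coe_smul c f).mono fun k hk => by
    simp only [hk, Pi.smul_apply, smul_eq_mul]; ring)

theorem hsNorm_neg (f : L2) : hsNorm α s (-f) = hsNorm α s f := by
  rw [← neg_one_smul ℂ f, hsNorm_smul]; simp

theorem hsNorm_sub_comm (f g : L2) : hsNorm α s (f - g) = hsNorm α s (g - f) := by
  rw [← hsNorm_neg, neg_sub]

theorem hsNorm_sub_le (f g : L2) : hsNorm α s (f - g) ≤ hsNorm α s f + hsNorm α s g := by
  rw [sub_eq_add_neg, ← hsNorm_neg g]
  exact hsNorm_add_le _ _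

theorem hsNorm_zero : hsNorm α s 0 = 0 := by
  have := hsNorm_smul (α := α) (s := s) 0 0
  simpa using this

theorem eq_zero_of_hsNorm_eq_zero (hs : 0 ≤ s) {f : L2} (h : hsNorm α s f = 0) : f = 0 := by
  have := eLpNorm_le_hsNorm α hs f
  rw [h, nonpos_iff_eq_zero, ← Lp.enorm_def, enorm_eq_zero] at this
  exact this

/-! ### Truncated weights -/

/-- The weight restricted to frequencies where it is at most `n`. -/
def truncWeight (α s : ℝ) (n : ℕ) (k : Plane) : ℝ :=
  {k | sobolevWeight α s k ≤ n}.indicator (sobolevWeight α s) k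

theorem measurable_truncWeight (α s : ℝ) (n : ℕ) : Measurable (truncWeight α s n) :=
  (measurable_sobolevWeight α s).indicator
    (measurableSet_le (measurable_sobolevWeight α s) measurable_const)

theorem truncWeight_nonneg (α s : ℝ) (n : ℕ) (k : Plane) : 0 ≤ truncWeight α s n k :=
  indicator_nonneg (fun k _ => (sobolevWeight_pos α s k).le) k

theorem truncWeight_le (α s : ℝ) (n : ℕ) (k : Plane) : truncWeight α s n k ≤ n := by
  unfold truncWeight
  by_cases h : k ∈ {k | sobolevWeight α s k ≤ n}
  · rw [indicator_of_mem h]; exact h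
  · rw [indicator_of_notMem h]; positivity

theorem truncWeight_le_sobolevWeight (α s : ℝ) (n : ℕ) (k : Plane) :
    truncWeight α s n k ≤ sobolevWeight α s k :=
  indicator_le_self' (fun k _ => (sobolevWeight_pos α s k).le) k

theorem memLp_truncWeight_mul (α s : ℝ) (n : ℕ) (g : L2) :
    MemLp (fun k : Plane => (truncWeight α s n k : ℂ) * g k) 2 volume := by
  refine (Lp.memLp g).of_le_mul (c := n) (AEStronglyMeasurable.mul
    (Complex.measurable_ofReal.comp (measurable_truncWeight α s n)).aestronglyMeasurable
      (Lp.aestronglyMeasurable g)) (Eventually.of_forall fun k => ?_)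
  rw [norm_mul, Complex.norm_real, Real.norm_of_nonneg (truncWeight_nonneg α s n k)]
  exact mul_le_mul_of_nonneg_right (truncWeight_le α s n k) (norm_nonneg _)

/-- Multiplication of the Fourier transform by the truncated weight, as an operator on `L²`. -/
def truncOp (α s : ℝ) (n : ℕ) : L2 →L[ℂ] L2 :=
  LinearMap.mkContinuous
    { toFun := fun f => (memLp_truncWeight_mul α s n (𝓕 f)).toLp _
      map_add' := fun f g => by
        rw [← MemLp.toLp_add, MemLp.toLp_eq_toLp_iff]
        exact (fourier_coe_add f g).mono fun k hk => by
          simp only [hk, Pi.add_apply, mul_add]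
      map_smul' := fun c f => by
        rw [RingHom.id_apply, ← MemLp.toLp_const_smul, MemLp.toLp_eq_toLp_iff]
        exact (fourier_coe_smul c f).mono fun k hk => by
          simp only [hk, Pi.smul_apply, smul_eq_mul]; ring }
    n fun f => by
      refine (Lp.norm_le_mul_norm_of_ae_le_mul (c := n) (g := (𝓕 f : L2)) ?_).trans_eq
        (by rw [Lp.norm_fourier_eq])
      filter_upwards [(memLp_truncWeight_mul α s n (𝓕 f)).coeFn_toLp] with k hk
      rw [LinearMap.coe_mk, AddHom.coe_mk, hk, norm_mul, Complex.norm_real,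
        Real.norm_of_nonneg (truncWeight_nonneg α s n k)]
      exact mul_le_mul_of_nonneg_right (truncWeight_le α s n k) (norm_nonneg _)

theorem enorm_truncOp (n : ℕ) (f : L2) :
    ‖truncOp α s n f‖ₑ
      = eLpNorm (fun k : Plane => (truncWeight α s n k : ℂ) * (𝓕 f : L2) k) 2 volume := by
  rw [Lp.enorm_def]
  exact eLpNorm_congr_ae (memLp_truncWeight_mul α s n (𝓕 f)).coeFn_toLp

theorem enorm_truncOp_le (n : ℕ) (f : L2) : ‖truncOp α s n f‖ₑ ≤ hsNorm α s f := by
  rw [enorm_truncOp]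
  refine eLpNorm_mono fun k => ?_
  rw [norm_mul, norm_mul, Complex.norm_real, Complex.norm_real,
    Real.norm_of_nonneg (truncWeight_nonneg α s n k),
    Real.norm_of_nonneg (sobolevWeight_pos α s k).le]
  exact mul_le_mul_of_nonneg_right (truncWeight_le_sobolevWeight α s n k) (norm_nonneg _)

/-- Fatou, since at each frequency the truncated weight eventually equals the full one. Estimates in
`H^s_α` can thus be proved through bounded operators on `L²`, which commute with Bochner integrals
and derivatives. -/
theorem hsNorm_le_of_truncOp_le {f : L2} {E : ℝ≥0∞} (h : ∀ n, ‖truncOp α s n f‖ₑ ≤ E) :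
    hsNorm α s f ≤ E := by
  refine (Lp.eLpNorm_lim_le_liminf_eLpNorm (p := 2) (μ := (volume : Measure Plane))
    (f := fun n k => (truncWeight α s n k : ℂ) * (𝓕 f : L2) k)
    (fun n => (memLp_truncWeight_mul α s n (𝓕 f)).1) _ (Eventually.of_forall fun k => ?_)).trans ?_
  · refine tendsto_const_nhds.congr' ?_
    obtain ⟨n₀, hn₀⟩ := exists_nat_ge (sobolevWeight α s k)
    filter_upwards [eventually_ge_atTop n₀] with n hn
    have : k ∈ {k | sobolevWeight α s k ≤ n} := hn₀.trans (by exact_mod_cast hn)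
    rw [truncWeight, indicator_of_mem this]
  · simp_rw [← enorm_truncOp]
    refine (liminf_le_liminf (Eventually.of_forall h)).trans ?_
    simp

/-- Minkowski's inequality for Bochner integrals in `L²`. -/
theorem hsNorm_integral_le {μ : Measure ℝ} {g : ℝ → L2} (hg : Integrable g μ) :
    hsNorm α s (∫ t, g t ∂μ) ≤ ∫⁻ t, hsNorm α s (g t) ∂μ := by
  refine hsNorm_le_of_truncOp_le fun n => ?_
  rw [← (truncOp α s n).integral_comp_comm hg]
  exact (enorm_integral_le_lintegral_enorm _).trans
    (lintegral_mono fun t => enorm_truncOp_le n (g t))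

end HsNorm

/-! ### Pointwise properties of the power nonlinearity -/

theorem gradReg_eq (q τ : ℝ) (v : ℂ × ℂ) :
    gradReg q τ v = ((‖v.1‖ ^ 2 + τ ^ 2) ^ (q / 2)) • v.2
      + (q * (‖v.1‖ ^ 2 + τ ^ 2) ^ (q / 2 - 1) * (v.1.re * v.2.re + v.1.im * v.2.im)) • v.1 := by
  simp only [gradReg, powerGrad, Complex.one_re, Complex.one_im, Complex.I_re, Complex.I_im]
  apply Complex.ext <;> simp <;> ring

theorem gradReg_smul (q τ : ℝ) (z h : ℂ) (c : ℝ) :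
    gradReg q τ (z, c • h) = c • gradReg q τ (z, h) := by
  simp only [gradReg, Complex.smul_re, Complex.smul_im, smul_add, smul_smul, smul_eq_mul]

theorem gradReg_zero_right (q τ : ℝ) (z : ℂ) : gradReg q τ (z, 0) = 0 := by
  simp [gradReg]

theorem tendsto_gradReg {q : ℝ} (hq : 2 ≤ q) (v : ℂ × ℂ) :
    Tendsto (fun τ => gradReg q τ v) (𝓝 0) (𝓝 (gradReg q 0 v)) := by
  have h1 : Continuous fun x : ℝ => x ^ (q / 2) := Real.continuous_rpow_const (by linarith)
  have h2 : Continuous fun x : ℝ => x ^ (q / 2 - 1) := Real.continuous_rpow_const (by linarith)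
  have : Continuous fun τ => gradReg q τ v := by
    simp only [gradReg_eq]
    have hn : Continuous fun τ : ℝ => ‖v.1‖ ^ 2 + τ ^ 2 := by fun_prop
    exact ((h1.comp hn).smul continuous_const).add
      (((continuous_const.mul (h2.comp hn)).mul continuous_const).smul continuous_const)
  exact this.tendsto 0

/-- The regularized power nonlinearity. -/
def powerReg (q τ : ℝ) (z : ℂ) : ℂ := ((‖z‖ ^ 2 + τ ^ 2) ^ (q / 2)) • z

theorem powerReg_zero (p : ℝ) (z : ℂ) : powerReg (p - 1) 0 z = power p z := by
  unfold powerReg power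
  have : (‖z‖ ^ 2 + (0 : ℝ) ^ 2) ^ ((p - 1) / 2) = ‖z‖ ^ (p - 1) := by
    rw [zero_pow two_ne_zero, add_zero, ← Real.rpow_natCast, ← Real.rpow_mul (norm_nonneg _)]
    congr 1; push_cast; ring
  rw [this, Complex.real_smul]

theorem tendsto_powerReg {q : ℝ} (hq : 0 ≤ q) (z : ℂ) :
    Tendsto (fun τ => powerReg q τ z) (𝓝 0) (𝓝 (powerReg q 0 z)) := by
  have h1 : Continuous fun x : ℝ => x ^ (q / 2) := Real.continuous_rpow_const (by linarith)
  have hn : Continuous fun τ : ℝ => ‖z‖ ^ 2 + τ ^ 2 := by fun_prop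
  exact ((h1.comp hn).smul continuous_const).tendsto 0

theorem hasDerivAt_powerReg (q : ℝ) {τ : ℝ} (hτ : 0 < τ) (z k : ℂ) (θ : ℝ) :
    HasDerivAt (fun θ : ℝ => powerReg q τ (z + θ • k)) (gradReg q τ (z + θ • k, k)) θ := by
  have hlin : HasDerivAt (fun θ : ℝ => z + θ • k) k θ := by
    simpa using ((hasDerivAt_id θ).smul_const k).const_add z
  have hn : HasDerivAt (fun θ : ℝ => ‖z + θ • k‖ ^ 2 + τ ^ 2)
      (2 * ((z + θ • k).re * k.re + (z + θ • k).im * k.im)) θ := by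
    have := (hlin.norm_sq).add_const (τ ^ 2)
    refine this.congr_deriv ?_
    rw [Complex.inner]
    simp
    ring
  have hne : ‖z + θ • k‖ ^ 2 + τ ^ 2 ≠ 0 := by positivity
  have := (hn.rpow_const (p := q / 2) (Or.inl hne)).smul hlin
  refine this.congr_deriv ?_
  rw [gradReg_eq]
  congr 2
  ring

/-- By linearity in `k`, the direction is rescaled to length `M`; both points then lie in the ball
where `gradReg` is Lipschitz uniformly in `τ`. -/
theorem norm_gradReg_sub_le {q : ℝ} (hq : 1 ≤ q) {M : ℝ} (hM : 0 < M) :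
    ∃ C : ℝ, 0 ≤ C ∧ ∀ τ : ℝ, 0 < τ → τ ≤ 1 → ∀ a b k : ℂ, ‖a‖ ≤ M → ‖b‖ ≤ M →
      ‖gradReg q τ (a, k) - gradReg q τ (b, k)‖ ≤ C * ‖k‖ * ‖a - b‖ := by
  obtain ⟨B, hB0, hB⟩ := exists_norm_iteratedFDeriv_gradReg_le (N := 1) (by simpa using hq) hM.le
  refine ⟨B / M, by positivity, fun τ hτ hτ1 a b k ha hb => ?_⟩
  rcases eq_or_ne k 0 with rfl | hk
  · simp [gradReg_zero_right]
  have hk0 : 0 < ‖k‖ := norm_pos_iff.2 hk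
  set k' := (M / ‖k‖) • k with hk'
  have hk'n : ‖k'‖ = M := by
    rw [hk', norm_smul, Real.norm_of_nonneg (by positivity)]
    field_simp
  have hkk : k = (‖k‖ / M) • k' := by
    rw [hk', smul_smul, div_mul_div_cancel₀ hM.ne', div_self hk0.ne', one_smul]
  have h := norm_sub_le_of_bound (K := gradReg q τ)
    (by simpa using contDiff_gradReg q hτ.ne' 1) (hB τ hτ hτ1 1 le_rfl)
    (v := (a, k')) (w := (b, k')) (max_le ha hk'n.le) (max_le hb hk'n.le)
  have hn : ‖((a, k') : ℂ × ℂ) - (b, k')‖ = ‖a - b‖ := by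
    simp [Prod.norm_def]
  rw [hn] at h
  have e : ∀ c, gradReg q τ (c, k) = (‖k‖ / M) • gradReg q τ (c, k') := fun c => by
    rw [← gradReg_smul, ← hkk]
  rw [e a, e b, ← smul_sub, norm_smul, Real.norm_of_nonneg (by positivity)]
  calc ‖k‖ / M * ‖gradReg q τ (a, k') - gradReg q τ (b, k')‖
      ≤ ‖k‖ / M * (B * ‖a - b‖) := by gcongr
    _ = _ := by ring

/-- Second order Taylor estimate for the power nonlinearity. -/
theorem norm_power_add_sub_le {p : ℝ} (hp : 3 ≤ p) {M : ℝ} (hM : 0 < M) :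
    ∃ C : ℝ, 0 ≤ C ∧ ∀ z k : ℂ, ‖z‖ ≤ M → ‖z + k‖ ≤ M →
      ‖power p (z + k) - power p z - gradReg (p - 1) 0 (z, k)‖ ≤ C * ‖k‖ ^ 2 := by
  obtain ⟨C, hC0, hC⟩ := norm_gradReg_sub_le (q := p - 1) (by linarith) hM
  refine ⟨C, hC0, fun z k hz hzk => ?_⟩
  -- For `τ > 0` the mean value inequality is applied to `θ ↦ J_τ(z + θk) - θ DJ_τ(z)k`, whose
  -- derivative is at most `C θ |k|²`. The bound is uniform in `τ`, so `τ → 0` is harmless.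
  have hreg : ∀ τ : ℝ, 0 < τ → τ ≤ 1 →
      ‖powerReg (p - 1) τ (z + k) - powerReg (p - 1) τ z - gradReg (p - 1) τ (z, k)‖
        ≤ C * ‖k‖ ^ 2 := by
    intro τ hτ hτ1
    have hd : ∀ θ ∈ Icc (0 : ℝ) 1, HasDerivWithinAt
        (fun θ : ℝ => powerReg (p - 1) τ (z + θ • k) - θ • gradReg (p - 1) τ (z, k))
        (gradReg (p - 1) τ (z + θ • k, k) - gradReg (p - 1) τ (z, k)) (Icc 0 1) θ := by
      intro θ _
      have h1 := (hasDerivAt_id θ).smul_const (gradReg (p - 1) τ (z, k))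
      rw [one_smul] at h1
      exact ((hasDerivAt_powerReg (p - 1) hτ z k θ).sub h1).hasDerivWithinAt
    have := norm_image_sub_le_of_norm_deriv_le_segment_01' hd (C := C * ‖k‖ ^ 2) fun θ hθ => ?_
    · simp only [one_smul, zero_smul, add_zero, sub_zero] at this
      rwa [sub_right_comm] at this
    · have hball : ‖z + θ • k‖ ≤ M := by
        have he : z + θ • k = (1 - θ) • z + θ • (z + k) := by
          simp only [Complex.real_smul]; push_cast; ring
        rw [he]
        refine (norm_add_le _ _).trans ?_
        rw [norm_smul, norm_smul, Real.norm_of_nonneg hθ.1,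
          Real.norm_of_nonneg (by linarith [hθ.2])]
        nlinarith [hθ.1, hθ.2]
      refine (hC τ hτ hτ1 _ _ k hball hz).trans ?_
      rw [add_sub_cancel_left, norm_smul, Real.norm_of_nonneg hθ.1]
      have : C * ‖k‖ * (θ * ‖k‖) = C * ‖k‖ ^ 2 * θ := by ring
      rw [this]
      exact mul_le_of_le_one_right (by positivity) hθ.2.le
  simp only [← powerReg_zero]
  have hlim := (((tendsto_powerReg (q := p - 1) (by linarith) (z + k)).sub
    (tendsto_powerReg (q := p - 1) (by linarith) z)).sub
    (tendsto_gradReg (q := p - 1) (by linarith) (z, k))).norm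
  refine le_of_tendsto (hlim.mono_left (nhdsWithin_le_nhds (s := Ioi 0))) ?_
  filter_upwards [Ioc_mem_nhdsGT (show (0 : ℝ) < 1 by norm_num)] with τ hτ
  exact hreg τ hτ.1 hτ.2

/-! ### The derivative of the nonlinearity on `H^s_α`. -/

section Nonlinearity

variable {α s : ℝ}

/-- Dominated convergence in `L²`. -/
theorem tendsto_toLp_of_dominated {G : ℕ → Plane → ℂ} {g : Plane → ℂ} {b : Plane → ℝ}
    (hG : ∀ n, MemLp (G n) 2 volume) (hg : MemLp g 2 volume) (hb : MemLp b 2 volume)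
    (hGb : ∀ n, ∀ z, ‖G n z‖ ≤ b z) (hlim : ∀ z, Tendsto (fun n => G n z) atTop (𝓝 (g z))) :
    Tendsto (fun n => ((hG n).toLp _ : L2)) atTop (𝓝 (hg.toLp _)) := by
  have hgb : ∀ z, ‖g z‖ ≤ b z := fun z =>
    le_of_tendsto (hlim z).norm (Eventually.of_forall fun n => hGb n z)
  rw [Lp.tendsto_Lp_iff_tendsto_eLpNorm'']
  have hsq : Tendsto (fun n => eLpNorm (G n - g) 2 volume ^ 2) atTop (𝓝 0) := by
    simp_rw [eLpNorm_two_sq]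
    have := tendsto_lintegral_of_dominated_convergence' (μ := (volume : Measure Plane))
      (F := fun n z => ‖(G n - g) z‖ₑ ^ 2) (f := fun _ => 0) (fun z => ‖(2 : ℝ) * b z‖ₑ ^ 2)
      (fun n => ((hG n).sub hg).1.enorm.pow_const 2)
      (fun n => Eventually.of_forall fun z => ?_) ?_ (Eventually.of_forall fun z => ?_)
    · simpa using this
    · have h1 := norm_sub_le (G n z) (g z)
      have h2 : ‖G n z - g z‖ ≤ ‖2 * b z‖ := by
        refine h1.trans (le_trans ?_ (le_abs_self _))
        linarith [hGb n z, hgb z]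
      simp only [Pi.sub_apply]
      gcongr
      rw [← ofReal_norm, ← ofReal_norm]
      exact ENNReal.ofReal_le_ofReal h2
    · have h2 := (hb.const_mul 2).2.ne
      have h3 : eLpNorm (fun z => (2 : ℝ) * b z) 2 volume ^ 2 = ∫⁻ z, ‖(2 : ℝ) * b z‖ₑ ^ 2 := by
        rw [eLpNorm_eq_lintegral_rpow_enorm_toReal (by norm_num) (by norm_num)]
        simp only [ENNReal.toReal_ofNat, ENNReal.rpow_ofNat]
        rw [← ENNReal.rpow_natCast, ← ENNReal.rpow_mul]
        norm_num
      rw [← h3]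
      exact ENNReal.pow_ne_top h2
    · have h0 : Tendsto (fun n => G n z - g z) atTop (𝓝 0) := by
        simpa using (hlim z).sub_const (g z)
      have := ((ENNReal.continuous_pow 2).tendsto _).comp ((continuous_enorm.tendsto _).comp h0)
      simpa [Function.comp_def] using this
  have := (ENNReal.continuous_rpow_const (y := 1 / 2)).tendsto 0 |>.comp hsq
  simp only [ENNReal.zero_rpow_of_pos (show (0 : ℝ) < 1 / 2 by norm_num)] at this
  refine this.congr fun n => ?_
  simp only [Function.comp_apply]
  rw [← ENNReal.rpow_natCast, ← ENNReal.rpow_mul]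
  norm_num

theorem exists_wiener_bound (hα0 : 0 < α) (hα2 : α ≤ 2) (hs : 1 / 2 + 1 / α < s) :
    ∃ A : ℝ, 0 ≤ A ∧ ∀ (M : ℝ) (f : L2), 0 ≤ M → hsNorm α s f ≤ ENNReal.ofReal M →
      Integrable (𝓕 f : L2) ∧ ∫ k, ‖(𝓕 f : L2) k‖ ≤ A * M := by
  obtain ⟨C, hC, hCle⟩ := exists_lintegral_fourier_le hα0 hα2 hs
  refine ⟨C.toReal, ENNReal.toReal_nonneg, fun M f hM hf => ?_⟩
  have h1 : ∫⁻ k, ‖(𝓕 f : L2) k‖ₑ ≤ C * ENNReal.ofReal M := (hCle f).trans (by gcongr)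
  have hfin : C * ENNReal.ofReal M ≠ ∞ := by finiteness
  refine ⟨⟨Lp.aestronglyMeasurable _, h1.trans_lt hfin.lt_top⟩, ?_⟩
  rw [integral_norm_eq_lintegral_enorm (Lp.aestronglyMeasurable _)]
  refine (ENNReal.toReal_mono hfin h1).trans_eq ?_
  rw [ENNReal.toReal_mul, ENNReal.toReal_ofReal hM]

theorem ae_norm_le {f : L2} {M : ℝ} (h : Integrable (𝓕 f : L2))
    (hM : ∫ k, ‖(𝓕 f : L2) k‖ ≤ M) : ∀ᵐ z : Plane, ‖f z‖ ≤ M := by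
  filter_upwards [ae_eq_fourierInv f h] with z hz
  rw [hz]
  exact (norm_fourierInv_le _ z).trans hM

/-- The derivative of the power nonlinearity is bounded on bounded subsets of `H^s_α`. -/
theorem exists_hsNorm_grad_le {q : ℝ} {N : ℕ} (hN : 1 ≤ N) (hNq : (N : ℝ) ≤ q) (hq : 2 ≤ q)
    (hα0 : 0 < α) (hα2 : α ≤ 2) (hs : 1 / 2 + 1 / α < s) (hsN : s ≤ N) {M : ℝ} (hM : 0 ≤ M) :
    ∃ C : ℝ≥0∞, C ≠ ∞ ∧ ∀ w h : L2, hsNorm α s w ≤ ENNReal.ofReal M →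
      hsNorm α s h ≤ ENNReal.ofReal M →
      ∃ g : L2, (∀ᵐ z : Plane, g z = gradReg q 0 (w z, h z)) ∧ hsNorm α s g ≤ C := by
  have hs0 : 0 < s := lt_trans (by positivity) hs
  obtain ⟨A, hA0, hA⟩ := exists_wiener_bound hα0 hα2 hs
  -- `A * M` bounds the Wiener norms of `w` and `h`, hence their suprema; the `+ 1` only makes the
  -- radius positive.
  set MA := A * M + 1 with hMA
  have hMA0 : 0 < MA := by positivity
  obtain ⟨B, hB0, hB⟩ := exists_norm_iteratedFDeriv_gradReg_le hNq hMA0.le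
  obtain ⟨C₀, hC₀, hC₀le⟩ := exists_energy_comp_le hN hs0 hsN (B := B) hMA0
  -- Since `α ≤ 2`, this order is at most `s`, so the same `N` serves both directions.
  have hr1 : α * s / 2 ≤ N := by nlinarith
  obtain ⟨C₁, hC₁, hC₁le⟩ := exists_energy_comp_le hN (show 0 < α * s / 2 by positivity) hr1
    (B := B) hMA0
  set mm := ENNReal.ofReal M with hmm
  set E : ℝ≥0∞ := ENNReal.ofReal (3 ^ s) * ((ENNReal.ofReal B * (mm + mm)) ^ 2
    + (C₀ * (mm ^ 2 + mm ^ 2) + C₁ * (mm ^ 2 + mm ^ 2))) with hE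
  have hEtop : E ≠ ∞ := by rw [hE]; finiteness
  refine ⟨E ^ (1 / 2 : ℝ), ENNReal.rpow_ne_top_of_nonneg (by norm_num) hEtop, ?_⟩
  intro w h hw hh
  obtain ⟨iw, iwM⟩ := hA M w hM hw
  obtain ⟨ih, ihM⟩ := hA M h hM hh
  replace iwM : ∫ k, ‖(𝓕 w : L2) k‖ ≤ MA := iwM.trans (by linarith)
  replace ihM : ∫ k, ‖(𝓕 h : L2) k‖ ≤ MA := ihM.trans (by linarith)
  set m₁ : Plane → ℂ := ⇑(𝓕 w : L2) with hm₁
  set m₂ : Plane → ℂ := ⇑(𝓕 h : L2) with hm₂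
  have l₁ : MemLp m₁ 2 volume := Lp.memLp _
  have l₂ : MemLp m₂ 2 volume := Lp.memLp _
  have aw : (w : Plane → ℂ) =ᵐ[volume] 𝓕⁻ m₁ := ae_eq_fourierInv w iw
  have ah : (h : Plane → ℂ) =ᵐ[volume] 𝓕⁻ m₂ := ae_eq_fourierInv h ih
  set b : Plane → ℝ := fun z => B * (‖(𝓕⁻ m₁) z‖ + ‖(𝓕⁻ m₂) z‖) with hb
  have hbL : MemLp b 2 volume :=
    ((memLp_fourierInv iw l₁).norm.add (memLp_fourierInv ih l₂).norm).const_mul B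
  have hbN : eLpNorm b 2 volume ≤ ENNReal.ofReal B * (mm + mm) := by
    have e1 : b = B • ((fun z => ‖(𝓕⁻ m₁) z‖) + fun z => ‖(𝓕⁻ m₂) z‖) := rfl
    rw [e1, eLpNorm_const_smul, Real.enorm_eq_ofReal hB0]
    gcongr
    refine (eLpNorm_add_le (memLp_fourierInv iw l₁).norm.1 (memLp_fourierInv ih l₂).norm.1
      (by norm_num)).trans (add_le_add ?_ ?_)
    · rw [eLpNorm_norm, ← eLpNorm_congr_ae aw]
      exact (eLpNorm_le_hsNorm α hs0.le w).trans hw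
    · rw [eLpNorm_norm, ← eLpNorm_congr_ae ah]
      exact (eLpNorm_le_hsNorm α hs0.le h).trans hh
  -- Regularizations tending to zero within `(0, 1]`. All bounds below are uniform in `n`; dominated
  -- convergence in `L²` and lower semicontinuity carry them to `τ = 0`.
  set τ : ℕ → ℝ := fun n => 1 / ((n : ℝ) + 1) with hτ
  have hτ0 : ∀ n, 0 < τ n := fun n => by positivity
  have hτ1 : ∀ n, τ n ≤ 1 := fun n => by
    rw [hτ]; simp only; rw [div_le_one (by positivity)]; linarith [Nat.cast_nonneg (α := ℝ) n]
  have hK0 : ∀ n, gradReg q (τ n) 0 = 0 := fun n => gradReg_zero_right q (τ n) 0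
  have hKN : ∀ n, ContDiff ℝ N (gradReg q (τ n)) := fun n => contDiff_gradReg q (hτ0 n).ne' N
  have hK1 : ∀ n, ContDiff ℝ 1 (gradReg q (τ n)) := fun n =>
    (hKN n).of_le (by exact_mod_cast hN)
  have hBn := fun n => hB (τ n) (hτ0 n) (hτ1 n)
  have hG : ∀ n, MemLp (fun z => gradReg q (τ n) (pairInv m₁ m₂ z)) 2 volume := fun n =>
    memLp_comp_pairInv (hK1 n) (hBn n 1 hN) (hK0 n) hMA0 iw ih l₁ l₂ iwM ihM
  have hGb : ∀ n z, ‖gradReg q (τ n) (pairInv m₁ m₂ z)‖ ≤ b z := by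
    intro n z
    have := norm_sub_le_of_bound (hK1 n) (hBn n 1 hN) (norm_pairInv_le iwM ihM z) (w := 0)
      (by simpa using hMA0.le)
    rw [hK0, sub_zero, sub_zero] at this
    refine this.trans ?_
    rw [hb]
    simp only
    gcongr
    exact max_le (by simp [pairInv]) (by simp [pairInv])
  have hτlim : Tendsto τ atTop (𝓝 0) := tendsto_one_div_add_atTop_nhds_zero_nat
  have hlim : ∀ z, Tendsto (fun n => gradReg q (τ n) (pairInv m₁ m₂ z)) atTop
      (𝓝 (gradReg q 0 (pairInv m₁ m₂ z))) := fun z => (tendsto_gradReg hq _).comp hτlim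
  have hg : MemLp (fun z => gradReg q 0 (pairInv m₁ m₂ z)) 2 volume :=
    hbL.mono' (aestronglyMeasurable_of_tendsto_ae atTop (fun n => (hG n).1)
      (Eventually.of_forall hlim))
      (Eventually.of_forall fun z => le_of_tendsto (hlim z).norm
        (Eventually.of_forall fun n => hGb n z))
  refine ⟨hg.toLp _, ?_, ?_⟩
  · filter_upwards [hg.coeFn_toLp, aw, ah] with z h1 h2 h3
    rw [h1, h2, h3]; rfl
  · have hsq : hsNorm α s (hg.toLp _) ^ 2 ≤ E := by
      rw [hsNorm_sq]
      refine lintegral_mul_fourier_le_of_tendsto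
        (tendsto_toLp_of_dominated hG hg hbL hGb hlim) (by fun_prop)
        (fun k => ENNReal.ofReal_ne_top) fun n => ?_
      rw [← hsNorm_sq]
      refine (hsNorm_sq_le α hs0.le _).trans ?_
      have e0 := hC₀le 0 m₁ m₂ _ iw ih l₁ l₂ iwM ihM (hK0 n) (hKN n) (hBn n) (hG n)
      have e1 := hC₁le 1 m₁ m₂ _ iw ih l₁ l₂ iwM ihM (hK0 n) (hKN n) (hBn n) (hG n)
      rw [hE]
      gcongr
      · rw [eLpNorm_congr_ae (hG n).coeFn_toLp]
        refine (eLpNorm_mono_real (hGb n)).trans hbN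
      · refine e0.trans ?_
        gcongr
        · exact (energy_zero_le α hs0.le w).trans (by gcongr)
        · exact (energy_zero_le α hs0.le h).trans (by gcongr)
      · refine e1.trans ?_
        gcongr
        · exact (energy_one_le α hs0.le w).trans (by gcongr)
        · exact (energy_one_le α hs0.le h).trans (by gcongr)
    calc hsNorm α s (hg.toLp _) = (hsNorm α s (hg.toLp _) ^ 2) ^ (1 / 2 : ℝ) := by
          rw [← ENNReal.rpow_natCast, ← ENNReal.rpow_mul]; norm_num
      _ ≤ E ^ (1 / 2 : ℝ) := by gcongr

/-- Linear dependence on the direction in the estimate of the derivative. -/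
theorem exists_hsNorm_grad_le_mul {q : ℝ} {N : ℕ} (hN : 1 ≤ N) (hNq : (N : ℝ) ≤ q) (hq : 2 ≤ q)
    (hα0 : 0 < α) (hα2 : α ≤ 2) (hs : 1 / 2 + 1 / α < s) (hsN : s ≤ N) {M : ℝ} (hM : 1 ≤ M) :
    ∃ C : ℝ≥0∞, C ≠ ∞ ∧ ∀ w h : L2, hsNorm α s w ≤ ENNReal.ofReal M → MemHs α s h →
      ∃ g : L2, (∀ᵐ z : Plane, g z = gradReg q 0 (w z, h z)) ∧
        hsNorm α s g ≤ C * hsNorm α s h := by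
  have hs0 : 0 < s := lt_trans (by positivity) hs
  obtain ⟨C, hC, hCle⟩ := exists_hsNorm_grad_le hN hNq hq hα0 hα2 hs hsN (M := M) (by linarith)
  refine ⟨C, hC, fun w h hw hh => ?_⟩
  rcases eq_or_ne (hsNorm α s h) 0 with h0 | h0
  · refine ⟨0, ?_, by simp [hsNorm_zero]⟩
    rw [eq_zero_of_hsNorm_eq_zero hs0.le h0]
    filter_upwards [Lp.coeFn_zero ℂ 2 (volume : Measure Plane)] with z hz
    rw [hz, Pi.zero_apply, gradReg_zero_right]
  · set c : ℝ := (hsNorm α s h).toReal with hc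
    have hc0 : 0 < c := ENNReal.toReal_pos h0 hh.ne
    have hcE : ENNReal.ofReal c = hsNorm α s h := ENNReal.ofReal_toReal hh.ne
    -- The direction is normalized to norm `1 ≤ M`, and the result scaled back by linearity.
    obtain ⟨g, hg, hgC⟩ := hCle w (((c⁻¹ : ℝ) : ℂ) • h) hw (by
      rw [hsNorm_smul, ← ofReal_norm, Complex.norm_real, Real.norm_of_nonneg (by positivity),
        ← hcE, ← ENNReal.ofReal_mul (by positivity), inv_mul_cancel₀ hc0.ne']
      exact ENNReal.ofReal_le_ofReal hM)
    refine ⟨(c : ℂ) • g, ?_, ?_⟩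
    · filter_upwards [Lp.coeFn_smul (c : ℂ) g, Lp.coeFn_smul ((c⁻¹ : ℝ) : ℂ) h, hg] with z h1 h2 h3
      rw [h1, Pi.smul_apply, h3, h2, Pi.smul_apply, smul_eq_mul, smul_eq_mul, ← Complex.real_smul,
        ← Complex.real_smul, gradReg_smul, smul_smul, mul_inv_cancel₀ hc0.ne', one_smul]
    · rw [hsNorm_smul, ← ofReal_norm, Complex.norm_real, Real.norm_of_nonneg hc0.le, hcE, mul_comm]
      gcongr

end Nonlinearity

/-! ### Lipschitz continuity of the nonlinearity. -/

section Lipschitz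

variable {α s : ℝ}

theorem measurable_power (p : ℝ) : Measurable (power p) := by
  unfold power; fun_prop

theorem norm_power_le {p : ℝ} (hp : 1 ≤ p) {M : ℝ} {z : ℂ} (hz : ‖z‖ ≤ M) :
    ‖power p z‖ ≤ M ^ (p - 1) * ‖z‖ := by
  rw [power, norm_mul, Complex.norm_real, Real.norm_of_nonneg (by positivity)]
  gcongr

theorem memLp_power {p : ℝ} (hp : 1 ≤ p) {M : ℝ} {f : L2} (hf : ∀ᵐ z : Plane, ‖f z‖ ≤ M) :
    MemLp (fun z => power p (f z)) 2 volume :=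
  (Lp.memLp f).of_le_mul
    ((measurable_power p).comp_aemeasurable (Lp.aestronglyMeasurable f).aemeasurable
      ).aestronglyMeasurable (hf.mono fun _ hz => norm_power_le hp hz)

theorem hsNorm_real_smul (c : ℝ) (f : L2) :
    hsNorm α s (c • f) = ENNReal.ofReal |c| * hsNorm α s f := by
  have : c • f = (c : ℂ) • f := by
    refine Lp.ext ?_
    filter_upwards [Lp.coeFn_smul c f, Lp.coeFn_smul (c : ℂ) f] with z h1 h2
    rw [h1, h2, Pi.smul_apply, Pi.smul_apply, Complex.real_smul, smul_eq_mul]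
  rw [this, hsNorm_smul, ← ofReal_norm, Complex.norm_real, Real.norm_eq_abs]

theorem hsNorm_segment_le {M : ℝ≥0∞} {u v : L2} (hu : hsNorm α s u ≤ M) (hv : hsNorm α s v ≤ M)
    {θ : ℝ} (hθ : θ ∈ Icc (0 : ℝ) 1) : hsNorm α s (v + θ • (u - v)) ≤ M := by
  have e : v + θ • (u - v) = (1 - θ) • v + θ • u := by
    rw [smul_sub, sub_smul, one_smul]; abel
  rw [e]
  refine (hsNorm_add_le _ _).trans ?_
  rw [hsNorm_real_smul, hsNorm_real_smul, abs_of_nonneg hθ.1,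
    abs_of_nonneg (by linarith [hθ.2] : 0 ≤ 1 - θ)]
  calc ENNReal.ofReal (1 - θ) * hsNorm α s v + ENNReal.ofReal θ * hsNorm α s u
      ≤ ENNReal.ofReal (1 - θ) * M + ENNReal.ofReal θ * M := by gcongr
    _ = M := by
        rw [← add_mul, ← ENNReal.ofReal_add (by linarith [hθ.2]) hθ.1]
        simp

theorem hasDerivWithinAt_of_sq_bound {E : Type*} [NormedAddCommGroup E] [NormedSpace ℝ E]
    {f : ℝ → E} {f' : E} {S : Set ℝ} {x D : ℝ}
    (h : ∀ y ∈ S, ‖f y - f x - (y - x) • f'‖ ≤ D * (y - x) ^ 2) : HasDerivWithinAt f f' S x := by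
  rw [hasDerivWithinAt_iff_isLittleO]
  have h1 : (fun y => f y - f x - (y - x) • f') =O[𝓝[S] x] fun y => ‖y - x‖ ^ 2 := by
    refine Asymptotics.IsBigO.of_bound D ?_
    filter_upwards [self_mem_nhdsWithin] with y hy
    simpa using h y hy
  refine h1.trans_isLittleO ?_
  exact (Asymptotics.isLittleO_pow_sub_sub x (by norm_num : 1 < 2)).mono nhdsWithin_le_nhds

/-- The power nonlinearity is Lipschitz on bounded subsets of `H^s_α`. -/
theorem exists_hsNorm_power_sub_le {p : ℝ} (hp : 3 ≤ p) {N : ℕ} (hN : 1 ≤ N)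
    (hNp : (N : ℝ) ≤ p - 1) (hα0 : 0 < α) (hα2 : α ≤ 2) (hs : 1 / 2 + 1 / α < s) (hsN : s ≤ N)
    {M : ℝ} (hM : 1 ≤ M) :
    ∃ C : ℝ≥0∞, C ≠ ∞ ∧ ∀ u v Fu Fv : L2, hsNorm α s u ≤ ENNReal.ofReal M →
      hsNorm α s v ≤ ENNReal.ofReal M → (∀ᵐ z : Plane, Fu z = power p (u z)) →
      (∀ᵐ z : Plane, Fv z = power p (v z)) → hsNorm α s (Fu - Fv) ≤ C * hsNorm α s (u - v) := by
  have hM0 : 0 ≤ M := by linarith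
  obtain ⟨C, hC, hCle⟩ := exists_hsNorm_grad_le_mul hN hNp (by linarith) hα0 hα2 hs hsN hM
  obtain ⟨A, hA0, hA⟩ := exists_wiener_bound hα0 hα2 hs
  set MA := A * M + 1 with hMA
  have hMA0 : 0 < MA := by positivity
  obtain ⟨D, hD0, hD⟩ := norm_power_add_sub_le hp hMA0
  refine ⟨C, hC, fun u v Fu Fv hu hv hFu hFv => ?_⟩
  have hsup : ∀ f : L2, hsNorm α s f ≤ ENNReal.ofReal M → ∀ᵐ z : Plane, ‖f z‖ ≤ MA := by
    intro f hf
    obtain ⟨i1, i2⟩ := hA M f hM0 hf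
    exact ae_norm_le i1 (i2.trans (by linarith))
  set h : L2 := u - v with hh
  have hhs : MemHs α s h :=
    (hsNorm_sub_le u v).trans_lt (ENNReal.add_lt_top.2
      ⟨hu.trans_lt ENNReal.ofReal_lt_top, hv.trans_lt ENNReal.ofReal_lt_top⟩)
  set w : ℝ → L2 := fun θ => v + θ • h with hw
  have hwM : ∀ θ ∈ Icc (0 : ℝ) 1, hsNorm α s (w θ) ≤ ENNReal.ofReal M := fun θ hθ =>
    hsNorm_segment_le hu hv hθ
  have hΦ : ∀ θ : ℝ, ∃ Φ : L2, θ ∈ Icc (0 : ℝ) 1 → ∀ᵐ z : Plane, Φ z = power p (w θ z) := by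
    intro θ
    by_cases hθ : θ ∈ Icc (0 : ℝ) 1
    · have hm := memLp_power (p := p) (by linarith) (hsup _ (hwM θ hθ))
      exact ⟨hm.toLp _, fun _ => hm.coeFn_toLp⟩
    · exact ⟨0, fun h => absurd h hθ⟩
  choose Φ hΦ using hΦ
  have hg : ∀ θ : ℝ, ∃ g : L2, θ ∈ Icc (0 : ℝ) 1 →
      (∀ᵐ z : Plane, g z = gradReg (p - 1) 0 (w θ z, h z)) ∧
        hsNorm α s g ≤ C * hsNorm α s h := by
    intro θ
    by_cases hθ : θ ∈ Icc (0 : ℝ) 1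
    · obtain ⟨g, hg⟩ := hCle (w θ) h (hwM θ hθ) hhs
      exact ⟨g, fun _ => hg⟩
    · exact ⟨0, fun h => absurd h hθ⟩
  choose g hg using hg
  have hbd : ∀ᵐ z : Plane, ‖h z‖ ≤ 2 * MA := by
    filter_upwards [hsup u hu, hsup v hv, Lp.coeFn_sub u v] with z h1 h2 h3
    rw [hh, h3, Pi.sub_apply]
    exact (norm_sub_le _ _).trans (by linarith)
  -- Differentiability is needed in `L²` only: the Taylor remainder is pointwise at most `D (θ' -
  -- θ)² |h|²`, and one factor `|h|` is bounded by `2 * MA`.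
  have hderiv : ∀ θ ∈ Icc (0 : ℝ) 1, HasDerivWithinAt Φ (g θ) (Icc 0 1) θ := by
    intro θ hθ
    refine hasDerivWithinAt_of_sq_bound (D := D * (2 * MA) * ‖h‖) fun θ' hθ' => ?_
    have key : ‖Φ θ' - Φ θ - (θ' - θ) • g θ‖ ≤ (D * (θ' - θ) ^ 2 * (2 * MA)) * ‖h‖ := by
      refine Lp.norm_le_mul_norm_of_ae_le_mul ?_
      have hww : w θ' = w θ + (θ' - θ) • h := by
        simp only [hw, sub_smul]; abel
      have hw1 := Lp.coeFn_add (w θ) ((θ' - θ) • h)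
      rw [← hww] at hw1
      filter_upwards [hΦ θ hθ, hΦ θ' hθ', (hg θ hθ).1, hbd, hw1, Lp.coeFn_smul (θ' - θ) h,
        Lp.coeFn_sub (Φ θ') (Φ θ), Lp.coeFn_sub (Φ θ' - Φ θ) ((θ' - θ) • g θ),
        Lp.coeFn_smul (θ' - θ) (g θ), hsup _ (hwM θ hθ), hsup _ (hwM θ' hθ')]
        with z a1 a2 a3 a4 a5 a6 a7 a8 a9 a10 a11
      rw [Pi.add_apply, a6, Pi.smul_apply] at a5
      rw [a8, Pi.sub_apply, a7, Pi.sub_apply, a9, Pi.smul_apply, a1, a2, a3, ← gradReg_smul, a5]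
      rw [a5] at a11
      refine (hD _ _ a10 a11).trans ?_
      rw [norm_smul, mul_pow, Real.norm_eq_abs, sq_abs, mul_assoc, mul_assoc, mul_assoc]
      gcongr
      nlinarith [norm_nonneg (h z)]
    refine key.trans (le_of_eq (by ring))
  have e1 : Fu = Φ 1 := by
    refine Lp.ext ?_
    have : w 1 = u := by simp [hw, hh]
    filter_upwards [hFu, hΦ 1 (by simp)] with z h1 h2
    rw [h1, h2, this]
  have e0 : Fv = Φ 0 := by
    refine Lp.ext ?_
    have : w 0 = v := by simp [hw]
    filter_upwards [hFv, hΦ 0 (by simp)] with z h1 h2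
    rw [h1, h2, this]
  have hCfin : C * hsNorm α s h ≠ ∞ := ENNReal.mul_ne_top hC hhs.ne
  -- The curve `Φ` is known to be differentiable in `L²`, not in `H^s_α`. Each truncated operator
  -- transports the derivative, and the mean value inequality gives a bound independent of `n`.
  refine hsNorm_le_of_truncOp_le fun n => ?_
  have hT : ∀ θ ∈ Icc (0 : ℝ) 1, HasDerivWithinAt (fun θ => truncOp α s n (Φ θ))
      (truncOp α s n (g θ)) (Icc 0 1) θ := fun θ hθ =>
    (((truncOp α s n).restrictScalars ℝ).hasFDerivAt.comp_hasDerivWithinAt θ (hderiv θ hθ))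
  have hmv := norm_image_sub_le_of_norm_deriv_le_segment_01' hT
    (C := (C * hsNorm α s h).toReal) fun θ hθ => ?_
  · rw [e1, e0, map_sub, ← ofReal_norm]
    exact (ENNReal.ofReal_le_ofReal hmv).trans_eq (ENNReal.ofReal_toReal hCfin)
  · rw [← toReal_enorm]
    exact ENNReal.toReal_mono hCfin
      ((enorm_truncOp_le n _).trans (hg θ (Ico_subset_Icc_self hθ)).2)

end Lipschitz

section Evolution

variable {α s T : ℝ}

/-! ### The propagator -/

theorem fourier_propagator_ae (a : ℝ × ℝ) (t : ℝ) (f : L2) :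
    ((𝓕 (propagator a t f) : L2) : Plane → ℂ) =ᵐ[volume] fun k => phase a t k * (𝓕 f : L2) k := by
  rw [propagator, FourierTransform.fourier_fourierInv_eq]
  exact (memLp_phase_mul a t (𝓕 f)).coeFn_toLp

theorem hsNorm_propagator (a : ℝ × ℝ) (t : ℝ) (f : L2) :
    hsNorm α s (propagator a t f) = hsNorm α s f := by
  refine eLpNorm_congr_norm_ae ((fourier_propagator_ae a t f).mono fun k hk => ?_)
  rw [hk, norm_mul, norm_mul, norm_mul, norm_phase, one_mul]

theorem propagator_sub (a : ℝ × ℝ) (t : ℝ) (f g : L2) :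
    propagator a t (f - g) = propagator a t f - propagator a t g := by
  apply (Lp.fourierTransformₗᵢ Plane ℂ).injective
  change (𝓕 (propagator a t (f - g)) : L2) = (𝓕 (propagator a t f - propagator a t g) : L2)
  refine Lp.ext ?_
  filter_upwards [fourier_propagator_ae a t (f - g), fourier_coe_sub f g,
    fourier_coe_sub (propagator a t f) (propagator a t g), fourier_propagator_ae a t f,
    fourier_propagator_ae a t g] with k h1 h2 h3 h4 h5
  rw [h1, h2, h3, h4, h5]
  ring

/-- A bound for `|phase a t - phase b t|` on `|t| ≤ T`. -/
def phaseGap (T : ℝ) (a b : ℝ × ℝ) (k : Plane) : ℝ :=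
  min 2 (T * |dispersion a k - dispersion b k|)

theorem measurable_dispersion (a : ℝ × ℝ) : Measurable (dispersion a) := by
  unfold dispersion; fun_prop

theorem measurable_phaseGap (T : ℝ) (a b : ℝ × ℝ) : Measurable (phaseGap T a b) :=
  measurable_const.min (measurable_const.mul
    ((measurable_dispersion a).sub (measurable_dispersion b)).abs)

theorem phaseGap_nonneg (hT : 0 ≤ T) (a b : ℝ × ℝ) (k : Plane) : 0 ≤ phaseGap T a b k :=
  le_min (by norm_num) (by positivity)

theorem phaseGap_le_two (T : ℝ) (a b : ℝ × ℝ) (k : Plane) : phaseGap T a b k ≤ 2 := min_le_left _ _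

theorem norm_phase_sub_le {t : ℝ} (ht : |t| ≤ T) (a b : ℝ × ℝ) (k : Plane) :
    ‖phase a t k - phase b t k‖ ≤ phaseGap T a b k := by
  refine le_min ?_ ?_
  · refine (norm_sub_le _ _).trans ?_
    rw [norm_phase, norm_phase]; norm_num
  · have e : phase a t k - phase b t k = phase b t k *
        (Complex.exp (Complex.I * ((t * (dispersion b k - dispersion a k) : ℝ) : ℂ)) - 1) := by
      rw [mul_sub, mul_one, phase, phase, ← Complex.exp_add]
      congr 2
      push_cast; ring
    rw [e, norm_mul, norm_phase, one_mul]
    refine (Real.norm_exp_I_mul_ofReal_sub_one_le).trans ?_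
    rw [Real.norm_eq_abs, abs_mul, abs_sub_comm]
    gcongr

/-- A bound in `H^s_α` for the difference of the two propagators on `[-T, T]`. -/
def gapNorm (T α s : ℝ) (a b : ℝ × ℝ) (f : L2) : ℝ≥0∞ :=
  eLpNorm (fun k : Plane => (phaseGap T a b k : ℂ) * ((sobolevWeight α s k : ℂ) * (𝓕 f : L2) k))
    2 volume

theorem hsNorm_propagator_sub_le {t : ℝ} (ht : |t| ≤ T) (a b : ℝ × ℝ) (f : L2) :
    hsNorm α s (propagator a t f - propagator b t f) ≤ gapNorm T α s a b f := by
  refine eLpNorm_mono_ae ?_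
  filter_upwards [fourier_coe_sub (propagator a t f) (propagator b t f),
    fourier_propagator_ae a t f, fourier_propagator_ae b t f] with k h1 h2 h3
  rw [h1, h2, h3, ← sub_mul, mul_left_comm, norm_mul, norm_mul (phaseGap T a b k : ℂ),
    Complex.norm_real, Real.norm_eq_abs]
  gcongr
  exact (norm_phase_sub_le ht a b k).trans (le_abs_self _)

/-- The gap multiplier is at most `2`, so smallness of the gap at one function extends to its
neighbours in `H^s_α`. -/
theorem gapNorm_le (hT : 0 ≤ T) (a b : ℝ × ℝ) (f g : L2) :
    gapNorm T α s a b f ≤ gapNorm T α s a b g + 2 * hsNorm α s (f - g) := by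
  have hm : ∀ h : L2, AEStronglyMeasurable (fun k : Plane =>
      (phaseGap T a b k : ℂ) * ((sobolevWeight α s k : ℂ) * (𝓕 h : L2) k)) volume := fun h =>
    AEStronglyMeasurable.mul
      (Complex.measurable_ofReal.comp (measurable_phaseGap T a b)).aestronglyMeasurable
      (aestronglyMeasurable_weight_mul α s h)
  have h1 : gapNorm T α s a b f ≤ gapNorm T α s a b g + gapNorm T α s a b (f - g) := by
    refine le_trans (le_of_eq (eLpNorm_congr_ae ?_)) (eLpNorm_add_le (hm g) (hm (f - g))
      (by norm_num))
    filter_upwards [fourier_coe_sub f g] with k hk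
    simp only [hk, Pi.add_apply]
    ring
  refine h1.trans ?_
  gcongr
  have h2 : (2 : ℝ≥0∞) * hsNorm α s (f - g) = eLpNorm ((2 : ℂ) •
      fun k : Plane => (sobolevWeight α s k : ℂ) * (𝓕 (f - g) : L2) k) 2 volume := by
    rw [eLpNorm_const_smul, hsNorm]
    congr 1
    rw [← ofReal_norm]; norm_num
  rw [h2]
  refine eLpNorm_mono fun k => ?_
  rw [norm_mul, Complex.norm_real, Real.norm_of_nonneg (phaseGap_nonneg hT a b k), Pi.smul_apply,
    norm_smul]
  gcongr
  exact (phaseGap_le_two T a b k).trans (by norm_num)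

theorem tendsto_dispersion {b : ℝ × ℝ} (hb₁ : 0 < b.1) (hb₂ : 0 < b.2) (k : Plane) :
    Tendsto (fun a => dispersion a k) (𝓝 b) (𝓝 (dispersion b k)) := by
  unfold dispersion
  have h : ∀ x y : ℝ, 0 < y → Tendsto (fun c : ℝ => x ^ c) (𝓝 y) (𝓝 (x ^ y)) := fun x y hy =>
    (Real.continuousAt_rpow (x, y) (Or.inr hy)).tendsto.comp
      (tendsto_const_nhds.prodMk_nhds tendsto_id)
  exact ((h _ _ hb₁).comp continuous_fst.continuousAt).add
    ((h _ _ hb₂).comp continuous_snd.continuousAt)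

/-- Dominated convergence: the gap tends to zero at each frequency and is at most `2`. The rate
depends on `f`, which is why compactness is needed for curves. -/
theorem tendsto_gapNorm (hT : 0 ≤ T) {b : ℝ × ℝ} (hb₁ : 0 < b.1) (hb₂ : 0 < b.2) {f : L2}
    (hf : MemHs α s f) : Tendsto (fun a => gapNorm T α s a b f) (𝓝 b) (𝓝 0) := by
  have hsq : Tendsto (fun a => gapNorm T α s a b f ^ 2) (𝓝 b) (𝓝 0) := by
    simp_rw [gapNorm, eLpNorm_two_sq]
    have := tendsto_lintegral_filter_of_dominated_convergence (μ := (volume : Measure Plane))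
      (l := 𝓝 b) (F := fun a k => ‖(phaseGap T a b k : ℂ) *
        ((sobolevWeight α s k : ℂ) * (𝓕 f : L2) k)‖ₑ ^ 2) (f := fun _ => 0)
      (fun k => 4 * ‖(sobolevWeight α s k : ℂ) * (𝓕 f : L2) k‖ₑ ^ 2)
      (Eventually.of_forall fun a => ?_)
      (Eventually.of_forall fun a => Eventually.of_forall fun k => ?_) ?_
      (Eventually.of_forall fun k => ?_)
    · simpa using this
    · have h1 := (measurable_phaseGap T a b)
      have h2 := (Lp.stronglyMeasurable (𝓕 f : L2)).measurable
      fun_prop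
    · rw [enorm_mul, mul_pow]
      gcongr
      rw [← ofReal_norm, Complex.norm_real, Real.norm_of_nonneg (phaseGap_nonneg hT a b k),
        ← ENNReal.ofReal_pow (phaseGap_nonneg hT a b k),
        show (4 : ℝ≥0∞) = ENNReal.ofReal (2 ^ 2) by norm_num]
      refine ENNReal.ofReal_le_ofReal ?_
      exact pow_le_pow_left₀ (phaseGap_nonneg hT a b k) (phaseGap_le_two T a b k) 2
    · rw [lintegral_const_mul' _ _ (by simp), ← eLpNorm_two_sq]
      exact ENNReal.mul_ne_top (by simp) (ENNReal.pow_ne_top hf.ne)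
    · have h0 : Tendsto (fun a => phaseGap T a b k) (𝓝 b) (𝓝 0) := by
        have h1 : Tendsto (fun a => T * |dispersion a k - dispersion b k|) (𝓝 b) (𝓝 0) := by
          have := (((tendsto_dispersion hb₁ hb₂ k).sub_const (dispersion b k)).abs).const_mul T
          simpa using this
        exact squeeze_zero (fun a => phaseGap_nonneg hT a b k) (fun a => min_le_right _ _) h1
      have h2 : Tendsto (fun a => (phaseGap T a b k : ℂ) *
          ((sobolevWeight α s k : ℂ) * (𝓕 f : L2) k)) (𝓝 b) (𝓝 0) := by
        have := ((Complex.continuous_ofReal.tendsto 0).comp h0).mul_const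
          ((sobolevWeight α s k : ℂ) * (𝓕 f : L2) k)
        simpa [Function.comp_def] using this
      have := ((ENNReal.continuous_pow 2).tendsto _).comp ((continuous_enorm.tendsto _).comp h2)
      simpa [Function.comp_def] using this
  have := (ENNReal.continuous_rpow_const (y := 1 / 2)).tendsto 0 |>.comp hsq
  simp only [ENNReal.zero_rpow_of_pos (show (0 : ℝ) < 1 / 2 by norm_num)] at this
  refine this.congr fun n => ?_
  simp only [Function.comp_apply]
  rw [← ENNReal.rpow_natCast, ← ENNReal.rpow_mul]
  norm_num

/-- Uniform smallness of the difference of the propagators on compact curves in `H^s_α`. -/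
theorem eventually_gapNorm_le (hT : 0 ≤ T) {b : ℝ × ℝ} (hb₁ : 0 < b.1) (hb₂ : 0 < b.2)
    {F : ℝ → L2} (hF : MemCHs T α s F) {ε : ℝ≥0∞} (hε : 0 < ε) :
    ∀ᶠ a in 𝓝 b, ∀ t ∈ Icc 0 T, gapNorm T α s a b (F t) ≤ ε := by
  -- The property passes to subsets and finite unions. Near `t₀` it holds because a displacement of
  -- size `ε/4` changes the gap by at most `ε/2`.
  refine isCompact_Icc.induction_on (p := fun S => ∀ᶠ a in 𝓝 b, ∀ t ∈ S,
    gapNorm T α s a b (F t) ≤ ε) ?_ ?_ ?_ ?_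
  · simp
  · intro S S' hSS' h
    filter_upwards [h] with a ha t ht using ha t (hSS' ht)
  · intro S S' h h'
    filter_upwards [h, h'] with a ha ha' t ht
    exact ht.elim (ha t) (ha' t)
  · intro t₀ ht₀
    have hε4 : 0 < ε / 4 := ENNReal.div_pos hε.ne' (by simp)
    have hε2 : 0 < ε / 2 := ENNReal.div_pos hε.ne' (by simp)
    refine ⟨{t | hsNorm α s (F t - F t₀) ≤ ε / 4},
      (ENNReal.tendsto_nhds_zero.1 (hF.2 t₀ ht₀)) _ hε4, ?_⟩
    filter_upwards [(ENNReal.tendsto_nhds_zero.1 (tendsto_gapNorm hT hb₁ hb₂ (hF.1 t₀ ht₀))) _ hε2]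
      with a ha t ht
    refine (gapNorm_le hT a b (F t) (F t₀)).trans ?_
    have ht' : hsNorm α s (F t - F t₀) ≤ ε / 4 := ht
    calc _ ≤ ε / 2 + 2 * (ε / 4) := by gcongr
      _ = ε := by
        have : 2 * (ε / 4) = ε / 2 := by
          rw [show (4 : ℝ≥0∞) = 2 * 2 by norm_num, ← mul_div_assoc,
            ENNReal.mul_div_mul_left _ _ (by simp) (by simp)]
        rw [this, ENNReal.add_halves]

/-! ### Curves in `H^s_α` -/

theorem MemCHs.sub {u v : ℝ → L2} (hu : MemCHs T α s u) (hv : MemCHs T α s v) :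
    MemCHs T α s fun t => u t - v t := by
  refine ⟨fun t ht => (hsNorm_sub_le _ _).trans_lt (ENNReal.add_lt_top.2 ⟨hu.1 t ht, hv.1 t ht⟩),
    fun t₀ ht₀ => ?_⟩
  have h := (hu.2 t₀ ht₀).add (hv.2 t₀ ht₀)
  rw [add_zero] at h
  refine tendsto_of_tendsto_of_tendsto_of_le_of_le tendsto_const_nhds h (fun _ => zero_le)
    fun t => ?_
  have e : u t - v t - (u t₀ - v t₀) = (u t - u t₀) - (v t - v t₀) := by abel
  simp only [e]
  exact hsNorm_sub_le _ _

theorem MemCHs.continuousOn {u : ℝ → L2} (hu : MemCHs T α s u) :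
    ContinuousOn (fun t => (hsNorm α s (u t)).toReal) (Icc 0 T) := by
  intro t₀ ht₀
  have h0 := (ENNReal.tendsto_toReal ENNReal.zero_ne_top).comp (hu.2 t₀ ht₀)
  rw [ENNReal.toReal_zero] at h0
  refine tendsto_iff_dist_tendsto_zero.2 (squeeze_zero' (Eventually.of_forall fun t => dist_nonneg)
    ?_ h0)
  filter_upwards [self_mem_nhdsWithin] with t ht
  have hd : hsNorm α s (u t - u t₀) ≠ ∞ := ((hsNorm_sub_le _ _).trans_lt
    (ENNReal.add_lt_top.2 ⟨hu.1 t ht, hu.1 t₀ ht₀⟩)).ne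
  have h1 : hsNorm α s (u t) ≤ hsNorm α s (u t - u t₀) + hsNorm α s (u t₀) := by
    simpa using hsNorm_add_le (α := α) (s := s) (u t - u t₀) (u t₀)
  have h2 : hsNorm α s (u t₀) ≤ hsNorm α s (u t - u t₀) + hsNorm α s (u t) := by
    rw [hsNorm_sub_comm]
    simpa using hsNorm_add_le (α := α) (s := s) (u t₀ - u t) (u t)
  have h1' := ENNReal.toReal_mono (ENNReal.add_ne_top.2 ⟨hd, (hu.1 t₀ ht₀).ne⟩) h1
  have h2' := ENNReal.toReal_mono (ENNReal.add_ne_top.2 ⟨hd, (hu.1 t ht).ne⟩) h2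
  rw [ENNReal.toReal_add hd (hu.1 t₀ ht₀).ne] at h1'
  rw [ENNReal.toReal_add hd (hu.1 t ht).ne] at h2'
  rw [Real.dist_eq, abs_le, Function.comp_apply]
  constructor <;> linarith

/-- Grönwall's inequality together with a continuity argument. -/
theorem le_mul_exp_of_le_integral {y : ℝ → ℝ} {L δ δ' : ℝ} (hy : ContinuousOn y (Icc 0 T))
    (hL : 0 ≤ L) (hδ : 0 ≤ δ) (hδδ' : δ < δ') (hδT : δ' * Real.exp (L * T) ≤ 1)
    (h : ∀ t ∈ Icc 0 T, (∀ t' ∈ Ico 0 t, y t' ≤ 1) → y t ≤ δ + L * ∫ t' in (0 : ℝ)..t, y t') :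
    ∀ t ∈ Icc 0 T, y t < δ' * Real.exp (L * t) := by
  by_contra! hcon
  obtain ⟨t₁, ht₁, hyt₁⟩ := hcon
  set b : ℝ → ℝ := fun t => δ' * Real.exp (L * t) with hb
  have hbc : Continuous b := by fun_prop
  set S := {t ∈ Icc 0 T | b t ≤ y t} with hS
  have hSc : IsClosed S := isClosed_Icc.isClosed_le hbc.continuousOn hy
  have hScomp : IsCompact S := isCompact_Icc.of_isClosed_subset hSc fun t ht => ht.1
  -- First time at which `y` meets the barrier `b t = δ' exp (L t)`. Before it `y < b ≤ 1`, so the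
  -- hypothesis applies at `t` and yields `y t ≤ δ + b t - δ' < b t`, a contradiction.
  obtain ⟨t, ht, hmin⟩ := hScomp.exists_isLeast ⟨t₁, ht₁, hyt₁⟩
  have hδ'0 : 0 < δ' := hδ.trans_lt hδδ'
  have hlt : ∀ t' ∈ Ico 0 t, y t' < b t' := by
    intro t' ht'
    by_contra hc
    have := hmin ⟨⟨ht'.1, ht'.2.le.trans ht.1.2⟩, not_lt.1 hc⟩
    exact absurd ht'.2 (not_lt.2 this)
  have hyI : ContinuousOn y (Icc 0 t) := hy.mono (Icc_subset_Icc_right ht.1.2)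
  have h1 : ∀ t' ∈ Ico 0 t, y t' ≤ 1 := fun t' ht' => (hlt t' ht').le.trans <| le_trans (by
    have : t' ≤ T := ht'.2.le.trans ht.1.2
    change δ' * Real.exp (L * t') ≤ δ' * Real.exp (L * T)
    gcongr) hδT
  have hint : ∫ t' in (0 : ℝ)..t, y t' ≤ ∫ t' in (0 : ℝ)..t, b t' := by
    refine intervalIntegral.integral_mono_on_of_le_Ioo ht.1.1
      (hyI.intervalIntegrable_of_Icc ht.1.1) (hbc.intervalIntegrable _ _) fun x hx => ?_
    exact (hlt x ⟨hx.1.le, hx.2⟩).le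
  have hbint : L * ∫ t' in (0 : ℝ)..t, b t' = b t - b 0 := by
    rw [← intervalIntegral.integral_const_mul]
    refine intervalIntegral.integral_eq_sub_of_hasDerivAt (fun x _ => ?_)
      ((continuous_const.mul hbc).intervalIntegrable _ _)
    have := (((hasDerivAt_id x).const_mul L).exp).const_mul δ'
    refine this.congr_deriv ?_
    simp only [hb, id]; ring
  have hyt := h t ht.1 h1
  have hb0 : b 0 = δ' := by simp [hb]
  have := mul_le_mul_of_nonneg_left hint hL
  have := ht.2
  linarith

end Evolution

section Stability

variable {α s T : ℝ}

/-! ### Stability of the integral equation -/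

/-- `U_a` is an isometry of `H^s_α`, and the change of propagator is made to fall on `g` alone. With
`b` the limit exponents, the gap is thus only evaluated on objects that do not vary with `a`. -/
theorem hsNorm_propagator_sub_propagator_le {t : ℝ} (ht : |t| ≤ T) (a b : ℝ × ℝ) (f g : L2) :
    hsNorm α s (propagator a t f - propagator b t g) ≤
      hsNorm α s (f - g) + gapNorm T α s a b g := by
  have e : propagator a t f - propagator b t g =
      propagator a t (f - g) + (propagator a t g - propagator b t g) := by
    rw [propagator_sub]; abel
  rw [e]
  refine (hsNorm_add_le _ _).trans ?_
  rw [hsNorm_propagator]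
  gcongr
  exact hsNorm_propagator_sub_le ht a b g

theorem hsNorm_duhamel_sub_le {μ t : ℝ} (hμ : |μ| = 1) (ht : t ∈ Icc 0 T) {a b : ℝ × ℝ}
    {f g : L2} {F G : ℝ → L2}
    (hF : IntervalIntegrable (fun t' => propagator a (t - t') (F t')) volume 0 t)
    (hG : IntervalIntegrable (fun t' => propagator b (t - t') (G t')) volume 0 t) :
    hsNorm α s
      ((propagator a t f -
          (Complex.I * (μ : ℂ)) • ∫ t' in (0 : ℝ)..t, propagator a (t - t') (F t')) -
        (propagator b t g -
          (Complex.I * (μ : ℂ)) • ∫ t' in (0 : ℝ)..t, propagator b (t - t') (G t'))) ≤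
      hsNorm α s (f - g) + gapNorm T α s a b g +
        ∫⁻ t' in Ioo 0 t, (hsNorm α s (F t' - G t') + gapNorm T α s a b (G t')) := by
  rw [sub_sub_sub_comm, ← smul_sub, ← intervalIntegral.integral_sub hF hG]
  refine (hsNorm_sub_le _ _).trans (add_le_add
    (hsNorm_propagator_sub_propagator_le (by rw [abs_of_nonneg ht.1]; exact ht.2) a b f g) ?_)
  have hn : ‖Complex.I * (μ : ℂ)‖ₑ = 1 := by
    rw [← ofReal_norm, norm_mul, Complex.norm_I, Complex.norm_real, Real.norm_eq_abs, hμ]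
    simp
  rw [hsNorm_smul, hn, one_mul, intervalIntegral.integral_of_le ht.1]
  refine (hsNorm_integral_le (hF.1.sub hG.1)).trans ?_
  rw [restrict_Ioo_eq_restrict_Ioc]
  refine setLIntegral_mono' measurableSet_Ioc fun t' ht' => ?_
  refine hsNorm_propagator_sub_propagator_le ?_ a b _ _
  rw [abs_of_nonneg (by linarith [ht'.2])]
  linarith [ht'.1, ht.2]

theorem MemCHs.exists_hsNorm_le {u : ℝ → L2} (hu : MemCHs T α s u) :
    ∃ M : ℝ, 0 ≤ M ∧ ∀ t ∈ Icc 0 T, hsNorm α s (u t) ≤ ENNReal.ofReal M := by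
  obtain ⟨M, hM⟩ := (isCompact_Icc.image_of_continuousOn hu.continuousOn).bddAbove
  refine ⟨max M 0, le_max_right _ _, fun t ht => ?_⟩
  rw [← ENNReal.ofReal_toReal (hu.1 t ht).ne]
  exact ENNReal.ofReal_le_ofReal ((hM ⟨t, ht, rfl⟩).trans (le_max_left _ _))

theorem MemCHs.of_lipschitz {u F : ℝ → L2} (hu : MemCHs T α s u) {C : ℝ≥0∞} (hC : C ≠ ∞)
    (h0 : ∀ t ∈ Icc 0 T, hsNorm α s (F t) ≤ C * hsNorm α s (u t))
    (h : ∀ t ∈ Icc 0 T, ∀ t' ∈ Icc 0 T,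
      hsNorm α s (F t - F t') ≤ C * hsNorm α s (u t - u t')) : MemCHs T α s F := by
  refine ⟨fun t ht => (h0 t ht).trans_lt (ENNReal.mul_lt_top hC.lt_top (hu.1 t ht)),
    fun t₀ ht₀ => ?_⟩
  have h1 := ENNReal.Tendsto.const_mul (hu.2 t₀ ht₀) (Or.inr hC)
  rw [mul_zero] at h1
  refine tendsto_of_tendsto_of_tendsto_of_le_of_le' tendsto_const_nhds h1
    (Eventually.of_forall fun _ => zero_le) ?_
  filter_upwards [self_mem_nhdsWithin] with t ht using h t ht t₀ ht₀

theorem toReal_le_of_le_lintegral {w : ℝ → L2} (hw : MemCHs T α s w) {L δ ε t : ℝ} (hL : 0 ≤ L)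
    (hδ : 0 ≤ δ) (hε : 0 ≤ ε) (ht : t ∈ Icc 0 T)
    (h : hsNorm α s (w t) ≤ ENNReal.ofReal δ +
      ∫⁻ t' in Ioo 0 t, (ENNReal.ofReal L * hsNorm α s (w t') + ENNReal.ofReal ε)) :
    (hsNorm α s (w t)).toReal ≤
      δ + T * ε + L * ∫ t' in (0 : ℝ)..t, (hsNorm α s (w t')).toReal := by
  set y : ℝ → ℝ := fun t => (hsNorm α s (w t)).toReal with hy
  have hyc : ContinuousOn y (Icc 0 t) := hw.continuousOn.mono (Icc_subset_Icc_right ht.2)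
  have hyi : IntervalIntegrable y volume 0 t := hyc.intervalIntegrable_of_Icc ht.1
  have hy0 : ∀ t, 0 ≤ y t := fun t => ENNReal.toReal_nonneg
  have hgi : IntervalIntegrable (fun t' => L * y t' + ε) volume 0 t :=
    (hyi.const_mul L).add intervalIntegrable_const
  have e : ∫⁻ t' in Ioo 0 t, (ENNReal.ofReal L * hsNorm α s (w t') + ENNReal.ofReal ε) =
      ENNReal.ofReal (∫ t' in (0 : ℝ)..t, (L * y t' + ε)) := by
    rw [intervalIntegral.integral_of_le ht.1, ofReal_integral_eq_lintegral_ofReal hgi.1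
      (Eventually.of_forall fun t' => add_nonneg (mul_nonneg hL (hy0 t')) hε),
      restrict_Ioo_eq_restrict_Ioc]
    refine setLIntegral_congr_fun measurableSet_Ioc fun t' ht' => ?_
    rw [ENNReal.ofReal_add (mul_nonneg hL (hy0 t')) hε, ENNReal.ofReal_mul hL, hy,
      ENNReal.ofReal_toReal (hw.1 t' ⟨ht'.1.le, ht'.2.trans ht.2⟩).ne]
  have hI0 : 0 ≤ ∫ t' in (0 : ℝ)..t, (L * y t' + ε) :=
    intervalIntegral.integral_nonneg ht.1 fun t' _ => add_nonneg (mul_nonneg hL (hy0 t')) hε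
  rw [e, ← ENNReal.ofReal_add hδ hI0] at h
  have h1 := ENNReal.toReal_le_of_le_ofReal (add_nonneg hδ hI0) h
  rw [intervalIntegral.integral_add (hyi.const_mul L) intervalIntegrable_const,
    intervalIntegral.integral_const_mul, intervalIntegral.integral_const, smul_eq_mul,
    sub_zero] at h1
  have := mul_le_mul_of_nonneg_right ht.2 hε
  linarith

theorem power_zero {p : ℝ} : power p 0 = 0 := by simp [power]

/-- Convergence of solutions in `C([0,T]; H^s_α)`, for a family of data and exponents. -/
theorem tendsto_cHsDist {p μ : ℝ} (hp : 3 ≤ p) (hT : 0 < T) (hμ : |μ| = 1) (hα0 : 0 < α)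
    (hα2 : α ≤ 2) (hs : 1 / 2 + 1 / α < s) (hsp : s ≤ (⌊p⌋ : ℝ) - 1) {A : Set (ℝ × ℝ)}
    {b : ℝ × ℝ} (hb : b ∈ A) (hb₁ : 0 < b.1) (hb₂ : 0 < b.2) {u₀ : ℝ × ℝ → L2}
    {u : ℝ × ℝ → ℝ → L2} (hu₀ : MemHs α s (u₀ b)) (hu : ∀ a ∈ A, MemCHs T α s (u a))
    (hsol : ∀ a ∈ A, IsSolution T p μ a (u₀ a) (u a))
    (hdata : Tendsto (fun a => hsNorm α s (u₀ a - u₀ b)) (𝓝[A] b) (𝓝 0)) :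
    Tendsto (fun a => cHsDist T α s (u a) (u b)) (𝓝[A] b) (𝓝 0) := by
  obtain ⟨G, hG, hGsol⟩ := hsol b hb
  obtain ⟨M, hM0, hM⟩ := (hu b hb).exists_hsNorm_le
  have hfl : (3 : ℤ) ≤ ⌊p⌋ := Int.le_floor.2 (by exact_mod_cast hp)
  -- `N = ⌊p⌋ - 1` is the largest integer at most `p - 1`, and `s ≤ N`.
  obtain ⟨N, hN⟩ := Int.eq_ofNat_of_zero_le (show 0 ≤ ⌊p⌋ - 1 by omega)
  have hNr : (N : ℝ) = (⌊p⌋ : ℝ) - 1 := by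
    have : ((⌊p⌋ - 1 : ℤ) : ℝ) = ((N : ℤ) : ℝ) := by rw [hN]
    push_cast at this
    linarith
  -- The radius `M + 1` leaves room for every `u a t` within distance one of `u b t`, the bootstrap
  -- assumption below.
  obtain ⟨C, hC, hlip⟩ := exists_hsNorm_power_sub_le (α := α) (s := s) (p := p) hp
    (N := N) (by omega) (by rw [hNr]; linarith [Int.floor_le p]) hα0 hα2 hs (by rwa [hNr])
    (M := M + 1) (by linarith)
  have hvM : ∀ t ∈ Icc 0 T, hsNorm α s (u b t) ≤ ENNReal.ofReal (M + 1) := fun t ht =>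
    (hM t ht).trans (ENNReal.ofReal_le_ofReal (by linarith))
  -- Continuity of the limit nonlinearity in `H^s_α` is what allows the compactness argument for the
  -- propagators.
  have hGc : MemCHs T α s G := by
    refine (hu b hb).of_lipschitz hC (fun t ht => ?_) fun t ht t' ht' =>
      hlip _ _ _ _ (hvM t ht) (hvM t' ht') (hG t ht) (hG t' ht')
    have h0 : ∀ᵐ z : Plane, (0 : L2) z = power p ((0 : L2) z) := by
      filter_upwards [Lp.coeFn_zero ℂ 2 (volume : Measure Plane)] with z hz
      rw [hz, Pi.zero_apply, power_zero]
    have := hlip (u b t) 0 (G t) 0 (hvM t ht) (by simp [hsNorm_zero]) (hG t ht) h0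
    rwa [sub_zero, sub_zero] at this
  set L := C.toReal with hL
  have hL0 : 0 ≤ L := ENNReal.toReal_nonneg
  have hCL : C = ENNReal.ofReal L := (ENNReal.ofReal_toReal hC).symm
  rw [ENNReal.tendsto_nhds_zero]
  intro ε hε
  obtain ⟨e, he0, he1, heε⟩ : ∃ e : ℝ, 0 < e ∧ e ≤ 1 ∧ ENNReal.ofReal e ≤ ε := by
    rcases eq_or_ne ε ∞ with rfl | hε'
    · exact ⟨1, one_pos, le_rfl, le_top⟩
    · refine ⟨min 1 ε.toReal, lt_min one_pos (ENNReal.toReal_pos hε.ne' hε'), min_le_left _ _, ?_⟩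
      exact (ENNReal.ofReal_le_ofReal (min_le_right _ _)).trans ENNReal.ofReal_toReal_le
  -- The barrier `δ exp (L t)` reaches exactly `e ≤ 1` at time `T`. The choice of `η` makes the
  -- total error `δ/2`: one `η` from the data, one from the propagators on the limit data, and `T η`
  -- from the propagators on the limit nonlinearity.
  set δ := e * Real.exp (-(L * T)) with hδ
  have hδ0 : 0 < δ := by positivity
  have hδT : δ * Real.exp (L * T) = e := by
    rw [hδ, mul_assoc, ← Real.exp_add, neg_add_cancel, Real.exp_zero, mul_one]
  set η := δ / (2 * (2 + T)) with hη
  have hη0 : 0 < η := by positivity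
  have hηδ : 2 * η + T * η < δ := by
    have : 2 * η + T * η = δ / 2 := by rw [hη]; field_simp
    rw [this]; linarith
  have hηpos : (0 : ℝ≥0∞) < ENNReal.ofReal η := ENNReal.ofReal_pos.2 hη0
  filter_upwards [self_mem_nhdsWithin, ENNReal.tendsto_nhds_zero.1 hdata _ hηpos,
    (ENNReal.tendsto_nhds_zero.1 (tendsto_gapNorm hT.le hb₁ hb₂ hu₀) _ hηpos).filter_mono
      nhdsWithin_le_nhds,
    (eventually_gapNorm_le hT.le hb₁ hb₂ hGc hηpos).filter_mono nhdsWithin_le_nhds]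
    with a ha h1 h2 h3
  obtain ⟨F, hF, hFsol⟩ := hsol a ha
  have hw : MemCHs T α s (fun t => u a t - u b t) := (hu a ha).sub (hu b hb)
  have key := le_mul_exp_of_le_integral (L := L) (δ := 2 * η + T * η) (δ' := δ)
    hw.continuousOn hL0 (by positivity) hηδ (hδT.trans_le he1) ?_
  · refine iSup₂_le fun t ht => le_trans ?_ heε
    rw [← ENNReal.ofReal_toReal (hw.1 t ht).ne]
    refine ENNReal.ofReal_le_ofReal ((key t ht).le.trans ?_)
    rw [← hδT]
    have := ht.2
    gcongr
  · intro t ht hle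
    refine toReal_le_of_le_lintegral hw hL0 (by positivity) hη0.le ht ?_
    obtain ⟨hFi, hFt⟩ := hFsol t ht
    obtain ⟨hGi, hGt⟩ := hGsol t ht
    rw [hFt, hGt]
    refine (hsNorm_duhamel_sub_le hμ ht hFi hGi).trans (add_le_add ?_ ?_)
    · rw [two_mul, ENNReal.ofReal_add hη0.le hη0.le]
      exact add_le_add h1 h2
    · refine setLIntegral_mono' measurableSet_Ioo fun t' ht' => ?_
      have htT : t' ∈ Icc 0 T := ⟨ht'.1.le, ht'.2.le.trans ht.2⟩
      refine add_le_add ?_ (h3 t' htT)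
      rw [← hCL]
      refine hlip _ _ _ _ ?_ (hvM t' htT) (hF t' htT) (hG t' htT)
      have e1 : u a t' = u b t' + (u a t' - u b t') := by abel
      rw [e1, ENNReal.ofReal_add hM0 zero_le_one]
      refine (hsNorm_add_le _ _).trans (add_le_add (hM t' htT) ?_)
      rw [← ENNReal.ofReal_toReal (hw.1 t' htT).ne]
      exact ENNReal.ofReal_le_ofReal (hle t' ⟨ht'.1.le, ht'.2⟩)

end Stability

end MixedNLS

end

open MixedNLS in
theorem theorem3
    (p T s μ α₁ α₂ α : ℝ)
    (hp : 3 ≤ p) (hT : 0 < T) (hμ : μ = 1 ∨ μ = -1)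
    (hα₂₁ : α₂ ≤ α₁) (hα : α = 2 * α₂ / α₁)
    (hs : 1 / 2 + 1 / α < s) (hsp : s ≤ (⌊p⌋ : ℝ) - 1)
    -- the set of dispersion exponents through which `(α₁', α₂') → (α₁, α₂)`
    (A : Set (ℝ × ℝ)) (hA : A ⊆ admissible) (hαA : (α₁, α₂) ∈ A)
    -- the data and the solutions, indexed by the exponents
    (u₀ : ℝ × ℝ → L2) (u : ℝ × ℝ → ℝ → L2)
    (hu₀ : ∀ a ∈ A, MemHs α s (u₀ a))
    (hu : ∀ a ∈ A, MemCHs T α s (u a))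
    (hsol : ∀ a ∈ A, IsSolution T p μ a (u₀ a) (u a))
    (hdata : Tendsto (fun a => hsNorm α s (u₀ a - u₀ (α₁, α₂))) (𝓝[A] (α₁, α₂)) (𝓝 0))
    (c R : ℝ) (hc : 0 < c) (hR : 0 < R)
    (hbound : ∀ a ∈ A, |α₁ - a.1| + |α₂ - a.2| < R →
      lqLinftyNorm T (p - 1) (u a)
        ≤ ENNReal.ofReal c * lqLinftyNorm T (p - 1) (u (α₁, α₂)))
    (hfin : lqLinftyNorm T (p - 1) (u (α₁, α₂)) < ∞) :
    Tendsto (fun a => cHsDist T α s (u a) (u (α₁, α₂))) (𝓝[A] (α₁, α₂)) (𝓝 0) := by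
  obtain ⟨⟨h1, -, -⟩, ⟨h2, -, -⟩⟩ := hA hαA
  have hα0 : 0 < α := by rw [hα]; positivity
  have hα2 : α ≤ 2 := by rw [hα, div_le_iff₀ h1]; linarith
  have hμ1 : |μ| = 1 := by rcases hμ with rfl | rfl <;> simp
  exact tendsto_cHsDist hp hT hμ1 hα0 hα2 hs hsp hαA h1 h2 (hu₀ _ hαA) hu hsol hdata
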